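/- Let $f\in\mathbb Q^2\setminus\mathbb Z^2$ and let $R=[r^1,\dots,r^k]\in\mathbb Q^{2\times k}$ have nonzero columns with $\mathrm{cone}\{r^1,\dots,r^k\}=\mathbb R^2$. Put $P(R,f)=\{(x,s)\in\mathbb Z^2\times\mathbb R^k_+ : x=f+Rs\}$ and let $P(R,f)^0\subseteq\mathbb R^2\times\mathbb R^k_+$ be its linear relaxation. For $\mathcal Q\subseteq\mathbb R^2\times\mathbb R^k$, its split closure is the intersection over all $\pi\in\mathbb Z^2,\pi_0\in\mathbb Z$ of $\mathrm{conv}\big((\mathcal Q\cap\{\pi^Tx\le\pi_0\})\cup(\mathcal Q\cap\{\pi^Tx\ge\pi_0+1\})\big)$, and the split rank of an inequality is the least $n\ge 0$ such that it is valid for the $n$-fold split closure of $P(R,f)^0$ ($+\infty$ if there is none). For $\alpha\in\mathbb R^k_+$ the induced set of $\sum_i\alpha_is_i\ge1$ is $L_\alpha=\mathrm{conv}(\{f+r^i/\alpha_i:\alpha_i>0\}\cup\{f\})+\mathrm{cone}\{r^i:\alpha_i=0\}$. For a closed convex lattice-free set $B$ (no integer point in its interior) with $f\in\mathrm{int}\,B$,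 let $\phi(B)_i=0$ if $r^i$ is in the recession cone of $B$ and otherwise let $\phi(B)_i$ be the $\lambda>0$ with $f+r^i/\lambda\in\partial B$; write $\phi(B)$ also for the inequality $\sum_i\phi(B)_is_i\ge1$. A lattice-free triangle is of type $T^1$ if its vertices are integral and each side has exactly one integer point in its relative interior; of type $T^{2A}$ if it has a non-integral vertex whose opposite side contains at least two integer points and whose two incident sides each have exactly one integer point in their relative interior; of type $T^{2B}$ if it has a non-integral vertex whose opposite side contains at least two integer points and of whose two incident sides one has exactly one and the other no integer point in its relative interior, and it is contained in a triangle of type $T^{2A}$. A convex quadrilateral is of type $Q^1$ if it is a subset of a triangle of type $T^1$ or $T^{2A}$ and, in some order of its sides, the first contains at least two integer points, the second and the third at least one each, and the fourth none in its relative interior. **Proposition.** (1) Let $\sum_i\alpha_is_i\ge1$, $\alpha\ge 0$, be valid for $\mathrm{conv}(P(R,f))$ and let $L_\alpha$ be a quadrilateral of type $Q^1$. Then its split rank is finite. If moreover $L_\alpha$ lies in a triangle of type $T^1$, then there are a unimodular $M\in\mathbb Z^{2\times2}$, a vector $w\in\mathbb Z^2$, a matrix $R'\in\mathbb Q^{2\times4}$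 and $\alpha'\in\mathbb R^4$ such that, with $f'=M(f+w)$, the data $(f',R',\alpha')$ are in the standard position described in (2), $M(L_\alpha+w)\subseteq L_{\alpha'}$, the split rank of $\alpha$ is at most that of $\alpha'$ (with respect to $P(R',f')^0$), and it is at most one more than the maximum of the split ranks of $\phi(U)$ and $\phi(V)$, for the triangles $U,V$ constructed in (2) from $(f',R')$. (2) Let $k=4$, $\alpha>0$, and let $(f,R,\alpha)$ be in standard position: $f+r^1/\alpha_1=(0,2)$, $f+r^2/\alpha_2=(1+\delta,1-\delta)$, $f+r^3/\alpha_3=(\gamma,0)$, $f+r^4/\alpha_4=(0,0)$ for some $0<\delta<1<\gamma<2$, and $r^2_2<0$, $r^3_1+r^3_2>0$. Let $x^2$ be the point of the ray from $f$ along $r^2$ with second coordinate $0$, and $p^1$ the point of the ray along $r^1$ on the line through $x^2$ and $(1,1)$; let $x^3$ be the point of the ray along $r^3$ on the line $x_1+x_2=2$, and $p^4$ the point of the ray along $r^4$ on the line through $x^3$ and $(1,0)$. These points exist; put $U=\mathrm{conv}\{p^1,x^2,(0,0)\}$ and $V=\mathrm{conv}\{(0,2),x^3,p^4\}$. Then $U$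 and $V$ are triangles of type $T^{2B}$ with $f$ in their interiors, $L_{\phi(U)}=U$, $L_{\phi(V)}=V$, and $\phi(U)$, $\phi(V)$ have finite split rank. The inequality $\sum_i\alpha_is_i\ge1$ is valid for $\mathrm{conv}\big((Q\cap\{x_1\le0\})\cup(Q\cap\{x_1\ge1\})\big)$, where $Q$ is the set of points of $P(R,f)^0$ satisfying $\phi(U)$ and $\phi(V)$; and its split rank is at most one more than the maximum of the split ranks of $\phi(U)$ and $\phi(V)$. -/

import Mathlib

open Set

noncomputable section

/-! ### Mixed integer sets, split closures and split rank -/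

/-- The set obtained from `Q ⊆ ℝ^p × ℝ^q` by the split disjunction
`π x ≤ π₀ ∨ π x ≥ π₀ + 1`: the convex hull of the two pieces of `Q`. -/
def splitSet {p q : ℕ} (Q : Set ((Fin p → ℝ) × (Fin q → ℝ))) (π : Fin p → ℤ) (π₀ : ℤ) :
    Set ((Fin p → ℝ) × (Fin q → ℝ)) :=
  convexHull ℝ
    ((Q ∩ {z | ∑ i, (π i : ℝ) * z.1 i ≤ (π₀ : ℝ)}) ∪
      (Q ∩ {z | (π₀ : ℝ) + 1 ≤ ∑ i, (π i : ℝ) * z.1 i}))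

/-- The first split closure. -/
def splitClosure {p q : ℕ} (Q : Set ((Fin p → ℝ) × (Fin q → ℝ))) :
    Set ((Fin p → ℝ) × (Fin q → ℝ)) :=
  ⋂ (π : Fin p → ℤ) (π₀ : ℤ), splitSet Q π π₀

/-- The `n`-th split closure; the `0`-th one is `Q` itself. -/
def iterSplitClosure {p q : ℕ} (n : ℕ) (Q : Set ((Fin p → ℝ) × (Fin q → ℝ))) :
    Set ((Fin p → ℝ) × (Fin q → ℝ)) :=
  splitClosure^[n] Q

/-- The inequality `a x + b y ≤ γ` holds on all of `Q`. -/
def ValidOn {p q : ℕ} (Q : Set ((Fin p → ℝ) × (Fin q → ℝ)))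
    (a : Fin p → ℝ) (b : Fin q → ℝ) (γ : ℝ) : Prop :=
  ∀ z ∈ Q, ∑ i, a i * z.1 i + ∑ j, b j * z.2 j ≤ γ

/-- The split rank of `a x + b y ≤ γ` with respect to `Q`: the least `n` such that the inequality
is valid for the `n`-th split closure of `Q`, and `⊤` if there is no such `n`. -/
def splitRank {p q : ℕ} (Q : Set ((Fin p → ℝ) × (Fin q → ℝ)))
    (a : Fin p → ℝ) (b : Fin q → ℝ) (γ : ℝ) : ℕ∞ :=
  ⨅ (n : ℕ) (_ : ValidOn (iterSplitClosure n Q) a b γ), (n : ℕ∞)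

/-! ### The sets `P(R, f)` and the inequalities `∑ αᵢ sᵢ ≥ 1` -/

/-- The linear relaxation `{(x, s) | x = f + R s, s ≥ 0}`; the columns of `R` are
`R 0, …, R (k - 1)`. -/
def relaxP {k : ℕ} (f : Fin 2 → ℝ) (R : Fin k → Fin 2 → ℝ) :
    Set ((Fin 2 → ℝ) × (Fin k → ℝ)) :=
  {z | z.1 = f + ∑ i, z.2 i • R i ∧ ∀ i, 0 ≤ z.2 i}

/-- The integer points of the plane. -/
def latticePoints : Set (Fin 2 → ℝ) := {x | ∃ z : Fin 2 → ℤ, x = fun i => (z i : ℝ)}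

/-- The vector `x` has rational coordinates. -/
def IsRationalVec (x : Fin 2 → ℝ) : Prop := ∃ z : Fin 2 → ℚ, x = fun i => (z i : ℝ)

/-- The mixed integer set `P(R, f)`. -/
def mixedP {k : ℕ} (f : Fin 2 → ℝ) (R : Fin k → Fin 2 → ℝ) :
    Set ((Fin 2 → ℝ) × (Fin k → ℝ)) :=
  {z | z ∈ relaxP f R ∧ z.1 ∈ latticePoints}

/-- The inequality `∑ αᵢ sᵢ ≥ 1`, written as `0 x + (-α) s ≤ -1`, is valid on `Q`. -/
def CutValidOn {k : ℕ} (Q : Set ((Fin 2 → ℝ) × (Fin k → ℝ))) (α : Fin k → ℝ) : Prop :=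
  ValidOn Q 0 (-α) (-1)

/-- The split rank of `∑ αᵢ sᵢ ≥ 1` with respect to the linear relaxation of `P(R, f)`. -/
def cutRank {k : ℕ} (f : Fin 2 → ℝ) (R : Fin k → Fin 2 → ℝ) (α : Fin k → ℝ) : ℕ∞ :=
  splitRank (relaxP f R) 0 (-α) (-1)

/-- Standing assumptions on the data: `f` is rational and not integral, the columns of `R` are
rational and nonzero, and they generate the whole plane as a cone. -/
structure IsPlaneData {k : ℕ} (f : Fin 2 → ℝ) (R : Fin k → Fin 2 → ℝ) : Prop where
  f_rational : IsRationalVec f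
  f_notMem : f ∉ latticePoints
  R_rational : ∀ i, IsRationalVec (R i)
  R_ne_zero : ∀ i, R i ≠ 0
  cone_eq_top : PointedCone.hull ℝ (range R) = ⊤

/-- The induced set
`L_α = conv ({f + rⁱ / αᵢ | αᵢ > 0} ∪ {f}) + cone {rⁱ | αᵢ = 0}`. -/
def inducedSet {k : ℕ} (f : Fin 2 → ℝ) (R : Fin k → Fin 2 → ℝ) (α : Fin k → ℝ) :
    Set (Fin 2 → ℝ) :=
  {x | ∃ y ∈ convexHull ℝ ({y | ∃ i, 0 < α i ∧ y = f + (α i)⁻¹ • R i} ∪ {f}),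
    ∃ d ∈ PointedCone.hull ℝ {r | ∃ i, α i = 0 ∧ r = R i}, x = y + d}

/-- The recession cone of a convex set. -/
def recCone (B : Set (Fin 2 → ℝ)) : Set (Fin 2 → ℝ) :=
  {d | ∀ x ∈ B, ∀ t : ℝ, 0 ≤ t → x + t • d ∈ B}

open Classical in
/-- The coefficient vector `φ(B)` of the intersection cut given by a closed convex set `B` with
`f` in its interior. If `rⁱ` is not in the recession cone of `B`, then the set below has exactly
one element. -/
def phi {k : ℕ} (f : Fin 2 → ℝ) (R : Fin k → Fin 2 → ℝ) (B : Set (Fin 2 → ℝ)) : Fin k → ℝ :=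
  fun i => if R i ∈ recCone B then 0
    else sInf {t : ℝ | 0 < t ∧ f + t⁻¹ • R i ∈ frontier B}

/-! ### Lattice-free triangles and quadrilaterals -/

/-- No integer point in the interior. -/
def LatticeFree (S : Set (Fin 2 → ℝ)) : Prop := Disjoint (interior S) latticePoints

/-- The segment `[a, b]` has exactly one integer point in its relative interior. -/
def OneInside (a b : Fin 2 → ℝ) : Prop := ∃! p, p ∈ openSegment ℝ a b ∩ latticePoints

/-- `v` lists the three vertices of the triangle `S`. -/
def IsTriangle (S : Set (Fin 2 → ℝ)) (v : Fin 3 → Fin 2 → ℝ) : Prop :=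
  AffineIndependent ℝ v ∧ S = convexHull ℝ (range v)

/-- Triangles of type `T¹`. -/
def IsT1 (S : Set (Fin 2 → ℝ)) : Prop :=
  LatticeFree S ∧ ∃ v, IsTriangle S v ∧ (∀ i, v i ∈ latticePoints) ∧
    OneInside (v 0) (v 1) ∧ OneInside (v 1) (v 2) ∧ OneInside (v 2) (v 0)

/-- Triangles of type `T²ᴬ`: `v 0` is the distinguished non-integral vertex. -/
def IsT2A (S : Set (Fin 2 → ℝ)) : Prop :=
  LatticeFree S ∧ ∃ v, IsTriangle S v ∧ v 0 ∉ latticePoints ∧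
    (segment ℝ (v 1) (v 2) ∩ latticePoints).Nontrivial ∧
    OneInside (v 0) (v 1) ∧ OneInside (v 0) (v 2)

/-- Triangles of type `T²ᴮ`: `v 0` is the distinguished non-integral vertex. -/
def IsT2B (S : Set (Fin 2 → ℝ)) : Prop :=
  LatticeFree S ∧ (∃ v, IsTriangle S v ∧ v 0 ∉ latticePoints ∧
    (segment ℝ (v 1) (v 2) ∩ latticePoints).Nontrivial ∧
    OneInside (v 0) (v 1) ∧ openSegment ℝ (v 0) (v 2) ∩ latticePoints = ∅) ∧
  ∃ T, IsT2A T ∧ S ⊆ T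

/-- Twice the signed area of the triangle `a b c`. -/
def orient (a b c : Fin 2 → ℝ) : ℝ :=
  (b 0 - a 0) * (c 1 - a 1) - (b 1 - a 1) * (c 0 - a 0)

/-- `v` lists the four vertices of the convex quadrilateral `S` in counterclockwise order
(indices are cyclic): there is a strict left turn at every vertex. -/
def IsQuadrilateral (S : Set (Fin 2 → ℝ)) (v : Fin 4 → Fin 2 → ℝ) : Prop :=
  (∀ i, 0 < orient (v i) (v (i + 1)) (v (i + 2))) ∧ S = convexHull ℝ (range v)

/-- Quadrilaterals of type `Q¹`. Side `i` joins `v i` and `v (i + 1)`; the sides are named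
`σ 0, σ 1, σ 2, σ 3` in an arbitrary order. -/
def IsQ1 (S : Set (Fin 2 → ℝ)) : Prop :=
  (∃ T, (IsT1 T ∨ IsT2A T) ∧ S ⊆ T) ∧
  ∃ v, IsQuadrilateral S v ∧ ∃ σ : Equiv.Perm (Fin 4),
    (segment ℝ (v (σ 0)) (v (σ 0 + 1)) ∩ latticePoints).Nontrivial ∧
    (segment ℝ (v (σ 1)) (v (σ 1 + 1)) ∩ latticePoints).Nonempty ∧
    (segment ℝ (v (σ 2)) (v (σ 2 + 1)) ∩ latticePoints).Nonempty ∧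
    openSegment ℝ (v (σ 3)) (v (σ 3 + 1)) ∩ latticePoints = ∅

/-! ### The standard quadrilateral inside a `T¹` triangle and the two auxiliary triangles -/

/-- Integral translation by `w` followed by the linear map given by the integral matrix `M`. -/
def intAffine (M : Matrix (Fin 2) (Fin 2) ℤ) (w : Fin 2 → ℤ) (x : Fin 2 → ℝ) : Fin 2 → ℝ :=
  (M.map (fun z : ℤ => (z : ℝ))).mulVec (x + fun i => (w i : ℝ))

/-- Standard position: the points `f + rⁱ / αᵢ` are `(0,2)`, `(1+δ,1-δ)`, `(γ,0)`, `(0,0)`, the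
second ray meets the line `x₂ = 0` beyond its point and the third ray meets the line
`x₁ + x₂ = 2` beyond its point. -/
structure IsStandardQ1 (f : Fin 2 → ℝ) (R : Fin 4 → Fin 2 → ℝ) (α : Fin 4 → ℝ) : Prop where
  data : IsPlaneData f R
  pos : ∀ i, 0 < α i
  vertices : ∃ δ γ : ℝ, 0 < δ ∧ δ < 1 ∧ 1 < γ ∧ γ < 2 ∧
    f + (α 0)⁻¹ • R 0 = ![0, 2] ∧ f + (α 1)⁻¹ • R 1 = ![1 + δ, 1 - δ] ∧
    f + (α 2)⁻¹ • R 2 = ![γ, 0] ∧ f + (α 3)⁻¹ • R 3 = ![0, 0]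
  second : R 1 1 < 0
  third : 0 < R 2 0 + R 2 1

/-- `U` is the triangle with vertices `p¹, x², (0,0)`, where `x²` is the point of the second ray
on the line `x₂ = 0` and `p¹` is the point of the first ray on the line through `x²` and `(1,1)`. -/
def IsTriangleU (f : Fin 2 → ℝ) (R : Fin 4 → Fin 2 → ℝ) (U : Set (Fin 2 → ℝ)) : Prop :=
  ∃ x₂ p₁ : Fin 2 → ℝ,
    (∃ t : ℝ, 0 < t ∧ x₂ = f + t • R 1) ∧ x₂ 1 = 0 ∧
    (∃ t : ℝ, 0 < t ∧ p₁ = f + t • R 0) ∧ p₁ ∈ affineSpan ℝ {x₂, ![1, 1]} ∧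
    U = convexHull ℝ {p₁, x₂, ![0, 0]}

/-- `V` is the triangle with vertices `(0,2), x³, p⁴`, where `x³` is the point of the third ray
on the line `x₁ + x₂ = 2` and `p⁴` is the point of the fourth ray on the line through `x³` and
`(1,0)`. -/
def IsTriangleV (f : Fin 2 → ℝ) (R : Fin 4 → Fin 2 → ℝ) (V : Set (Fin 2 → ℝ)) : Prop :=
  ∃ x₃ p₄ : Fin 2 → ℝ,
    (∃ t : ℝ, 0 < t ∧ x₃ = f + t • R 2) ∧ x₃ 0 + x₃ 1 = 2 ∧
    (∃ t : ℝ, 0 < t ∧ p₄ = f + t • R 3) ∧ p₄ ∈ affineSpan ℝ {x₃, ![1, 0]} ∧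
    V = convexHull ℝ {![0, 2], x₃, p₄}

end

open Set

noncomputable section

/-! ### Split closures: monotonicity, nesting and integral maps -/

/-! The core is a finiteness result: a cut with positive coefficients whose points `f + (α i)⁻¹ • R
i` lie in a triangle of type `T²ᴬ` has finite split rank (`cutRank_lt_top_of_isT2A`). The map `(x,
s) ↦ (x, ∑ αᵢ sᵢ)`, read in lattice coordinates, sends the relaxation into a three-dimensional
pyramid whose section at height `1` is a triangle. Split closures are compatible with such maps
(`IsSplitMap`), so it suffices that finitely many split closures push the pyramid above height `1`
(`exists_iter_pyramid`). By `IsT2A.exists_coords` the triangle may be taken to be bounded by `x₀ =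
0`, a line of negative slope through `(1, 1)` and a line of positive slope through `(1, 0)`.

If both slanted facets are flattened until they grow at a common rate `c` in `x₀`, the split `x₁ ≤ 0
∨ x₁ ≥ 1` yields `z ≥ 1 + c (x₀ - 1)`, and the split `x₀ ≤ 0 ∨ x₀ ≥ 1` then yields `z ≥ 1`. To
flatten the facet over a side `W = 0`, take its plane `z = E x`. The points of the body on this
plane lie over a planar cone cut out by the other two facets. Since the triangle is lattice-free,
all lattice points of the cone satisfy `W ≤ 0`, so this inequality has a finite Chvátal proof over
the cone. Each step of that proof lifts to splits of the body, which together tilt `E` by a positive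
amount (`Liftable`). The number of splits and the amount do not depend on `E`, so repetition reaches
any positive steepness (`exists_iter_side`). A side of irrational slope is a combination of two
rational lines that the lattice points of the cone cannot distinguish from it (`liftable_side`).

In standard position `U` and `V` are of type `T²ᴮ`, hence inside `T²ᴬ` triangles, and their cuts
have finite rank. The quadrilateral cut holds where `x₀ ≤ 0`, since `x₀` is nonnegative at the four
vertices and positive at `f`. Where `x₀ ≥ 1` it is forced by the two triangle cuts
(`cutValidOn_splitSet_of_standard`).

A quadrilateral inside a `T¹` triangle misses one of its vertices. A unimodular map takes the
triangle to `(0, 0), (0, 2), (2, 0)` with the missed vertex at `(2, 0)`. By compactness the image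
lies in `x₀ ≤ γ` for some rational `γ < 2`, hence in a standard quadrilateral, and enlarging the
induced set can only raise the rank (`cutRank_le_of_mapsTo`). -/

lemma splitSet_mono {p q : ℕ} {Q Q' : Set ((Fin p → ℝ) × (Fin q → ℝ))} (h : Q ⊆ Q')
    (π : Fin p → ℤ) (π₀ : ℤ) : splitSet Q π π₀ ⊆ splitSet Q' π π₀ :=
  convexHull_mono (union_subset_union (inter_subset_inter_left _ h) (inter_subset_inter_left _ h))

lemma splitClosure_subset_splitSet {p q : ℕ} (Q : Set ((Fin p → ℝ) × (Fin q → ℝ)))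
    (π : Fin p → ℤ) (π₀ : ℤ) : splitClosure Q ⊆ splitSet Q π π₀ :=
  fun _ hz => mem_iInter₂.1 hz π π₀

lemma splitClosure_subset {p q : ℕ} {Q : Set ((Fin p → ℝ) × (Fin q → ℝ))} (hQ : Convex ℝ Q) :
    splitClosure Q ⊆ Q :=
  -- The degenerate split `0 ≤ 0 ∨ 0 ≥ 1` returns the convex hull of `Q`.
  (splitClosure_subset_splitSet Q 0 0).trans
    (convexHull_min (union_subset inter_subset_left inter_subset_left) hQ)

lemma convex_splitClosure {p q : ℕ} (Q : Set ((Fin p → ℝ) × (Fin q → ℝ))) :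
    Convex ℝ (splitClosure Q) :=
  convex_iInter₂ fun _ _ => convex_convexHull ℝ _

lemma iterSplitClosure_succ {p q : ℕ} (n : ℕ) (Q : Set ((Fin p → ℝ) × (Fin q → ℝ))) :
    iterSplitClosure (n + 1) Q = splitClosure (iterSplitClosure n Q) :=
  Function.iterate_succ_apply' _ _ _

lemma iterSplitClosure_add {p q : ℕ} (m n : ℕ) (Q : Set ((Fin p → ℝ) × (Fin q → ℝ))) :
    iterSplitClosure (m + n) Q = iterSplitClosure m (iterSplitClosure n Q) :=
  Function.iterate_add_apply _ _ _ _

lemma convex_iterSplitClosure {p q : ℕ} {Q : Set ((Fin p → ℝ) × (Fin q → ℝ))}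
    (hQ : Convex ℝ Q) : ∀ n, Convex ℝ (iterSplitClosure n Q)
  | 0 => hQ
  | n + 1 => by rw [iterSplitClosure_succ]; exact convex_splitClosure _

lemma iterSplitClosure_antitone {p q : ℕ} {Q : Set ((Fin p → ℝ) × (Fin q → ℝ))}
    (hQ : Convex ℝ Q) : Antitone fun n => iterSplitClosure n Q :=
  antitone_nat_of_succ_le fun n => by
    change iterSplitClosure (n + 1) Q ⊆ iterSplitClosure n Q
    rw [iterSplitClosure_succ]
    exact splitClosure_subset (convex_iterSplitClosure hQ n)

/-- A property cut out by a convex set that holds on both sides of a split holds on the split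
closure. -/
lemma splitClosure_subset_of_sides {p q : ℕ} {Q S : Set ((Fin p → ℝ) × (Fin q → ℝ))}
    (hS : Convex ℝ S) (π : Fin p → ℤ) (π₀ : ℤ)
    (h₁ : ∀ z ∈ Q, ∑ i, (π i : ℝ) * z.1 i ≤ π₀ → z ∈ S)
    (h₂ : ∀ z ∈ Q, (π₀ : ℝ) + 1 ≤ ∑ i, (π i : ℝ) * z.1 i → z ∈ S) :
    splitClosure Q ⊆ S :=
  (splitClosure_subset_splitSet Q π π₀).trans
    (convexHull_min (union_subset (fun z hz => h₁ z hz.1 hz.2) fun z hz => h₂ z hz.1 hz.2) hS)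

/-- `F` commutes with convex combinations, and integral affine functions of the first component
pull back to integral affine functions of the first component. -/
structure IsSplitMap {p q p' q' : ℕ}
    (F : (Fin p → ℝ) × (Fin q → ℝ) → (Fin p' → ℝ) × (Fin q' → ℝ)) : Prop where
  comb : ∀ x y (a b : ℝ), a + b = 1 → F (a • x + b • y) = a • F x + b • F y
  pull : ∀ π : Fin p' → ℤ, ∃ (π' : Fin p → ℤ) (c : ℤ), ∀ z,
    ∑ i, (π i : ℝ) * (F z).1 i = ∑ i, (π' i : ℝ) * z.1 i + c

/-- A split of the target pulls back to a split of the source, its right-hand side shifted by the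
integer `c`, and the preimage of a convex set under `F` is convex. -/
lemma IsSplitMap.mapsTo_splitClosure {p q p' q' : ℕ}
    {F : (Fin p → ℝ) × (Fin q → ℝ) → (Fin p' → ℝ) × (Fin q' → ℝ)} (hF : IsSplitMap F)
    {Q : Set ((Fin p → ℝ) × (Fin q → ℝ))} {Q' : Set ((Fin p' → ℝ) × (Fin q' → ℝ))}
    (h : MapsTo F Q Q') : MapsTo F (splitClosure Q) (splitClosure Q') := by
  intro z hz
  refine mem_iInter₂.2 fun π π₀ => ?_
  obtain ⟨π', c, hc⟩ := hF.pull π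
  refine splitClosure_subset_of_sides (S := F ⁻¹' splitSet Q' π π₀) ?_ π' (π₀ - c) ?_ ?_ hz
  · intro x hx y hy a b ha hb hab
    rw [mem_preimage, hF.comb x y a b hab]
    exact convex_convexHull ℝ _ hx hy ha hb hab
  · intro x hx hle
    refine subset_convexHull ℝ _ (Or.inl ⟨h hx, ?_⟩)
    rw [mem_ofPred_eq, hc]; push_cast at hle; linarith
  · intro x hx hle
    refine subset_convexHull ℝ _ (Or.inr ⟨h hx, ?_⟩)
    rw [mem_ofPred_eq, hc]; push_cast at hle; linarith

lemma IsSplitMap.mapsTo_iterSplitClosure {p q p' q' : ℕ}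
    {F : (Fin p → ℝ) × (Fin q → ℝ) → (Fin p' → ℝ) × (Fin q' → ℝ)} (hF : IsSplitMap F)
    {Q : Set ((Fin p → ℝ) × (Fin q → ℝ))} {Q' : Set ((Fin p' → ℝ) × (Fin q' → ℝ))}
    (h : MapsTo F Q Q') :
    ∀ n, MapsTo F (iterSplitClosure n Q) (iterSplitClosure n Q')
  | 0 => h
  | n + 1 => by
    rw [iterSplitClosure_succ, iterSplitClosure_succ]
    exact hF.mapsTo_splitClosure (hF.mapsTo_iterSplitClosure h n)

/-- Integral affine maps `x ↦ M x + c` of the plane, together with a linear map of the continuous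
variables, are split maps. -/
lemma isSplitMap_intMap {q q' : ℕ} (M : Matrix (Fin 2) (Fin 2) ℤ) (c : Fin 2 → ℤ)
    (A : (Fin q → ℝ) →ₗ[ℝ] (Fin q' → ℝ)) :
    IsSplitMap fun z : (Fin 2 → ℝ) × (Fin q → ℝ) =>
      ((fun i => (M i 0 : ℝ) * z.1 0 + M i 1 * z.1 1 + c i : Fin 2 → ℝ), A z.2) where
  comb x y a b hab := by
    refine Prod.ext (funext fun i => ?_) ?_
    · simp only [Prod.fst_add, Prod.smul_fst, Pi.add_apply, Pi.smul_apply, smul_eq_mul]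
      linear_combination (-(c i : ℝ)) * hab
    · simp
  pull π := ⟨fun j => π 0 * M 0 j + π 1 * M 1 j, π 0 * c 0 + π 1 * c 1, fun z => by
    simp only [Fin.sum_univ_two]; push_cast; ring⟩

/-! ### The split rank of a cut -/

lemma convex_relaxP {k : ℕ} (f : Fin 2 → ℝ) (R : Fin k → Fin 2 → ℝ) : Convex ℝ (relaxP f R) := by
  rintro x ⟨hx, hx'⟩ y ⟨hy, hy'⟩ a b ha hb hab
  refine ⟨?_, fun i => ?_⟩
  · have : f = a • f + b • f := by rw [← add_smul, hab, one_smul]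
    simp only [Prod.fst_add, Prod.smul_fst, Prod.snd_add, Prod.smul_snd, Pi.add_apply,
      Pi.smul_apply, smul_eq_mul, add_smul, Finset.sum_add_distrib, mul_smul]
    rw [← Finset.smul_sum, ← Finset.smul_sum, hx, hy, smul_add, smul_add]
    nth_rewrite 3 [this]
    abel
  · have := mul_nonneg ha (hx' i)
    have := mul_nonneg hb (hy' i)
    simp only [Prod.snd_add, Prod.smul_snd, Pi.add_apply, Pi.smul_apply, smul_eq_mul]
    linarith

lemma cutValidOn_iff {k : ℕ} {Q : Set ((Fin 2 → ℝ) × (Fin k → ℝ))} {α : Fin k → ℝ} :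
    CutValidOn Q α ↔ ∀ z ∈ Q, 1 ≤ ∑ i, α i * z.2 i := by
  simp only [CutValidOn, ValidOn, Pi.zero_apply, zero_mul, Finset.sum_const_zero, zero_add,
    Pi.neg_apply, neg_mul, Finset.sum_neg_distrib, neg_le_neg_iff]

lemma CutValidOn.mono {k : ℕ} {Q Q' : Set ((Fin 2 → ℝ) × (Fin k → ℝ))} {α : Fin k → ℝ}
    (h : CutValidOn Q' α) (hQ : Q ⊆ Q') : CutValidOn Q α := fun z hz => h z (hQ hz)

lemma cutRank_le {k : ℕ} {f : Fin 2 → ℝ} {R : Fin k → Fin 2 → ℝ} {α : Fin k → ℝ} {n : ℕ}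
    (h : CutValidOn (iterSplitClosure n (relaxP f R)) α) : cutRank f R α ≤ n :=
  iInf₂_le n h

/-- Above the split rank a cut is valid. -/
lemma cutValidOn_of_cutRank_le {k : ℕ} {f : Fin 2 → ℝ} {R : Fin k → Fin 2 → ℝ} {α : Fin k → ℝ}
    {n : ℕ} (h : cutRank f R α ≤ n) : CutValidOn (iterSplitClosure n (relaxP f R)) α := by
  have h' : cutRank f R α < (n : ℕ∞) + 1 :=
    lt_of_le_of_lt h (by exact_mod_cast Nat.lt_succ_self n)
  obtain ⟨m, hm⟩ := iInf_lt_iff.1 h'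
  obtain ⟨hv, hm⟩ := iInf_lt_iff.1 hm
  have hmn : m ≤ n := by
    have : m < n + 1 := by exact_mod_cast hm
    omega
  exact CutValidOn.mono hv (iterSplitClosure_antitone (convex_relaxP f R) hmn)

lemma cutRank_le_of_forall {k k' : ℕ} {f f' : Fin 2 → ℝ} {R : Fin k → Fin 2 → ℝ}
    {R' : Fin k' → Fin 2 → ℝ} {α : Fin k → ℝ} {α' : Fin k' → ℝ}
    (h : ∀ n, CutValidOn (iterSplitClosure n (relaxP f' R')) α' →
      CutValidOn (iterSplitClosure n (relaxP f R)) α) : cutRank f R α ≤ cutRank f' R' α' :=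
  le_iInf₂ fun n hn => cutRank_le (h n hn)

lemma cutRank_lt_top {k : ℕ} {f : Fin 2 → ℝ} {R : Fin k → Fin 2 → ℝ} {α : Fin k → ℝ} {n : ℕ}
    (h : CutValidOn (iterSplitClosure n (relaxP f R)) α) : cutRank f R α < ⊤ :=
  (cutRank_le h).trans_lt (WithTop.coe_lt_top n)

/-- A cut that follows from two others by one split has split rank at most one more. -/
lemma cutRank_le_max_add_one {k : ℕ} {f : Fin 2 → ℝ} {R : Fin k → Fin 2 → ℝ}
    {α β γ : Fin k → ℝ} (π : Fin 2 → ℤ) (π₀ : ℤ)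
    (h : CutValidOn (splitSet {z | z ∈ relaxP f R ∧ 1 ≤ ∑ i, β i * z.2 i ∧
      1 ≤ ∑ i, γ i * z.2 i} π π₀) α) :
    cutRank f R α ≤ max (cutRank f R β) (cutRank f R γ) + 1 := by
  rcases eq_or_ne (max (cutRank f R β) (cutRank f R γ)) ⊤ with ht | ht
  · rw [ht]; exact le_top
  · obtain ⟨n, hn⟩ := ENat.ne_top_iff_exists.1 ht
    have hβ := cutValidOn_iff.1 (cutValidOn_of_cutRank_le (hn ▸ le_max_left _ _))
    have hγ := cutValidOn_iff.1 (cutValidOn_of_cutRank_le (hn ▸ le_max_right _ _))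
    rw [← hn]
    refine cutRank_le (n := n + 1) (h.mono ?_)
    rw [iterSplitClosure_succ]
    refine (splitClosure_subset_splitSet _ π π₀).trans (splitSet_mono (fun z hz => ?_) π π₀)
    exact ⟨iterSplitClosure_antitone (convex_relaxP f R) (Nat.zero_le n) hz, hβ z hz, hγ z hz⟩

/-! ### Lifting planar cutting plane proofs to a facet -/

/-- `G` commutes with affine combinations. -/
def IsAff (G : (Fin 2 → ℝ) → ℝ) : Prop :=
  ∀ x y (a b : ℝ), a + b = 1 → G (a • x + b • y) = a * G x + b * G y

lemma isAff_coord (c₀ c₁ c₂ : ℝ) : IsAff fun x => c₀ + c₁ * x 0 + c₂ * x 1 := by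
  intro x y a b hab
  simp only [Pi.add_apply, Pi.smul_apply, smul_eq_mul]
  linear_combination (-c₀) * hab

lemma IsAff.of_eq {G : (Fin 2 → ℝ) → ℝ} (c₀ c₁ c₂ : ℝ)
    (h : ∀ x, G x = c₀ + c₁ * x 0 + c₂ * x 1) : IsAff G := by
  rw [show G = _ from funext h]; exact isAff_coord c₀ c₁ c₂

/-- The part of the space above the graph of `E + κ L`. -/
lemma convex_above {E L : (Fin 2 → ℝ) → ℝ} (hE : IsAff E) (hL : IsAff L) (κ : ℝ) :
    Convex ℝ {z : (Fin 2 → ℝ) × (Fin 1 → ℝ) | κ * L z.1 ≤ z.2 0 - E z.1} := by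
  intro x hx y hy a b ha hb hab
  simp only [mem_ofPred_eq, Prod.fst_add, Prod.smul_fst, Prod.snd_add, Prod.smul_snd,
    Pi.add_apply, Pi.smul_apply, smul_eq_mul] at hx hy ⊢
  rw [hE _ _ _ _ hab, hL _ _ _ _ hab]
  have := mul_le_mul_of_nonneg_left hx ha
  have := mul_le_mul_of_nonneg_left hy hb
  linarith

/-- If the plane `E` supports a convex set `Q` from below and the functions of `S` can be added to
`E`, after scaling, then so can `L` after a bounded number of split closures. -/
def Liftable (S : Set ((Fin 2 → ℝ) → ℝ)) (L : (Fin 2 → ℝ) → ℝ) : Prop :=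
  ∃ k : ℕ, ∀ κ > 0, ∃ κ' > 0, ∀ (Q : Set ((Fin 2 → ℝ) × (Fin 1 → ℝ))) (E : (Fin 2 → ℝ) → ℝ),
    Convex ℝ Q → IsAff E → (∀ z ∈ Q, E z.1 ≤ z.2 0) →
    (∀ L₀ ∈ S, ∀ z ∈ Q, κ * L₀ z.1 ≤ z.2 0 - E z.1) →
    ∀ z ∈ iterSplitClosure k Q, κ' * L z.1 ≤ z.2 0 - E z.1

lemma Liftable.base {S : Set ((Fin 2 → ℝ) → ℝ)} {L : (Fin 2 → ℝ) → ℝ} (h : L ∈ S) :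
    Liftable S L :=
  ⟨0, fun κ hκ => ⟨κ, hκ, fun _ _ _ _ _ hS z hz => hS L h z hz⟩⟩

lemma mul_le_half_of_le {κ c κ₁ l v : ℝ} (hκ : 0 ≤ κ) (hc : 0 ≤ c) (h : κ * c ≤ κ₁ / 2)
    (hv : 0 ≤ v) (hl : κ₁ * l ≤ v) : κ * (c * l) ≤ v / 2 := by
  rcases le_total 0 l with h0 | h0
  · nlinarith [mul_le_mul_of_nonneg_right h h0]
  · nlinarith [mul_nonneg hκ hc, mul_nonneg (mul_nonneg hκ hc) (neg_nonneg.2 h0)]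

lemma Liftable.comb {S : Set ((Fin 2 → ℝ) → ℝ)} {L₁ L₂ L : (Fin 2 → ℝ) → ℝ}
    (h₁ : Liftable S L₁) (h₂ : Liftable S L₂) {c₁ c₂ : ℝ} (hc₁ : 0 ≤ c₁) (hc₂ : 0 ≤ c₂)
    (h : ∀ x, L x ≤ c₁ * L₁ x + c₂ * L₂ x) : Liftable S L := by
  obtain ⟨k₁, h₁⟩ := h₁
  obtain ⟨k₂, h₂⟩ := h₂
  refine ⟨max k₁ k₂, fun κ hκ => ?_⟩
  obtain ⟨κ₁, hκ₁, h₁⟩ := h₁ κ hκ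
  obtain ⟨κ₂, hκ₂, h₂⟩ := h₂ κ hκ
  have hm : 0 < min κ₁ κ₂ := lt_min hκ₁ hκ₂
  have hd : 0 < 2 * (c₁ + c₂ + 1) := by linarith
  -- With this denominator each of the two terms is at most half of `z - E`.
  refine ⟨min κ₁ κ₂ / (2 * (c₁ + c₂ + 1)), by positivity, fun Q E hQ hE hz₀ hS z hz => ?_⟩
  have e₁ := h₁ Q E hQ hE hz₀ hS z (iterSplitClosure_antitone hQ (le_max_left _ _) hz)
  have e₂ := h₂ Q E hQ hE hz₀ hS z (iterSplitClosure_antitone hQ (le_max_right _ _) hz)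
  have e₀ := hz₀ z (iterSplitClosure_antitone hQ (Nat.zero_le _) hz)
  set κ' := min κ₁ κ₂ / (2 * (c₁ + c₂ + 1)) with hκ'
  have hpos : 0 < κ' := by positivity
  have hmul : κ' * (2 * (c₁ + c₂ + 1)) = min κ₁ κ₂ := div_mul_cancel₀ _ hd.ne'
  have a₁ : κ' * c₁ ≤ κ₁ / 2 := by
    nlinarith [min_le_left κ₁ κ₂, mul_nonneg hpos.le hc₂, mul_nonneg hpos.le hc₁]
  have a₂ : κ' * c₂ ≤ κ₂ / 2 := by
    nlinarith [min_le_right κ₁ κ₂, mul_nonneg hpos.le hc₂, mul_nonneg hpos.le hc₁]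
  have b₁ := mul_le_half_of_le hpos.le hc₁ a₁ (by linarith) e₁
  have b₂ := mul_le_half_of_le hpos.le hc₂ a₂ (by linarith) e₂
  have := mul_le_mul_of_nonneg_left (h z.1) hpos.le
  linarith

lemma Liftable.of_le {S : Set ((Fin 2 → ℝ) → ℝ)} {L₁ L : (Fin 2 → ℝ) → ℝ}
    (h₁ : Liftable S L₁) {c : ℝ} (hc : 0 ≤ c) (h : ∀ x, L x ≤ c * L₁ x) : Liftable S L :=
  h₁.comb h₁ hc le_rfl fun x => by simpa using h x

/-- The proofs of `A` and `B` run in parallel and one more split joins them. Lowering both factors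
to their minimum is harmless because `z - E ≥ 0`. -/
lemma Liftable.split {S : Set ((Fin 2 → ℝ) → ℝ)} {A B L : (Fin 2 → ℝ) → ℝ}
    (hA : Liftable S A) (hB : Liftable S B) (hL : IsAff L) (π : Fin 2 → ℤ) (π₀ : ℤ)
    (h₁ : ∀ x : Fin 2 → ℝ, ∑ i, (π i : ℝ) * x i ≤ π₀ → L x ≤ A x)
    (h₂ : ∀ x : Fin 2 → ℝ, (π₀ : ℝ) + 1 ≤ ∑ i, (π i : ℝ) * x i → L x ≤ B x) :
    Liftable S L := by
  obtain ⟨k₁, hA⟩ := hA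
  obtain ⟨k₂, hB⟩ := hB
  refine ⟨max k₁ k₂ + 1, fun κ hκ => ?_⟩
  obtain ⟨κ₁, hκ₁, hA⟩ := hA κ hκ
  obtain ⟨κ₂, hκ₂, hB⟩ := hB κ hκ
  have hm : 0 < min κ₁ κ₂ := lt_min hκ₁ hκ₂
  refine ⟨min κ₁ κ₂, hm, fun Q E hQ hE hz₀ hS => ?_⟩
  rw [iterSplitClosure_succ]
  have key : ∀ κ' l v : ℝ, min κ₁ κ₂ ≤ κ' → 0 ≤ v → κ' * l ≤ v → min κ₁ κ₂ * l ≤ v := by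
    intro κ' l v hle hv hl
    rcases le_total 0 l with h0 | h0
    · exact (mul_le_mul_of_nonneg_right hle h0).trans hl
    · exact (mul_nonpos_of_nonneg_of_nonpos hm.le h0).trans hv
  refine splitClosure_subset_of_sides (convex_above hE hL _) π π₀ (fun z hz hle => ?_)
    fun z hz hle => ?_
  · have e₀ := hz₀ z (iterSplitClosure_antitone hQ (Nat.zero_le _) hz)
    have e := hA Q E hQ hE hz₀ hS z (iterSplitClosure_antitone hQ (le_max_left _ _) hz)
    exact (mul_le_mul_of_nonneg_left (h₁ _ hle) hm.le).trans
      (key _ _ _ (min_le_left _ _) (by linarith) e)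
  · have e₀ := hz₀ z (iterSplitClosure_antitone hQ (Nat.zero_le _) hz)
    have e := hB Q E hQ hE hz₀ hS z (iterSplitClosure_antitone hQ (le_max_right _ _) hz)
    exact (mul_le_mul_of_nonneg_left (h₂ _ hle) hm.le).trans
      (key _ _ _ (min_le_right _ _) (by linarith) e)

/-! ### Cutting planes for a planar cone -/

section Cone

variable {π ρ : Fin 2 → ℤ} {L₁ L₂ : (Fin 2 → ℝ) → ℝ} {a₁ b₁ e₁ a₂ b₂ e₂ : ℝ}

/-- One Chvátal step: from `π x ≥ j` to `π x ≥ j + 1` if the cone `L₁ ≤ 0, L₂ ≤ 0` contains no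
lattice point on the line `π x = j`. The vectors `π, ρ` are dual to a lattice basis. -/
lemma liftable_step (he₁ : 0 < e₁) (he₂ : e₂ < 0)
    (hL₁ : ∀ x, L₁ x = a₁ + b₁ * (∑ i, (π i : ℝ) * x i) + e₁ * (∑ i, (ρ i : ℝ) * x i))
    (hL₂ : ∀ x, L₂ x = a₂ + b₂ * (∑ i, (π i : ℝ) * x i) + e₂ * (∑ i, (ρ i : ℝ) * x i))
    (j : ℤ)
    (hj : ∀ i : ℤ, a₁ + b₁ * j + e₁ * i ≤ 0 → 0 < a₂ + b₂ * j + e₂ * i)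
    (h : Liftable {L₁, L₂} fun x => (j : ℝ) - ∑ i, (π i : ℝ) * x i) :
    Liftable {L₁, L₂} fun x => ((j + 1 : ℤ) : ℝ) - ∑ i, (π i : ℝ) * x i := by
  have haff : ∀ c : ℝ, IsAff fun x => c - ∑ i, (π i : ℝ) * x i := fun c =>
    IsAff.of_eq c (-π 0) (-π 1) fun x => by rw [Fin.sum_univ_two]; ring
  -- On the line `π x = j`, `i₀` is the last integer with `L₁ ≤ 0`. Hence `L₁ > 0` at `i₀ + 1`, and
  -- `L₂ > 0` at `i₀` by `hj`.
  set i₀ : ℤ := ⌊-(a₁ + b₁ * j) / e₁⌋ with hi₀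
  have hlo : a₁ + b₁ * j + e₁ * i₀ ≤ 0 := by
    have : (i₀ : ℝ) ≤ -(a₁ + b₁ * j) / e₁ := Int.floor_le _
    rw [le_div_iff₀ he₁] at this
    linarith
  have hhi : 0 < a₁ + b₁ * j + e₁ * (i₀ + 1) := by
    have : -(a₁ + b₁ * j) / e₁ < (i₀ : ℝ) + 1 := Int.lt_floor_add_one _
    rw [div_lt_iff₀ he₁] at this
    linarith
  have hlo₂ := hj i₀ hlo
  set γ₁ := a₁ + b₁ * j + e₁ * (i₀ + 1) with hγ₁
  set γ₂ := a₂ + b₂ * j + e₂ * i₀ with hγ₂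
  -- Any `N > b` would do: it keeps the coefficient `N - b` of `j - π x` positive.
  set N₁ := |b₁| + 1 with hN₁
  set N₂ := |b₂| + 1 with hN₂
  have hb₁ : 0 < N₁ - b₁ := by linarith [le_abs_self b₁]
  have hb₂ : 0 < N₂ - b₂ := by linarith [le_abs_self b₂]
  have hA : Liftable {L₁, L₂} fun x =>
      (L₂ x + N₂ * ((j : ℝ) - ∑ i, (π i : ℝ) * x i)) / (N₂ - b₂) :=
    (Liftable.base (L := L₂) (by simp)).comb h (c₁ := 1 / (N₂ - b₂)) (c₂ := N₂ / (N₂ - b₂))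
      (by positivity) (by positivity) fun x => le_of_eq (by ring)
  have hB : Liftable {L₁, L₂} fun x =>
      (L₁ x + N₁ * ((j : ℝ) - ∑ i, (π i : ℝ) * x i)) / (N₁ - b₁) :=
    (Liftable.base (L := L₁) (by simp)).comb h (c₁ := 1 / (N₁ - b₁)) (c₂ := N₁ / (N₁ - b₁))
      (by positivity) (by positivity) fun x => le_of_eq (by ring)
  set ε := min (γ₁ / (N₁ - b₁)) (γ₂ / (N₂ - b₂)) with hε
  have hε₀ : 0 < ε := lt_min (by positivity) (by positivity)
  -- On `ρ x ≤ i₀` one has `L₂ ≥ γ₂ - b₂ (j - π x)`, and on `ρ x ≥ i₀ + 1` one has `L₁ ≥ γ₁ - b₁ (j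
  -- - π x)`. The split on `ρ` therefore moves the bound from `j` to `j + ε`.
  have hC : Liftable {L₁, L₂} fun x => ((j : ℝ) + ε) - ∑ i, (π i : ℝ) * x i := by
    refine hA.split hB (haff _) ρ i₀ (fun x hx => ?_) fun x hx => ?_
    · have : ε * (N₂ - b₂) ≤ γ₂ := (le_div_iff₀ hb₂).1 (min_le_right _ _)
      rw [le_div_iff₀ hb₂, hL₂]
      have := mul_le_mul_of_nonpos_left hx he₂.le
      nlinarith
    · have : ε * (N₁ - b₁) ≤ γ₁ := (le_div_iff₀ hb₁).1 (min_le_left _ _)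
      rw [le_div_iff₀ hb₁, hL₁]
      have := mul_le_mul_of_nonneg_left hx he₁.le
      nlinarith
  -- Rounding `j + ε` up to `j + 1` by the split on `π`: with the factor `1 + 1 / ε` the function
  -- dominates the target where `π x ≤ j`, and where `π x ≥ j + 1` the target is already at most
  -- `0`.
  have hM : Liftable {L₁, L₂} fun x =>
      (1 + 1 / ε) * (((j : ℝ) + ε) - ∑ i, (π i : ℝ) * x i) :=
    hC.of_le (c := 1 + 1 / ε) (by positivity) fun x => le_rfl
  have h0 : Liftable {L₁, L₂} fun _ => (0 : ℝ) := hM.of_le (c := 0) le_rfl fun x => by simp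
  refine hM.split h0 (haff _) π j (fun x hx => ?_) fun x hx => ?_
  · have h1 : 1 / ε * ε = 1 := by field_simp
    have h2 : 0 ≤ 1 / ε * ((j : ℝ) - ∑ i, (π i : ℝ) * x i) :=
      mul_nonneg (by positivity) (by linarith)
    push_cast
    nlinarith
  · push_cast; linarith

/-- If all lattice points of the planar cone `L₁ ≤ 0, L₂ ≤ 0` satisfy `π x ≥ π₀`, where `π` is
bounded below on the cone, then this inequality has a finite cutting plane proof. -/
lemma liftable_cone (he₁ : 0 < e₁) (he₂ : e₂ < 0) (hτ : -e₂ * b₁ + e₁ * b₂ < 0)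
    (hL₁ : ∀ x, L₁ x = a₁ + b₁ * (∑ i, (π i : ℝ) * x i) + e₁ * (∑ i, (ρ i : ℝ) * x i))
    (hL₂ : ∀ x, L₂ x = a₂ + b₂ * (∑ i, (π i : ℝ) * x i) + e₂ * (∑ i, (ρ i : ℝ) * x i))
    (π₀ : ℤ)
    (hlat : ∀ j i : ℤ, a₁ + b₁ * j + e₁ * i ≤ 0 → a₂ + b₂ * j + e₂ * i ≤ 0 → π₀ ≤ j) :
    Liftable {L₁, L₂} fun x => (π₀ : ℝ) - ∑ i, (π i : ℝ) * x i := by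
  set τ := -(-e₂ * b₁ + e₁ * b₂) with hτ'
  have hτ₀ : 0 < τ := by linarith
  set γ := -e₂ * a₁ + e₁ * a₂ with hγ
  -- Eliminating `ρ x` between `L₁` and `L₂` gives a first bound `π x ≥ γ / τ`, from which the
  -- integer steps start.
  have h0 : Liftable {L₁, L₂} fun x => γ / τ - ∑ i, (π i : ℝ) * x i := by
    refine (Liftable.base (L := L₁) (by simp)).comb (Liftable.base (L := L₂) (by simp))
      (c₁ := -e₂ / τ) (c₂ := e₁ / τ) (div_nonneg (by linarith) hτ₀.le) (by positivity)
      fun x => le_of_eq ?_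
    rw [hL₁, hL₂]
    field_simp
    rw [hτ', hγ]
    ring
  have key : ∀ n : ℕ, (min ⌊γ / τ⌋ π₀) + n ≤ π₀ → Liftable {L₁, L₂} fun x =>
      (((min ⌊γ / τ⌋ π₀) + n : ℤ) : ℝ) - ∑ i, (π i : ℝ) * x i := by
    intro n
    induction n with
    | zero =>
      intro _
      refine h0.of_le (c := 1) zero_le_one fun x => ?_
      have h1 : ((min ⌊γ / τ⌋ π₀ : ℤ) : ℝ) ≤ γ / τ :=
        (Int.cast_le.2 (min_le_left _ _)).trans (Int.floor_le _)
      rw [Nat.cast_zero, add_zero]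
      linarith
    | succ n ih =>
      intro hn
      have := liftable_step he₁ he₂ hL₁ hL₂ (min ⌊γ / τ⌋ π₀ + n) (fun i hi => ?_)
        (ih (by push_cast at hn; omega))
      · rw [Nat.cast_succ, ← add_assoc]; exact this
      · by_contra hcon
        have := hlat _ i hi (not_lt.1 hcon)
        push_cast at hn; omega
  have hfin := key (π₀ - min ⌊γ / τ⌋ π₀).toNat
  have hle : min ⌊γ / τ⌋ π₀ ≤ π₀ := min_le_right _ _
  rw [Int.toNat_of_nonneg (by omega)] at hfin
  have := hfin (by omega)
  rwa [add_sub_cancel] at this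

end Cone

/-- Rational lower approximations of `β` that no lattice point of a given cone can distinguish
from `β`. -/
lemma exists_rat_below (β : ℝ) {c ε : ℝ} (hc : 0 < c) (hε : 0 < ε) (H : ℝ) :
    ∃ p q : ℤ, 0 < q ∧ IsCoprime p q ∧ (p : ℝ) ≤ β * q ∧ (β - ε) * q < p ∧
      ∀ i m : ℤ, 1 ≤ i → 0 ≤ m + β * i → c * (i - H) ≤ m + β * i → 0 ≤ q * m + p * i := by
  obtain ⟨N, hN⟩ := exists_nat_gt (max (1 / ε) (max (2 / c) (2 * H)))
  obtain ⟨hN₁, hN₂⟩ := max_lt_iff.1 hN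
  obtain ⟨hN₂, hN₃⟩ := max_lt_iff.1 hN₂
  have hN₀ : (0 : ℝ) < N := (by positivity : 0 < 1 / ε).trans hN₁
  have hN₀' : 1 ≤ N := by exact_mod_cast hN₀
  -- The best of the fractions `⌊β i⌋ / i` with `i ≤ N` loses no lattice point with `1 ≤ i ≤ N`, and
  -- `i = N` makes it closer than `1 / N` to `β`.
  obtain ⟨i₀, hi₀, hmax⟩ := Finset.exists_max_image (Finset.Icc 1 N)
    (fun i : ℕ => (⌊β * i⌋ : ℚ) / i) ⟨1, Finset.mem_Icc.2 ⟨le_rfl, hN₀'⟩⟩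
  set r : ℚ := (⌊β * i₀⌋ : ℚ) / i₀ with hr
  have hi₀' : (0 : ℝ) < i₀ := by exact_mod_cast (Finset.mem_Icc.1 hi₀).1
  have hrβ : (r : ℝ) ≤ β := by
    rw [hr]; push_cast
    rw [div_le_iff₀ hi₀']
    exact Int.floor_le _
  have hfl : ∀ i : ℕ, 1 ≤ i → i ≤ N → (⌊β * i⌋ : ℝ) ≤ r * i := by
    intro i h1 h2
    have h := hmax i (Finset.mem_Icc.2 ⟨h1, h2⟩)
    have hi : (0 : ℚ) < i := by exact_mod_cast h1
    change _ ≤ r at h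
    rw [div_le_iff₀ hi] at h
    exact_mod_cast h
  have hrN : β * N - 1 < r * N := (Int.sub_one_lt_floor _).trans_le (hfl N hN₀' le_rfl)
  have hq : (0 : ℝ) < r.den := by exact_mod_cast r.den_pos
  have hpq : (r.num : ℝ) = r * r.den := by exact_mod_cast (Rat.mul_den_eq_num r).symm
  have hβr : (β - r) * N < 1 := by linarith
  refine ⟨r.num, r.den, by exact_mod_cast r.den_pos, Rat.isCoprime_num_den r, ?_, ?_, ?_⟩
  · rw [hpq]; push_cast; exact mul_le_mul_of_nonneg_right hrβ hq.le
  · rw [hpq]; push_cast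
    refine mul_lt_mul_of_pos_right ?_ hq
    have : 1 < N * ε := by rwa [div_lt_iff₀ hε] at hN₁
    nlinarith
  · intro i m hi h₁ h₂
    have hi' : (1 : ℝ) ≤ i := by exact_mod_cast hi
    have key : (0 : ℝ) ≤ m + r * i := by
      rcases le_or_gt i N with hiN | hiN
      · have h := hfl i.toNat (by omega) (by omega)
        have e : ((i.toNat : ℕ) : ℝ) = i := by exact_mod_cast Int.toNat_of_nonneg (by omega)
        rw [e] at h
        have : -m ≤ ⌊β * i⌋ := Int.le_floor.2 (by push_cast; linarith)
        have : (-m : ℝ) ≤ ⌊β * i⌋ := by exact_mod_cast this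
        linarith
      -- Far out the third inequality gives `m + β i ≥ c (i - H) > c i / 2`, which exceeds the loss
      -- `(β - r) i`.
      · have hiN' : (N : ℝ) < i := by exact_mod_cast hiN
        have h2 : 2 < N * c := by rwa [div_lt_iff₀ hc] at hN₂
        have h3 : β - r < c / 2 := by
          by_contra hcon
          nlinarith
        nlinarith
    have : (0 : ℝ) ≤ r.den * m + r.num * i := by
      rw [hpq]
      nlinarith
    exact_mod_cast this

/-- Bézout coefficients complete `π = (p, q)` by `ρ = (v, -u)`, so that `x₀ = u π x + q ρ x` and `x₁
= v π x - p ρ x`. The claim is then `liftable_cone` for `π x ≥ p + q`, divided by `q`. -/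
lemma liftable_rational_side {β c₁ c₂ h : ℝ} (hc₁ : 0 < c₁) (hc₂ : 0 < c₂) {p q : ℤ} (hq : 0 < q)
    (hpq : IsCoprime p q) (hp₁ : (β - c₁) * q < p) (hp₂ : p < (β + c₂) * q)
    (hlat : ∀ i m : ℤ, -m - β * (i - 1) + c₁ * (i - h) ≤ 0 → -m - β * (i - 1) - c₂ * i ≤ 0 →
      0 ≤ q * m + p * (i - 1)) :
    Liftable {fun x => 1 - x 1 - β * (x 0 - 1) + c₁ * (x 0 - h),
      fun x => 1 - x 1 - β * (x 0 - 1) - c₂ * x 0}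
      fun x => 1 - x 1 - (p / q : ℝ) * (x 0 - 1) := by
  obtain ⟨u, v, huv⟩ := hpq
  have huv' : (u : ℝ) * p + v * q = 1 := by exact_mod_cast huv
  have hq' : (0 : ℝ) < q := by exact_mod_cast hq
  have hL := liftable_cone (π := ![p, q]) (ρ := ![v, -u])
    (L₁ := fun x => 1 - x 1 - β * (x 0 - 1) + c₁ * (x 0 - h))
    (L₂ := fun x => 1 - x 1 - β * (x 0 - 1) - c₂ * x 0)
    (a₁ := 1 + β - c₁ * h) (b₁ := -(β * u + v) + c₁ * u) (e₁ := p - β * q + c₁ * q)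
    (a₂ := 1 + β) (b₂ := -(β * u + v) - c₂ * u) (e₂ := p - β * q - c₂ * q)
    (by linarith) (by linarith) ?_ ?_ ?_ (p + q) ?_
  · refine hL.of_le (c := 1 / q) (by positivity) fun x => le_of_eq ?_
    simp only [Fin.sum_univ_two, Matrix.cons_val_zero, Matrix.cons_val_one]
    push_cast
    field_simp
    ring
  · have : -(p - β * q - c₂ * q) * (-(β * u + v) + c₁ * u) +
        (p - β * q + c₁ * q) * (-(β * u + v) - c₂ * u) = -(c₁ + c₂) * (u * p + v * q) := by ring
    rw [this, huv']
    linarith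
  · intro x
    simp only [Fin.sum_univ_two, Matrix.cons_val_zero, Matrix.cons_val_one]
    push_cast
    linear_combination (-(x 1) - β * x 0 + c₁ * x 0) * (-huv')
  · intro x
    simp only [Fin.sum_univ_two, Matrix.cons_val_zero, Matrix.cons_val_one]
    push_cast
    linear_combination (-(x 1) - β * x 0 - c₂ * x 0) * (-huv')
  · intro j i h₁ h₂
    have hh := hlat (u * j + q * i) (v * j - p * i - 1) (by push_cast; linarith)
      (by push_cast; linarith)
    have : q * (v * j - p * i - 1) + p * (u * j + q * i - 1) = j * (u * p + v * q) - p - q := by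
      ring
    rw [this, huv] at hh
    linarith

/-- The side `W = 0` of a lattice-free cone has a finite cutting plane proof. -/
lemma liftable_side {β c₁ c₂ h : ℝ} (hc₁ : 0 < c₁) (hc₂ : 0 < c₂)
    (hlat : ∀ i m : ℤ, -m - β * (i - 1) + c₁ * (i - h) ≤ 0 → -m - β * (i - 1) - c₂ * i ≤ 0 →
      0 ≤ m + β * (i - 1)) :
    Liftable {fun x => 1 - x 1 - β * (x 0 - 1) + c₁ * (x 0 - h),
      fun x => 1 - x 1 - β * (x 0 - 1) - c₂ * x 0}
      fun x => 1 - x 1 - β * (x 0 - 1) := by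
  obtain ⟨p, q, hq, hpq, hpβ, hβp, hcone⟩ := exists_rat_below β hc₁ hc₁ (h - 1)
  obtain ⟨p', q', hq', hpq', hpβ', hβp', hcone'⟩ := exists_rat_below (-β) hc₂ hc₂ 1
  have hqr : (0 : ℝ) < q := by exact_mod_cast hq
  have hqr' : (0 : ℝ) < q' := by exact_mod_cast hq'
  -- The lower approximation needs care only at abscissas `i ≥ 2`; for `i ≤ 1` the inequality
  -- follows from `p ≤ β q`. The upper one, obtained from `-β`, needs care only for `i ≤ 0`.
  have h₁ := liftable_rational_side hc₁ hc₂ hq hpq hβp (by nlinarith) fun i m e₁ e₂ => by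
    have h0 := hlat i m e₁ e₂
    rcases le_or_gt 2 i with hi | hi
    · exact hcone (i - 1) m (by omega) (by push_cast; linarith) (by push_cast; linarith)
    · have : (0 : ℝ) ≤ q * m + p * (i - 1) := by
        have hi' : (i : ℝ) - 1 ≤ 0 := by
          have : (i : ℝ) ≤ 1 := by exact_mod_cast (by omega : i ≤ 1)
          linarith
        nlinarith [mul_le_mul_of_nonpos_right hpβ hi']
      exact_mod_cast this
  have h₂ := liftable_rational_side (p := -p') hc₁ hc₂ hq' hpq'.neg_left (by push_cast; nlinarith)
    (by push_cast; nlinarith) fun i m e₁ e₂ => by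
    have h0 := hlat i m e₁ e₂
    rcases le_or_gt i 0 with hi | hi
    · have := hcone' (1 - i) m (by omega) (by push_cast; linarith) (by push_cast; linarith)
      linarith
    · have : (0 : ℝ) ≤ q' * m + (-p') * (i - 1) := by
        have hi' : 0 ≤ (i : ℝ) - 1 := by
          have : (1 : ℝ) ≤ i := by exact_mod_cast hi
          linarith
        nlinarith [mul_le_mul_of_nonneg_right hpβ' hi']
      exact_mod_cast this
  set r : ℝ := p / q with hr
  set r' : ℝ := ((-p' : ℤ) : ℝ) / q' with hr'
  have hrβ : r ≤ β := (div_le_iff₀ hqr).2 hpβ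
  have hrβ' : β ≤ r' := (le_div_iff₀ hqr').2 (by push_cast; linarith)
  rcases eq_or_lt_of_le (hrβ.trans hrβ') with he | hlt
  · have : r = β := le_antisymm hrβ (hrβ'.trans he.ge)
    rwa [this] at h₁
  · have hd : 0 < r' - r := by linarith
    refine h₁.comb h₂ (c₁ := (r' - β) / (r' - r)) (c₂ := (β - r) / (r' - r))
      (div_nonneg (by linarith) hd.le) (div_nonneg (by linarith) hd.le) fun x => le_of_eq ?_
    field_simp
    ring

lemma Liftable.rescale {A B L : (Fin 2 → ℝ) → ℝ} (h : Liftable {A, B} L) {c d : ℝ} (hc : 0 < c)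
    (hd : 0 < d) {A' B' : (Fin 2 → ℝ) → ℝ} (hA : ∀ x, A' x = c * A x)
    (hB : ∀ x, B' x = d * B x) : Liftable {A', B'} L := by
  obtain ⟨k, h⟩ := h
  refine ⟨k, fun κ hκ => ?_⟩
  have hm : 0 < min c d := lt_min hc hd
  obtain ⟨κ', hκ', h⟩ := h (κ * min c d) (by positivity)
  refine ⟨κ', hκ', fun Q E hQ hE hz₀ hS => h Q E hQ hE hz₀ ?_⟩
  have key : ∀ e l v : ℝ, min c d ≤ e → 0 ≤ v → κ * (e * l) ≤ v → κ * min c d * l ≤ v := by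
    intro e l v he hv hl
    rcases le_total 0 l with h0 | h0
    · refine le_trans ?_ hl
      rw [mul_assoc]
      exact mul_le_mul_of_nonneg_left (mul_le_mul_of_nonneg_right he h0) hκ.le
    · exact (mul_nonpos_of_nonneg_of_nonpos (by positivity) h0).trans hv
  intro L₀ hL₀ z hz
  have e₀ := hz₀ z hz
  rcases hL₀ with rfl | rfl
  · exact key c _ _ (min_le_left _ _) (by linarith) (hA z.1 ▸ hS A' (by simp) z hz)
  · exact key d _ _ (min_le_right _ _) (by linarith) (hB z.1 ▸ hS B' (by simp) z hz)

/-! ### The pyramid over a lattice-free triangle -/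

section Pyramid

variable {a β s₀ s₁ s₂ : ℝ}

/-- The cone cut out by two sides of a triangle and a plane through the third side. -/
lemma liftable_triangle (ha : 0 < a) (hβ : 0 < β) (hs₁ : 0 < s₁) (hs₂ : 0 < s₂) {s : ℝ}
    (hs : 0 < s) :
    Liftable {fun x => s * (1 - x 1 - β * (x 0 - 1)) - s₁ * (x 1 - a * (x 0 - 1)),
      fun x => s * (1 - x 1 - β * (x 0 - 1)) - s₂ * x 0}
      fun x => 1 - x 1 - β * (x 0 - 1) := by
  have hab : 0 < a + β := by linarith
  -- With `W = 1 - x₁ - β (x₀ - 1)` one has `x₁ - a (x₀ - 1) = 1 - W - (a + β) (x₀ - 1)`, which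
  -- gives `c₁`. The number `h` is the abscissa where the two slanted sides meet.
  refine (liftable_side (β := β) (c₁ := s₁ * (a + β) / (s + s₁)) (c₂ := s₂ / s)
    (h := 1 + 1 / (a + β)) (by positivity) (by positivity) ?_).rescale
    (c := s + s₁) (d := s) (by linarith) hs (fun x => ?_) fun x => ?_
  · intro i m e₁ e₂
    by_contra hcon
    push Not at hcon
    have e₁' : s * (-m - β * (i - 1)) - s₁ * (m + 1 - a * (i - 1)) ≤ 0 := by
      have h1 := mul_nonpos_of_nonneg_of_nonpos (by linarith : 0 ≤ s + s₁) e₁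
      have h2 : (s + s₁) * (-m - β * (i - 1) + s₁ * (a + β) / (s + s₁) * (i - (1 + 1 / (a + β)))) =
          s * (-m - β * (i - 1)) - s₁ * (m + 1 - a * (i - 1)) := by
        field_simp
        ring
      linarith
    have e₂' : s * (-m - β * (i - 1)) - s₂ * i ≤ 0 := by
      have h1 := mul_nonpos_of_nonneg_of_nonpos hs.le e₂
      have h2 : s * (-m - β * (i - 1) - s₂ / s * i) = s * (-m - β * (i - 1)) - s₂ * i := by
        field_simp
      linarith
    -- In the cone, `W > 0` forces the other two side functions to be positive. The point is then
    -- interior to the triangle, so `x₀ ≥ 1` and `0 < x₁ < 1`, where `x₁ = m + 1`.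
    have hW : 0 < s * (-m - β * (i - 1)) := mul_pos hs (by linarith)
    have hi : (0 : ℝ) < i := by
      by_contra h0
      nlinarith
    have hi' : (1 : ℝ) ≤ i := by exact_mod_cast (by exact_mod_cast hi : 0 < i)
    have hW' : 0 < (m : ℝ) + 1 - a * (i - 1) := by
      by_contra h0
      nlinarith
    have h1 : (m : ℝ) < 0 := by nlinarith
    have h2 : (-1 : ℝ) < m := by nlinarith
    have h1' : m < 0 := by exact_mod_cast h1
    have h2' : -1 < m := by exact_mod_cast h2
    omega
  · field_simp
    ring
  · field_simp

/-- Each round applies `liftable_triangle` to the current plane `1 - s' W` and lowers `s'` by a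
fixed `κ'`. This works because `Liftable` chooses its number of closures and its factor before the
plane. -/
lemma exists_iter_side (ha : 0 < a) (hβ : 0 < β) (hs₀ : 0 < s₀) (hs₁ : 0 < s₁) (hs₂ : 0 < s₂)
    {Q : Set ((Fin 2 → ℝ) × (Fin 1 → ℝ))} (hQ : Convex ℝ Q)
    (h₀ : ∀ z ∈ Q, 1 - s₀ * (1 - z.1 1 - β * (z.1 0 - 1)) ≤ z.2 0)
    (h₁ : ∀ z ∈ Q, 1 - s₁ * (z.1 1 - a * (z.1 0 - 1)) ≤ z.2 0)
    (h₂ : ∀ z ∈ Q, 1 - s₂ * z.1 0 ≤ z.2 0) {s : ℝ} (hs : 0 < s) (hss : s ≤ s₀) :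
    ∃ n, ∀ z ∈ iterSplitClosure n Q, 1 - s * (1 - z.1 1 - β * (z.1 0 - 1)) ≤ z.2 0 := by
  have haff : ∀ t : ℝ, IsAff fun x => 1 - t * (1 - x 1 - β * (x 0 - 1)) := fun t =>
    IsAff.of_eq (1 - t - t * β) (t * β) t fun x => by ring
  have hmono : ∀ {n : ℕ} {z}, z ∈ iterSplitClosure n Q → z ∈ Q := fun hz =>
    iterSplitClosure_antitone hQ (Nat.zero_le _) hz
  -- the first improvement
  obtain ⟨k, hk⟩ := liftable_triangle ha hβ hs₁ hs₂ hs₀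
  obtain ⟨κ, hκ, hk⟩ := hk 1 one_pos
  have hfirst : ∀ z ∈ iterSplitClosure k Q,
      1 - (s₀ - κ) * (1 - z.1 1 - β * (z.1 0 - 1)) ≤ z.2 0 := by
    intro z hz
    have := hk Q (fun x => 1 - s₀ * (1 - x 1 - β * (x 0 - 1))) hQ (haff _) h₀ (by
      rintro L (rfl | rfl) z hz
      · have := h₁ z hz; simp only; linarith
      · have := h₂ z hz; simp only; linarith) z hz
    linarith
  -- the uniform improvement
  obtain ⟨k', hk'⟩ := liftable_triangle ha hβ hs₁ hs₂ hs
  -- After the first improvement every later `s'` stays below `s₀ - κ`. Since `t s₀ ≤ κ / 2`, this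
  -- gap absorbs the error where `W < 0`, so one `t` serves all rounds.
  set t := min (κ / (2 * s₀)) 1 with ht
  have ht₀ : 0 < t := lt_min (by positivity) one_pos
  have htκ : 2 * (t * s₀) ≤ κ := by
    have := (le_div_iff₀ (by positivity : 0 < 2 * s₀)).1 (min_le_left (κ / (2 * s₀)) 1)
    linarith
  have ht₁ : t ≤ 1 := min_le_right _ _
  obtain ⟨κ', hκ', hk'⟩ := hk' t ht₀
  have hiter : ∀ N : ℕ, ∃ n, ∃ s' : ℝ, (s' ≤ s ∨ s' ≤ s₀ - κ - N * κ') ∧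
      ∀ z ∈ iterSplitClosure n Q, 1 - s' * (1 - z.1 1 - β * (z.1 0 - 1)) ≤ z.2 0 := by
    intro N
    induction N with
    | zero => exact ⟨k, s₀ - κ, Or.inr (by simp), hfirst⟩
    | succ N ih =>
      obtain ⟨n, s', hs', hv⟩ := ih
      rcases le_or_gt s' s with hle | hgt
      · exact ⟨n, s', Or.inl hle, hv⟩
      · have hs'' : s' ≤ s₀ - κ - N * κ' := hs'.resolve_left (not_le.2 hgt)
        have hNκ : 0 ≤ N * κ' := by positivity
        refine ⟨k' + n, s' - κ', Or.inr (by push_cast; linarith), fun z hz => ?_⟩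
        rw [iterSplitClosure_add] at hz
        -- For `W ≥ 0` the current plane suffices, as `s < s'`. For `W ≤ 0` the original facet and
        -- the facet of `g` are averaged with weights `1 - t` and `t`.
        have bound : ∀ W g v : ℝ, 1 - s' * W ≤ v → 1 - s₀ * W ≤ v → 1 - g ≤ v →
            t * (s * W - g) ≤ v - (1 - s' * W) := by
          intro W g v e₁ e₂ e₃
          rcases le_total 0 W with hW | hW
          · have h3 : s * W ≤ s' * W := mul_le_mul_of_nonneg_right hgt.le hW
            have h4 : t * (v - (1 - s' * W)) ≤ 1 * (v - (1 - s' * W)) :=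
              mul_le_mul_of_nonneg_right ht₁ (by linarith)
            have h5 : t * (s * W - g) ≤ t * (v - (1 - s' * W)) :=
              mul_le_mul_of_nonneg_left (by linarith) ht₀.le
            linarith
          · have f₁ : t * (1 - g) ≤ t * v := mul_le_mul_of_nonneg_left e₃ ht₀.le
            have f₂ : (1 - t) * (1 - s₀ * W) ≤ (1 - t) * v :=
              mul_le_mul_of_nonneg_left e₂ (by linarith)
            have f₃ : 0 ≤ (κ - t * s₀) * (-W) :=
              mul_nonneg (by nlinarith) (by linarith)
            have f₄ : 0 ≤ (s₀ - κ - s') * (-W) := mul_nonneg (by linarith) (by linarith)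
            have f₅ : 0 ≤ t * s * (-W) := mul_nonneg (by positivity) (by linarith)
            nlinarith
        have := hk' _ (fun x => 1 - s' * (1 - x 1 - β * (x 0 - 1)))
          (convex_iterSplitClosure hQ n) (haff _) hv (by
          rintro L (rfl | rfl) z hz
          · exact bound _ _ _ (hv z hz) (h₀ z (hmono hz)) (h₁ z (hmono hz))
          · exact bound _ _ _ (hv z hz) (h₀ z (hmono hz)) (h₂ z (hmono hz))) z hz
        linarith
  obtain ⟨N, hN⟩ := exists_nat_gt (s₀ / κ')
  obtain ⟨n, s', hs', hv⟩ := hiter N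
  have hle : s' ≤ s := by
    rcases hs' with h | h
    · exact h
    · have := (div_lt_iff₀ hκ').1 hN
      linarith
  refine ⟨n, fun z hz => ?_⟩
  have e₁ := hv z hz
  have e₂ := h₀ z (hmono hz)
  rcases le_total 0 (1 - z.1 1 - β * (z.1 0 - 1)) with hW | hW
  · have := mul_le_mul_of_nonneg_right hle hW
    linarith
  · have := mul_le_mul_of_nonpos_right hss hW
    linarith

/-- The inequality `z ≥ 1` has finite split rank on the pyramid over a lattice-free triangle with
sides `x₀ = 0`, a side with slope `-β < 0` through `(1, 1)` and a side with slope `a > 0` through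
`(1, 0)`. -/
theorem exists_iter_pyramid (ha : 0 < a) (hβ : 0 < β) (hs₀ : 0 < s₀) (hs₁ : 0 < s₁) (hs₂ : 0 < s₂)
    {Q : Set ((Fin 2 → ℝ) × (Fin 1 → ℝ))} (hQ : Convex ℝ Q)
    (h₀ : ∀ z ∈ Q, 1 - s₀ * (1 - z.1 1 - β * (z.1 0 - 1)) ≤ z.2 0)
    (h₁ : ∀ z ∈ Q, 1 - s₁ * (z.1 1 - a * (z.1 0 - 1)) ≤ z.2 0)
    (h₂ : ∀ z ∈ Q, 1 - s₂ * z.1 0 ≤ z.2 0) :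
    ∃ n, ∀ z ∈ iterSplitClosure n Q, 1 ≤ z.2 0 := by
  -- With steepness `c / β` and `c / a` both slanted facets grow at the same rate `c` in `x₀`.
  set c := min (s₀ * β) (s₁ * a) with hc
  have hc₀ : 0 < c := lt_min (by positivity) (by positivity)
  have hcβ : c / β ≤ s₀ := (div_le_iff₀ hβ).2 (min_le_left _ _)
  have hca : c / a ≤ s₁ := (div_le_iff₀ ha).2 (min_le_right _ _)
  obtain ⟨n₁, hn₁⟩ := exists_iter_side ha hβ hs₀ hs₁ hs₂ hQ h₀ h₁ h₂ (div_pos hc₀ hβ) hcβ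
  -- the reflection exchanging the two sides
  let F : (Fin 2 → ℝ) × (Fin 1 → ℝ) → (Fin 2 → ℝ) × (Fin 1 → ℝ) := fun z =>
    ((fun i => ((!![1, 0; 0, -1] : Matrix (Fin 2) (Fin 2) ℤ) i 0 : ℝ) * z.1 0 +
      (!![1, 0; 0, -1] : Matrix (Fin 2) (Fin 2) ℤ) i 1 * z.1 1 + (![0, 1] : Fin 2 → ℤ) i),
      (LinearMap.id : (Fin 1 → ℝ) →ₗ[ℝ] (Fin 1 → ℝ)) z.2)
  have hF : IsSplitMap F := isSplitMap_intMap _ _ _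
  have hF₀ : ∀ z, (F z).1 0 = z.1 0 := fun z => by simp [F]
  have hF₁ : ∀ z, (F z).1 1 = 1 - z.1 1 := fun z => by simp [F]; ring
  have hF₂ : ∀ z, (F z).2 = z.2 := fun z => rfl
  have hFF : ∀ z, F (F z) = z := fun z => by
    refine Prod.ext (funext fun i => ?_) rfl
    fin_cases i
    · simp [hF₀]
    · simp [hF₁]
  have hQF : Convex ℝ (F ⁻¹' Q) := fun x hx y hy p q hp hq hpq => by
    rw [mem_preimage, hF.comb x y p q hpq]
    exact hQ hx hy hp hq hpq
  obtain ⟨n₂, hn₂⟩ := exists_iter_side (a := β) (β := a) (s₀ := s₁) (s₁ := s₀) hβ ha hs₁ hs₀ hs₂ hQF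
    (fun z hz => by have := h₁ _ hz; rwa [hF₀, hF₁, hF₂] at this)
    (fun z hz => by
      have := h₀ _ hz
      rw [hF₀, hF₁, hF₂] at this
      linarith)
    (fun z hz => by have := h₂ _ hz; rwa [hF₀, hF₂] at this) (div_pos hc₀ ha) hca
  have hmaps := hF.mapsTo_iterSplitClosure (Q := Q) (Q' := F ⁻¹' Q)
    (fun z hz => by rw [mem_preimage, hFF]; exact hz) n₂
  have hJ : ∀ z ∈ iterSplitClosure (max n₁ n₂ + 1) Q, 1 + c * (z.1 0 - 1) ≤ z.2 0 := by
    rw [iterSplitClosure_succ]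
    -- With factor `0`, `convex_above` is just the half-space above a graph.
    have hS := convex_above (IsAff.of_eq (1 - c) c 0 (G := fun x => 1 + c * (x 0 - 1))
      fun x => by ring) (isAff_coord 0 0 0) 0
    intro z hz
    have := splitClosure_subset_of_sides hS ![0, 1] 0 (fun z hz hle => ?_) (fun z hz hle => ?_) hz
    · simp only [mem_ofPred_eq] at this; linarith
    · have e := hn₂ _ (hmaps (iterSplitClosure_antitone hQ (le_max_right _ _) hz))
      rw [hF₀, hF₁, hF₂] at e
      simp only [Fin.sum_univ_two, Matrix.cons_val_zero, Matrix.cons_val_one] at hle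
      push_cast at hle
      have h3 : c / a * (z.1 1) ≤ 0 := mul_nonpos_of_nonneg_of_nonpos (by positivity) (by linarith)
      have h4 : c / a * (a * (z.1 0 - 1)) = c * (z.1 0 - 1) := by field_simp
      simp only [mem_ofPred_eq]
      nlinarith
    · have e := hn₁ _ (iterSplitClosure_antitone hQ (le_max_left _ _) hz)
      simp only [Fin.sum_univ_two, Matrix.cons_val_zero, Matrix.cons_val_one] at hle
      push_cast at hle
      have h3 : c / β * (1 - z.1 1) ≤ 0 :=
        mul_nonpos_of_nonneg_of_nonpos (by positivity) (by linarith)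
      have h4 : c / β * (β * (z.1 0 - 1)) = c * (z.1 0 - 1) := by field_simp
      simp only [mem_ofPred_eq]
      nlinarith
  refine ⟨max n₁ n₂ + 1 + 1, ?_⟩
  rw [iterSplitClosure_succ]
  have hS := convex_above (IsAff.of_eq 1 0 0 (G := fun _ => 1) fun x => by ring)
    (isAff_coord 0 0 0) 0
  intro z hz
  have := splitClosure_subset_of_sides hS ![1, 0] 0 (fun z hz hle => ?_) (fun z hz hle => ?_) hz
  · simp only [mem_ofPred_eq] at this; linarith
  · have e := h₂ _ (iterSplitClosure_antitone hQ (Nat.zero_le _) hz)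
    simp only [Fin.sum_univ_two, Matrix.cons_val_zero, Matrix.cons_val_one] at hle
    push_cast at hle
    simp only [mem_ofPred_eq]
    nlinarith
  · have e := hJ _ hz
    simp only [Fin.sum_univ_two, Matrix.cons_val_zero, Matrix.cons_val_one] at hle
    push_cast at hle
    simp only [mem_ofPred_eq]
    nlinarith

end Pyramid

/-! ### Lattice preserving affine maps of the plane -/

/-- The map `x ↦ M x + c` for an integral matrix `M` and an integral vector `c`. -/
def latMap (M : Matrix (Fin 2) (Fin 2) ℤ) (c : Fin 2 → ℤ) : (Fin 2 → ℝ) →ᵃ[ℝ] (Fin 2 → ℝ) :=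
  (Matrix.mulVecLin (M.map (fun z : ℤ => (z : ℝ)))).toAffineMap +
    AffineMap.const ℝ (Fin 2 → ℝ) (fun i => (c i : ℝ))

lemma latMap_apply (M : Matrix (Fin 2) (Fin 2) ℤ) (c : Fin 2 → ℤ) (x : Fin 2 → ℝ) (i : Fin 2) :
    latMap M c x i = M i 0 * x 0 + M i 1 * x 1 + c i := by
  fin_cases i <;> simp [latMap]

lemma continuous_latMap (M : Matrix (Fin 2) (Fin 2) ℤ) (c : Fin 2 → ℤ) :
    Continuous (latMap M c) := by
  refine continuous_pi fun i => ?_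
  simp only [latMap_apply]
  fun_prop

lemma latMap_mem {M : Matrix (Fin 2) (Fin 2) ℤ} {c : Fin 2 → ℤ} {x : Fin 2 → ℝ}
    (hx : x ∈ latticePoints) : latMap M c x ∈ latticePoints := by
  obtain ⟨z, rfl⟩ := hx
  refine ⟨fun i => M i 0 * z 0 + M i 1 * z 1 + c i, funext fun i => ?_⟩
  rw [latMap_apply]
  push_cast
  ring

lemma intAffine_eq_latMap (M : Matrix (Fin 2) (Fin 2) ℤ) (w : Fin 2 → ℤ) :
    intAffine M w = latMap M (M.mulVec w) := by
  funext x i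
  rw [latMap_apply]
  simp only [intAffine, Matrix.mulVec, dotProduct, Fin.sum_univ_two, Matrix.map_apply,
    Pi.add_apply]
  push_cast
  ring

/-- Two mutually inverse lattice maps, as a homeomorphism. -/
structure LatPair where
  M : Matrix (Fin 2) (Fin 2) ℤ
  c : Fin 2 → ℤ
  N : Matrix (Fin 2) (Fin 2) ℤ
  d : Fin 2 → ℤ
  left_inv : ∀ x, latMap N d (latMap M c x) = x
  right_inv : ∀ x, latMap M c (latMap N d x) = x

namespace LatPair

variable (φ : LatPair)

/-- The underlying affine map. -/
def map : (Fin 2 → ℝ) →ᵃ[ℝ] (Fin 2 → ℝ) := latMap φ.M φ.c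

/-- The inverse affine map. -/
def inv : (Fin 2 → ℝ) →ᵃ[ℝ] (Fin 2 → ℝ) := latMap φ.N φ.d

lemma inv_map (x : Fin 2 → ℝ) : φ.inv (φ.map x) = x := φ.left_inv x

lemma map_inv (x : Fin 2 → ℝ) : φ.map (φ.inv x) = x := φ.right_inv x

lemma injective : Function.Injective φ.map := Function.LeftInverse.injective φ.inv_map

lemma map_mem_iff {x : Fin 2 → ℝ} : φ.map x ∈ latticePoints ↔ x ∈ latticePoints :=
  ⟨fun h => φ.inv_map x ▸ latMap_mem h, latMap_mem⟩

/-- The underlying homeomorphism. -/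
def homeo : (Fin 2 → ℝ) ≃ₜ (Fin 2 → ℝ) where
  toFun := φ.map
  invFun := φ.inv
  left_inv := φ.inv_map
  right_inv := φ.map_inv
  continuous_toFun := continuous_latMap _ _
  continuous_invFun := continuous_latMap _ _

lemma image_interior (S : Set (Fin 2 → ℝ)) : φ.map '' interior S = interior (φ.map '' S) :=
  φ.homeo.image_interior S

lemma image_frontier (S : Set (Fin 2 → ℝ)) : φ.map '' frontier S = frontier (φ.map '' S) :=
  φ.homeo.image_frontier S

lemma image_lattice : φ.map '' latticePoints = latticePoints :=
  Subset.antisymm (image_subset_iff.2 fun _ h => latMap_mem h)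
    fun y hy => ⟨φ.inv y, latMap_mem hy, φ.map_inv y⟩

lemma latticeFree {S : Set (Fin 2 → ℝ)} (h : LatticeFree S) : LatticeFree (φ.map '' S) := by
  rw [LatticeFree, ← φ.image_interior, ← φ.image_lattice]
  exact disjoint_image_of_injective φ.injective h

lemma image_openSegment_inter (a b : Fin 2 → ℝ) :
    openSegment ℝ (φ.map a) (φ.map b) ∩ latticePoints =
      φ.map '' (openSegment ℝ a b ∩ latticePoints) := by
  rw [image_inter φ.injective, image_openSegment, φ.image_lattice]

lemma oneInside {a b : Fin 2 → ℝ} (h : OneInside a b) : OneInside (φ.map a) (φ.map b) := by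
  obtain ⟨p, hp, hu⟩ := h
  rw [OneInside, φ.image_openSegment_inter]
  refine ⟨φ.map p, mem_image_of_mem _ hp, ?_⟩
  rintro _ ⟨q, hq, rfl⟩
  rw [hu q hq]

lemma isTriangle {S : Set (Fin 2 → ℝ)} {v : Fin 3 → Fin 2 → ℝ} (h : IsTriangle S v) :
    IsTriangle (φ.map '' S) (φ.map ∘ v) :=
  ⟨h.1.map' φ.map φ.injective, by rw [h.2, AffineMap.image_convexHull, range_comp]⟩

lemma nontrivial_segment {a b : Fin 2 → ℝ} (h : (segment ℝ a b ∩ latticePoints).Nontrivial) :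
    (segment ℝ (φ.map a) (φ.map b) ∩ latticePoints).Nontrivial := by
  rw [← image_segment, ← φ.image_lattice, ← image_inter φ.injective]
  exact h.image φ.injective

lemma isT2A {S : Set (Fin 2 → ℝ)} (h : IsT2A S) : IsT2A (φ.map '' S) := by
  obtain ⟨hS, v, hv, h0, h12, h01, h02⟩ := h
  exact ⟨φ.latticeFree hS, φ.map ∘ v, φ.isTriangle hv, fun h => h0 (φ.map_mem_iff.1 h),
    φ.nontrivial_segment h12, φ.oneInside h01, φ.oneInside h02⟩

lemma isT2B {S : Set (Fin 2 → ℝ)} (h : IsT2B S) : IsT2B (φ.map '' S) := by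
  obtain ⟨hS, ⟨v, hv, h0, h12, h01, h02⟩, T, hT, hST⟩ := h
  refine ⟨φ.latticeFree hS, ⟨φ.map ∘ v, φ.isTriangle hv, fun h => h0 (φ.map_mem_iff.1 h),
    φ.nontrivial_segment h12, φ.oneInside h01, ?_⟩, _, φ.isT2A hT, image_mono hST⟩
  exact (φ.image_openSegment_inter _ _).trans (by rw [h02, image_empty])

/-- A lattice map with unimodular matrix is invertible. -/
lemma exists_of_isUnit (M : Matrix (Fin 2) (Fin 2) ℤ) (c : Fin 2 → ℤ) (h : IsUnit M.det) :
    ∃ φ : LatPair, φ.M = M ∧ φ.c = c := by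
  set D := M.det with hD
  have hDD : (D : ℝ) * D = 1 := by
    rcases Int.isUnit_iff.1 h with h | h <;> rw [h] <;> norm_num
  have hD' : (D : ℝ) = M 0 0 * M 1 1 - M 0 1 * M 1 0 := by
    rw [hD, Matrix.det_fin_two]; push_cast; ring
  -- As `D = ±1` is its own inverse, the inverse matrix is `D` times the adjugate.
  refine ⟨⟨M, c, !![D * M 1 1, -D * M 0 1; -D * M 1 0, D * M 0 0],
    ![-D * (M 1 1 * c 0 - M 0 1 * c 1), -D * (M 0 0 * c 1 - M 1 0 * c 0)], ?_, ?_⟩, rfl, rfl⟩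
  · intro x
    funext i
    fin_cases i
    · simp only [Fin.zero_eta, latMap_apply, Matrix.of_apply, Matrix.cons_val', Matrix.cons_val_zero,
        Matrix.cons_val_one, Matrix.cons_val_fin_one]
      push_cast
      linear_combination x 0 * hDD + (-(D : ℝ) * x 0) * hD'
    · simp only [Fin.mk_one, latMap_apply, Matrix.of_apply, Matrix.cons_val', Matrix.cons_val_zero,
        Matrix.cons_val_one, Matrix.cons_val_fin_one]
      push_cast
      linear_combination x 1 * hDD + (-(D : ℝ) * x 1) * hD'
  · intro x
    funext i
    fin_cases i
    · simp only [Fin.zero_eta, latMap_apply, Matrix.of_apply, Matrix.cons_val', Matrix.cons_val_zero,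
        Matrix.cons_val_one, Matrix.cons_val_fin_one]
      push_cast
      linear_combination (x 0 - c 0) * hDD + (-(D : ℝ) * (x 0 - c 0)) * hD'
    · simp only [Fin.mk_one, latMap_apply, Matrix.of_apply, Matrix.cons_val', Matrix.cons_val_zero,
        Matrix.cons_val_one, Matrix.cons_val_fin_one]
      push_cast
      linear_combination (x 1 - c 1) * hDD + (-(D : ℝ) * (x 1 - c 1)) * hD'

end LatPair

/-! ### Split rank and containment of induced sets -/

/-- An affine function that is nonnegative at all points `f + rⁱ / αᵢ` is positive at `f`, since
the rays generate the plane. -/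
lemma pos_of_hull_eq_top {k : ℕ} {f : Fin 2 → ℝ} {R : Fin k → Fin 2 → ℝ} {α : Fin k → ℝ}
    (hR : PointedCone.hull ℝ (range R) = ⊤) (hα : ∀ i, 0 < α i) {c₀ c₁ c₂ : ℝ}
    (hc : c₁ ≠ 0 ∨ c₂ ≠ 0)
    (h : ∀ i, 0 ≤ c₀ + c₁ * (f + (α i)⁻¹ • R i) 0 + c₂ * (f + (α i)⁻¹ • R i) 1) :
    0 < c₀ + c₁ * f 0 + c₂ * f 1 := by
  by_contra hcon
  push Not at hcon
  have hdir : ∀ i, 0 ≤ c₁ * R i 0 + c₂ * R i 1 := by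
    intro i
    have := h i
    simp only [Pi.add_apply, Pi.smul_apply, smul_eq_mul] at this
    have h2 : 0 ≤ (α i)⁻¹ * (c₁ * R i 0 + c₂ * R i 1) := by linarith
    exact nonneg_of_mul_nonneg_right h2 (inv_pos.2 (hα i))
  have hmem : (![-c₁, -c₂] : Fin 2 → ℝ) ∈ PointedCone.hull ℝ (range R) := by rw [hR]; trivial
  have : 0 ≤ c₁ * (![-c₁, -c₂] : Fin 2 → ℝ) 0 + c₂ * (![-c₁, -c₂] : Fin 2 → ℝ) 1 := by
    refine Submodule.span_induction (p := fun x _ => 0 ≤ c₁ * x 0 + c₂ * x 1) ?_ ?_ ?_ ?_ hmem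
    · rintro _ ⟨i, rfl⟩; exact hdir i
    · simp
    · intro x y _ _ hx hy
      simp only [Pi.add_apply]; linarith
    · intro a x _ hx
      have ha : (0 : ℝ) ≤ a := a.2
      have : a • x = (a : ℝ) • x := rfl
      rw [this]
      simp only [Pi.smul_apply, smul_eq_mul]
      nlinarith [mul_nonneg ha hx]
  simp only [Matrix.cons_val_zero, Matrix.cons_val_one] at this
  rcases hc with hc | hc
  · have := mul_self_pos.2 hc
    nlinarith [mul_self_nonneg c₂]
  · have := mul_self_pos.2 hc
    nlinarith [mul_self_nonneg c₁]

lemma relaxP_coord {k : ℕ} {f : Fin 2 → ℝ} {R : Fin k → Fin 2 → ℝ}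
    {z : (Fin 2 → ℝ) × (Fin k → ℝ)} (hz : z ∈ relaxP f R) (j : Fin 2) :
    z.1 j = f j + ∑ i, z.2 i * R i j := by
  rw [hz.1]
  simp [Finset.sum_apply]

/-- An affine function that is nonnegative at the points `f + rⁱ / αᵢ` decreases at most linearly
in `∑ αᵢ sᵢ`. -/
lemma sub_mul_sum_le {k : ℕ} {f : Fin 2 → ℝ} {R : Fin k → Fin 2 → ℝ} {α : Fin k → ℝ}
    (hα : ∀ i, 0 < α i) {c₀ c₁ c₂ : ℝ}
    (h : ∀ i, 0 ≤ c₀ + c₁ * (f + (α i)⁻¹ • R i) 0 + c₂ * (f + (α i)⁻¹ • R i) 1)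
    {z : (Fin 2 → ℝ) × (Fin k → ℝ)} (hz : z ∈ relaxP f R) :
    (c₀ + c₁ * f 0 + c₂ * f 1) * (1 - ∑ i, α i * z.2 i) ≤ c₀ + c₁ * z.1 0 + c₂ * z.1 1 := by
  have hdir : ∀ i, -(c₀ + c₁ * f 0 + c₂ * f 1) * α i ≤ c₁ * R i 0 + c₂ * R i 1 := by
    intro i
    have h1 := mul_nonneg (hα i).le (h i)
    simp only [Pi.add_apply, Pi.smul_apply, smul_eq_mul] at h1
    have h2 : α i * (c₀ + c₁ * (f 0 + (α i)⁻¹ * R i 0) + c₂ * (f 1 + (α i)⁻¹ * R i 1)) =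
        (c₀ + c₁ * f 0 + c₂ * f 1) * α i + (c₁ * R i 0 + c₂ * R i 1) := by
      have := (hα i).ne'
      field_simp
      ring
    linarith
  have hsum : ∑ i, (-(c₀ + c₁ * f 0 + c₂ * f 1) * α i) * z.2 i ≤
      ∑ i, (c₁ * R i 0 + c₂ * R i 1) * z.2 i :=
    Finset.sum_le_sum fun i _ => mul_le_mul_of_nonneg_right (hdir i) (hz.2 i)
  have e₁ : ∑ i, (-(c₀ + c₁ * f 0 + c₂ * f 1) * α i) * z.2 i =
      -(c₀ + c₁ * f 0 + c₂ * f 1) * ∑ i, α i * z.2 i := by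
    rw [Finset.mul_sum]; exact Finset.sum_congr rfl fun i _ => by ring
  have e₂ : ∑ i, (c₁ * R i 0 + c₂ * R i 1) * z.2 i =
      c₁ * (z.1 0 - f 0) + c₂ * (z.1 1 - f 1) := by
    rw [relaxP_coord hz 0, relaxP_coord hz 1, add_sub_cancel_left, add_sub_cancel_left,
      Finset.mul_sum, Finset.mul_sum, ← Finset.sum_add_distrib]
    exact Finset.sum_congr rfl fun i _ => by ring
  rw [e₁, e₂] at hsum
  linarith

lemma IsAff.convex_epi {E : (Fin 2 → ℝ) → ℝ} (hE : IsAff E) :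
    Convex ℝ {z : (Fin 2 → ℝ) × (Fin 1 → ℝ) | E z.1 ≤ z.2 0} := by
  have := convex_above hE hE 0
  simpa only [zero_mul, sub_nonneg] using this

/-- If all points `f + rⁱ / αᵢ` lie, in suitable integral coordinates, in a triangle as in
`exists_iter_pyramid`, then the split rank is finite. -/
lemma cutRank_lt_top_of_coords {k : ℕ} {f : Fin 2 → ℝ} {R : Fin k → Fin 2 → ℝ} {α : Fin k → ℝ}
    (hR : PointedCone.hull ℝ (range R) = ⊤) (hα : ∀ i, 0 < α i) (φ : LatPair) {a β : ℝ}
    (ha : 0 < a) (hβ : 0 < β)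
    (h : ∀ i, 0 ≤ φ.map (f + (α i)⁻¹ • R i) 0 ∧
      0 ≤ 1 - φ.map (f + (α i)⁻¹ • R i) 1 - β * (φ.map (f + (α i)⁻¹ • R i) 0 - 1) ∧
      0 ≤ φ.map (f + (α i)⁻¹ • R i) 1 - a * (φ.map (f + (α i)⁻¹ • R i) 0 - 1)) :
    cutRank f R α < ⊤ := by
  -- a general affine function in the new coordinates
  have key : ∀ c₀ c₁ c₂ : ℝ, (c₁ ≠ 0 ∨ c₂ ≠ 0) →
      (∀ i, 0 ≤ c₀ + c₁ * φ.map (f + (α i)⁻¹ • R i) 0 + c₂ * φ.map (f + (α i)⁻¹ • R i) 1) →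
      ∃ g > 0, ∀ z ∈ relaxP f R,
        g * (1 - ∑ i, α i * z.2 i) ≤ c₀ + c₁ * φ.map z.1 0 + c₂ * φ.map z.1 1 := by
    intro c₀ c₁ c₂ hc hi
    have e : ∀ x, c₀ + c₁ * φ.map x 0 + c₂ * φ.map x 1 =
        (c₀ + c₁ * φ.c 0 + c₂ * φ.c 1) + (c₁ * φ.M 0 0 + c₂ * φ.M 1 0) * x 0 +
          (c₁ * φ.M 0 1 + c₂ * φ.M 1 1) * x 1 := fun x => by
      rw [LatPair.map, latMap_apply, latMap_apply]; ring
    have hne : c₁ * φ.M 0 0 + c₂ * φ.M 1 0 ≠ 0 ∨ c₁ * φ.M 0 1 + c₂ * φ.M 1 1 ≠ 0 := by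
      by_contra hcon
      push Not at hcon
      have hconst : ∀ y : Fin 2 → ℝ, c₀ + c₁ * y 0 + c₂ * y 1 = c₀ + c₁ * φ.c 0 + c₂ * φ.c 1 := by
        intro y
        have := e (φ.inv y)
        rwa [φ.map_inv, hcon.1, hcon.2, zero_mul, zero_mul, add_zero, add_zero] at this
      have h0 := hconst 0
      have h1 := hconst ![1, 0]
      have h2 := hconst ![0, 1]
      simp at h0 h1 h2
      rcases hc with hc | hc
      · exact hc (by linarith)
      · exact hc (by linarith)
    simp only [e] at hi ⊢
    exact ⟨_, pos_of_hull_eq_top hR hα hne hi, fun z hz => sub_mul_sum_le hα hi hz⟩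
  obtain ⟨g₀, hg₀, k₀⟩ := key (1 + β) (-β) (-1) (Or.inr (by norm_num)) fun i => by
    linarith [(h i).2.1]
  obtain ⟨g₁, hg₁, k₁⟩ := key a (-a) 1 (Or.inr (by norm_num)) fun i => by
    linarith [(h i).2.2]
  obtain ⟨g₂, hg₂, k₂⟩ := key 0 1 0 (Or.inl (by norm_num)) fun i => by
    linarith [(h i).1]
  -- All continuous variables collapse to the height `∑ αᵢ sᵢ`; the cut becomes `z ≥ 1`.
  let A : (Fin k → ℝ) →ₗ[ℝ] (Fin 1 → ℝ) :=
    LinearMap.pi fun _ => ∑ i, α i • LinearMap.proj i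
  have hA : ∀ s : Fin k → ℝ, A s 0 = ∑ i, α i * s i := fun s => by
    simp [A, LinearMap.sum_apply]
  have hF := isSplitMap_intMap φ.M φ.c A
  set Q : Set ((Fin 2 → ℝ) × (Fin 1 → ℝ)) :=
    {z | (fun x => 1 - 1 / g₀ * (1 - x 1 - β * (x 0 - 1))) z.1 ≤ z.2 0} ∩
    {z | (fun x => 1 - 1 / g₁ * (x 1 - a * (x 0 - 1))) z.1 ≤ z.2 0} ∩
    {z | (fun x => 1 - 1 / g₂ * x 0) z.1 ≤ z.2 0} with hQdef
  have aff₀ : IsAff fun x => 1 - 1 / g₀ * (1 - x 1 - β * (x 0 - 1)) :=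
    IsAff.of_eq (1 - 1 / g₀ - 1 / g₀ * β) (1 / g₀ * β) (1 / g₀) fun x => by ring
  have aff₁ : IsAff fun x => 1 - 1 / g₁ * (x 1 - a * (x 0 - 1)) :=
    IsAff.of_eq (1 - 1 / g₁ * a) (1 / g₁ * a) (-(1 / g₁)) fun x => by ring
  have aff₂ : IsAff fun x => 1 - 1 / g₂ * x 0 :=
    IsAff.of_eq 1 (-(1 / g₂)) 0 fun x => by ring
  have hQ : Convex ℝ Q := (aff₀.convex_epi.inter aff₁.convex_epi).inter aff₂.convex_epi
  obtain ⟨n, hn⟩ := exists_iter_pyramid (s₀ := 1 / g₀) (s₁ := 1 / g₁) (s₂ := 1 / g₂) ha hβ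
    (by positivity) (by positivity) (by positivity) hQ
    (fun z hz => hz.1.1) (fun z hz => hz.1.2) (fun z hz => hz.2)
  refine cutRank_lt_top (n := n) (cutValidOn_iff.2 fun z hz => ?_)
  have hmaps := hF.mapsTo_iterSplitClosure (Q := relaxP f R) (Q' := Q) (fun z hz => ?_) n
  · have := hn _ (hmaps hz)
    simpa only [hA] using this
  · have hm : (fun i => (φ.M i 0 : ℝ) * z.1 0 + φ.M i 1 * z.1 1 + φ.c i) = φ.map z.1 :=
      funext fun i => (latMap_apply _ _ _ _).symm
    have key₂ : ∀ g W S : ℝ, 0 < g → g * (1 - S) ≤ W → 1 - 1 / g * W ≤ S := by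
      intro g W S hg hW
      have : 1 - S ≤ 1 / g * W := by
        rw [one_div, inv_mul_eq_div, le_div_iff₀ hg]; linarith
      linarith
    refine ⟨⟨?_, ?_⟩, ?_⟩
    · simp only [mem_ofPred_eq, hA, hm]
      exact key₂ _ _ _ hg₀ ((k₀ z hz).trans (by linarith))
    · simp only [mem_ofPred_eq, hA, hm]
      exact key₂ _ _ _ hg₁ ((k₁ z hz).trans (by linarith))
    · simp only [mem_ofPred_eq, hA, hm]
      exact key₂ _ _ _ hg₂ ((k₂ z hz).trans (by linarith))

/-! ### Lattice-free triangles of type `T²ᴬ` in coordinates -/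

/-- The lattice points on the two sides of a triangle of type `T²ᴬ` lie on the first lattice line
next to the long side, and a shear makes the slopes of the two sides have opposite signs. The sides
are the graphs of `t₁ + A x` and `t₂ + B x`, for `0 ≤ x ≤ h`. -/
lemma exists_shear {h A B t₁ t₂ : ℝ} (hh : 0 < h) (ht₁ : 1 ≤ t₁) (ht₂ : t₂ ≤ 0)
    (hAB : t₁ + A * h = t₂ + B * h)
    (hv : ∀ i j : ℤ, h = i → t₁ + A * h ≠ j)
    (hfree : ∀ i j : ℤ, 0 < i → t₂ + B * i < j → t₁ + A * i ≤ j)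
    (hup : ∃ m b : ℤ, 0 < m ∧ (m : ℝ) < h ∧ t₁ + A * m = b ∧
      ∀ m' b' : ℤ, 0 < m' → (m' : ℝ) < h → t₁ + A * m' = b' → m' = m)
    (hlo : ∃ m b : ℤ, 0 < m ∧ (m : ℝ) < h ∧ t₂ + B * m = b ∧
      ∀ m' b' : ℤ, 0 < m' → (m' : ℝ) < h → t₂ + B * m' = b' → m' = m) :
    ∃ b n : ℤ, t₁ + A = b + 1 ∧ t₂ + B = b ∧ 0 < b - t₂ + n ∧ 0 < t₁ - (b + 1) - n := by
  have hdiff : ∀ x, x < h → t₂ + B * x < t₁ + A * x := by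
    intro x hx
    by_contra hcon
    have h1 : 0 < B - A := by nlinarith
    nlinarith
  obtain ⟨m, b, hm, hmh, hmb, hmu⟩ := hup
  obtain ⟨m', b', hm', hmh', hmb', hmu'⟩ := hlo
  have hmr : (0 : ℝ) < m := by exact_mod_cast hm
  have hmr' : (0 : ℝ) < m' := by exact_mod_cast hm'
  have h1m : (1 : ℝ) ≤ m := by exact_mod_cast hm
  have h1m' : (1 : ℝ) ≤ m' := by exact_mod_cast hm'
  have h1h : 1 < h := by linarith
  have hceil : ∀ m b : ℤ, 0 < m → ∃ j : ℤ, b ≤ m * j ∧ m * j ≤ b + m - 1 := by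
    intro m b hm
    refine ⟨-(-b / m), ?_, ?_⟩
    · have h2 := Int.emod_add_mul_ediv (-b) m
      have h3 := Int.emod_nonneg (-b) hm.ne'
      linarith
    · have h2 := Int.emod_add_mul_ediv (-b) m
      have h3 := Int.emod_lt_of_pos (-b) hm
      linarith
  -- the upper side
  have hm1 : m = 1 := by
    -- Take `j = ⌈b / m⌉`. By convexity and `t₂ ≤ 0`, the point `(1, j)` is above the lower side; as
    -- `t₁ ≥ 1`, it is not above the upper one. Lattice-freeness puts it on the upper side, and
    -- uniqueness gives `m = 1`.
    obtain ⟨j, hj₁, hj₂⟩ := hceil m b hm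
    have hj₁' : (b : ℝ) ≤ m * j := by exact_mod_cast hj₁
    have hj₂' : (m : ℝ) * j ≤ b + m - 1 := by exact_mod_cast hj₂
    have hlt : t₂ + B * (1 : ℤ) < j := by
      have := hdiff m hmh
      push_cast
      by_contra hcon
      nlinarith
    have hge := hfree 1 j one_pos hlt
    have hle : (j : ℝ) ≤ t₁ + A * (1 : ℤ) := by
      push_cast
      by_contra hcon
      nlinarith
    exact (hmu 1 j one_pos (by simpa using h1h) (le_antisymm hge hle)).symm
  have hm1' : m' = 1 := by
    obtain ⟨j, hj₁, hj₂⟩ := hceil m' b' hm'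
    have hj₁' : (b' : ℝ) ≤ m' * j := by exact_mod_cast hj₁
    have hj₂' : (m' : ℝ) * j ≤ b' + m' - 1 := by exact_mod_cast hj₂
    have hlt : (j : ℝ) < t₁ + A * (1 : ℤ) := by
      have := hdiff m' hmh'
      push_cast
      by_contra hcon
      nlinarith
    have hge : t₂ + B * (1 : ℤ) ≤ j := by
      push_cast
      by_contra hcon
      nlinarith
    have hle : (j : ℝ) ≤ t₂ + B * (1 : ℤ) := by
      by_contra hcon
      exact absurd (hfree 1 j one_pos (not_le.1 hcon)) (not_le.2 hlt)
    exact (hmu' 1 j one_pos (by simpa using h1h) (le_antisymm hge hle)).symm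
  subst hm1
  subst hm1'
  simp only [Int.cast_one, mul_one] at hmb hmb'
  have hbb : b = b' + 1 := by
    have h1 := hdiff 1 h1h
    have h2 := hfree 1 (b' + 1) one_pos (by push_cast; linarith)
    push_cast at h2
    have h3 : (b : ℝ) ≤ b' + 1 := by linarith
    have h4 : (b' : ℝ) < b := by linarith
    have h3' : b ≤ b' + 1 := by exact_mod_cast h3
    have h4' : b' < b := by exact_mod_cast h4
    omega
  have hbr : (b : ℝ) = b' + 1 := by exact_mod_cast hbb
  -- The vertical width is affine, with values `t₁ - t₂` at `0`, `1` at `1` and `0` at `h`.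
  have ht : (t₁ - t₂) * (h - 1) = h := by
    have : (t₁ - t₂) + (A - B) = 1 := by linarith
    linear_combination h * this - hAB
  -- Needed is an integer `n` strictly between `t₂ - b'` and `t₁ - b' - 1`. The choice `-b'` fails
  -- only if `t₁ = 1` or `t₂ = 0`. In these cases `h < 2`, since otherwise a side has a second
  -- lattice point or the apex is integral; hence `t₁ - t₂ > 2` and a neighbour of `-b'` works.
  rcases lt_or_eq_of_le ht₂ with hlt₂ | heq₂
  · rcases lt_or_eq_of_le ht₁ with hlt₁ | heq₁
    · exact ⟨b', -b', by linarith, hmb', by push_cast; linarith, by push_cast; linarith⟩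
    · -- the upper vertex is a lattice point
      have hlt2 : h < 2 := by
        rcases lt_trichotomy h 2 with h2 | h2 | h2
        · exact h2
        · exact absurd (by push_cast; rw [h2, ← heq₁]; linarith)
            (hv 2 (2 * b - 1) (by push_cast; exact h2))
        · have := hmu 2 (2 * b - 1) two_pos (by push_cast; exact h2) (by push_cast; linarith)
          omega
      refine ⟨b', -b' - 1, by linarith, hmb', ?_, by push_cast; linarith⟩
      push_cast
      nlinarith
  · have hlt2 : h < 2 := by
      rcases lt_trichotomy h 2 with h2 | h2 | h2
      · exact h2
      · exact absurd (by push_cast; rw [hAB, h2, heq₂]; linarith)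
          (hv 2 (2 * b') (by push_cast; exact h2))
      · have := hmu' 2 (2 * b') two_pos (by push_cast; exact h2) (by push_cast; linarith)
        omega
    refine ⟨b', -b' + 1, by linarith, hmb', by push_cast; linarith, ?_⟩
    push_cast
    nlinarith


namespace LatPair

/-- Composition of lattice maps. -/
def trans (φ ψ : LatPair) : LatPair where
  M := ψ.M * φ.M
  c := fun i => ψ.M i 0 * φ.c 0 + ψ.M i 1 * φ.c 1 + ψ.c i
  N := φ.N * ψ.N
  d := fun i => φ.N i 0 * ψ.d 0 + φ.N i 1 * ψ.d 1 + φ.d i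
  left_inv x := by
    have h₁ : ∀ x, latMap (ψ.M * φ.M) (fun i => ψ.M i 0 * φ.c 0 + ψ.M i 1 * φ.c 1 + ψ.c i) x =
        ψ.map (φ.map x) := fun x => funext fun i => by
      simp only [map, latMap_apply, Matrix.mul_apply, Fin.sum_univ_two]; push_cast; ring
    have h₂ : ∀ x, latMap (φ.N * ψ.N) (fun i => φ.N i 0 * ψ.d 0 + φ.N i 1 * ψ.d 1 + φ.d i) x =
        φ.inv (ψ.inv x) := fun x => funext fun i => by
      simp only [inv, latMap_apply, Matrix.mul_apply, Fin.sum_univ_two]; push_cast; ring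
    rw [h₁, h₂, inv_map, inv_map]
  right_inv x := by
    have h₁ : ∀ x, latMap (ψ.M * φ.M) (fun i => ψ.M i 0 * φ.c 0 + ψ.M i 1 * φ.c 1 + ψ.c i) x =
        ψ.map (φ.map x) := fun x => funext fun i => by
      simp only [map, latMap_apply, Matrix.mul_apply, Fin.sum_univ_two]; push_cast; ring
    have h₂ : ∀ x, latMap (φ.N * ψ.N) (fun i => φ.N i 0 * ψ.d 0 + φ.N i 1 * ψ.d 1 + φ.d i) x =
        φ.inv (ψ.inv x) := fun x => funext fun i => by
      simp only [inv, latMap_apply, Matrix.mul_apply, Fin.sum_univ_two]; push_cast; ring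
    rw [h₁, h₂, map_inv, map_inv]

lemma trans_map (φ ψ : LatPair) (x : Fin 2 → ℝ) : (φ.trans ψ).map x = ψ.map (φ.map x) :=
  funext fun i => by
    simp only [map, trans, latMap_apply, Matrix.mul_apply, Fin.sum_univ_two]; push_cast; ring

end LatPair

lemma mem_segment_coord {a b p : Fin 2 → ℝ} (h : p ∈ segment ℝ a b) :
    ∃ t : ℝ, 0 ≤ t ∧ t ≤ 1 ∧ ∀ i, p i = a i + t * (b i - a i) := by
  obtain ⟨s, t, hs, ht, hst, rfl⟩ := h
  refine ⟨t, ht, by linarith, fun i => ?_⟩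
  simp only [Pi.add_apply, Pi.smul_apply, smul_eq_mul]
  linear_combination a i * hst

lemma mem_openSegment_coord {a b p : Fin 2 → ℝ} :
    p ∈ openSegment ℝ a b ↔ ∃ t : ℝ, 0 < t ∧ t < 1 ∧ ∀ i, p i = a i + t * (b i - a i) := by
  constructor
  · rintro ⟨s, t, hs, ht, hst, rfl⟩
    refine ⟨t, ht, by linarith, fun i => ?_⟩
    simp only [Pi.add_apply, Pi.smul_apply, smul_eq_mul]
    linear_combination a i * hst
  · rintro ⟨t, ht, ht', h⟩
    refine ⟨1 - t, t, by linarith, ht, by ring, funext fun i => ?_⟩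
    simp only [Pi.add_apply, Pi.smul_apply, smul_eq_mul, h]
    ring

/-- The vertices of a triangle are not on a line. -/
lemma AffineIndependent.not_line {v : Fin 3 → Fin 2 → ℝ} (h : AffineIndependent ℝ v)
    {c₀ c₁ c₂ : ℝ} (hc : c₁ ≠ 0 ∨ c₂ ≠ 0) : ¬ ∀ i, c₀ + c₁ * v i 0 + c₂ * v i 1 = 0 := by
  intro hline
  rw [affineIndependent_iff_not_collinear] at h
  refine h ((collinear_iff_of_mem (mem_range_self 0)).2 ⟨![-c₂, c₁], ?_⟩)
  rintro _ ⟨i, rfl⟩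
  have h0 := hline 0
  have hi := hline i
  have hn : c₁ ^ 2 + c₂ ^ 2 ≠ 0 := by
    rcases hc with hc | hc
    · nlinarith [mul_self_pos.2 hc, mul_self_nonneg c₂]
    · nlinarith [mul_self_pos.2 hc, mul_self_nonneg c₁]
  refine ⟨(-c₂ * (v i 0 - v 0 0) + c₁ * (v i 1 - v 0 1)) / (c₁ ^ 2 + c₂ ^ 2), funext fun j => ?_⟩
  fin_cases j
  · simp only [Fin.zero_eta, vadd_eq_add, Pi.add_apply, Pi.smul_apply, smul_eq_mul,
      Matrix.cons_val_zero]
    field_simp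
    linear_combination c₁ * (hi - h0)
  · simp only [Fin.mk_one, vadd_eq_add, Pi.add_apply, Pi.smul_apply, smul_eq_mul,
      Matrix.cons_val_one, Matrix.cons_val_fin_one]
    field_simp
    linear_combination c₂ * (hi - h0)

/-- Lattice coordinates that put a segment with two lattice points on the line `x₀ = 0`. -/
lemma exists_coords_of_segment {v : Fin 3 → Fin 2 → ℝ} (hv : AffineIndependent ℝ v)
    (h12 : (segment ℝ (v 1) (v 2) ∩ latticePoints).Nontrivial) :
    ∃ φ : LatPair, φ.map (v 1) 0 = 0 ∧ φ.map (v 2) 0 = 0 ∧ 0 < φ.map (v 0) 0 ∧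
      (1 ≤ φ.map (v 1) 1 ∧ φ.map (v 2) 1 ≤ 0 ∨ 1 ≤ φ.map (v 2) 1 ∧ φ.map (v 1) 1 ≤ 0) := by
  obtain ⟨_, ⟨hP, ⟨P, rfl⟩⟩, _, ⟨hP', ⟨P', rfl⟩⟩, hne⟩ := h12
  obtain ⟨t, ht0, ht1, ht⟩ := mem_segment_coord hP
  obtain ⟨t', ht0', ht1', ht'⟩ := mem_segment_coord hP'
  have hg : 0 < Int.gcd (P' 0 - P 0) (P' 1 - P 1) := by
    rw [Int.gcd_pos_iff]
    by_contra hcon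
    push Not at hcon
    apply hne
    funext i
    fin_cases i
    · simp only [Fin.zero_eta]; exact_mod_cast (sub_eq_zero.1 hcon.1).symm
    · simp only [Fin.mk_one]; exact_mod_cast (sub_eq_zero.1 hcon.2).symm
  obtain ⟨d₀, d₁, hd, hd₀, hd₁⟩ := Int.exists_gcd_one hg
  set g := Int.gcd (P' 0 - P 0) (P' 1 - P 1) with hgdef
  obtain ⟨u, w, huw⟩ := Int.isCoprime_iff_gcd_eq_one.2 hd
  have hgr : (1 : ℝ) ≤ g := by exact_mod_cast hg
  have hd₀' : (P' 0 : ℝ) - P 0 = d₀ * g := by exact_mod_cast hd₀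
  have hd₁' : (P' 1 : ℝ) - P 1 = d₁ * g := by exact_mod_cast hd₁
  have huw' : (u : ℝ) * d₀ + w * d₁ = 1 := by exact_mod_cast huw
  have htt : t ≠ t' := by
    rintro rfl
    exact hne (funext fun i => by rw [ht i, ht' i])
  -- the linear function vanishing on the segment
  have hlin : ∀ i : Fin 3, i ≠ 0 → (d₁ : ℝ) * (v i 0 - P 0) - d₀ * (v i 1 - P 1) = 0 := by
    have e : (d₁ : ℝ) * (P' 0 - P 0) - d₀ * (P' 1 - P 1) = 0 := by rw [hd₀', hd₁']; ring
    have e' : (d₁ : ℝ) * (v 2 0 - v 1 0) - d₀ * (v 2 1 - v 1 1) = 0 := by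
      rw [ht 0, ht 1, ht' 0, ht' 1] at e
      have : (t' - t) * ((d₁ : ℝ) * (v 2 0 - v 1 0) - d₀ * (v 2 1 - v 1 1)) = 0 := by
        linear_combination e
      exact (mul_eq_zero.1 this).resolve_left (sub_ne_zero.2 htt.symm)
    intro i hi
    have := ht 0
    have := ht 1
    fin_cases i
    · exact absurd rfl hi
    · simp only [Fin.mk_one]
      rw [ht 0, ht 1]; linear_combination -t * e'
    · simp only [Fin.reduceFinMk]
      rw [ht 0, ht 1]; linear_combination (1 - t) * e'
  have hd01 : (d₁ : ℝ) ≠ 0 ∨ (-d₀ : ℝ) ≠ 0 := by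
    by_contra hcon
    push Not at hcon
    rw [hcon.1, neg_eq_zero.1 hcon.2] at huw'
    simp at huw'
  have hv0 : (d₁ : ℝ) * (v 0 0 - P 0) - d₀ * (v 0 1 - P 1) ≠ 0 := by
    intro h0
    refine hv.not_line (c₀ := -(d₁ * P 0) + d₀ * P 1) hd01 fun i => ?_
    rcases eq_or_ne i 0 with rfl | hi
    · linear_combination h0
    · linear_combination hlin i hi
  -- the second coordinate along the segment
  have hη : (1 ≤ (u : ℝ) * (v 1 0 - P 0) + w * (v 1 1 - P 1) ∧
      (u : ℝ) * (v 2 0 - P 0) + w * (v 2 1 - P 1) ≤ 0) ∨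
      (1 ≤ (u : ℝ) * (v 2 0 - P 0) + w * (v 2 1 - P 1) ∧
      (u : ℝ) * (v 1 0 - P 0) + w * (v 1 1 - P 1) ≤ 0) := by
    set η := (u : ℝ) * (v 2 0 - v 1 0) + w * (v 2 1 - v 1 1) with hηdef
    have e₁ : (u : ℝ) * (v 1 0 - P 0) + w * (v 1 1 - P 1) = -t * η := by
      rw [ht 0, ht 1, hηdef]; ring
    have e₂ : (u : ℝ) * (v 2 0 - P 0) + w * (v 2 1 - P 1) = (1 - t) * η := by
      rw [ht 0, ht 1, hηdef]; ring
    have e₃ : (t' - t) * η = g := by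
      have : (u : ℝ) * (P' 0 - P 0) + w * (P' 1 - P 1) = g := by
        rw [hd₀', hd₁']; linear_combination (g : ℝ) * huw'
      rw [ht 0, ht 1, ht' 0, ht' 1] at this
      rw [hηdef]; linear_combination this
    rw [e₁, e₂]
    rcases le_total 0 η with h0 | h0
    · right
      constructor <;> nlinarith
    · left
      constructor <;> nlinarith
  -- The sign puts the vertex `v 0` on the positive side of the segment.
  obtain ⟨s, hs, hs0⟩ : ∃ s : ℤ, s * s = 1 ∧
      0 < (s : ℝ) * (d₁ * (v 0 0 - P 0) - d₀ * (v 0 1 - P 1)) := by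
    rcases lt_or_gt_of_ne hv0 with h | h
    · exact ⟨-1, by norm_num, by push_cast; linarith⟩
    · exact ⟨1, by norm_num, by push_cast; linarith⟩
  obtain ⟨φ, hφM, hφc⟩ := LatPair.exists_of_isUnit !![s * d₁, -(s * d₀); u, w]
    ![-(s * (d₁ * P 0 - d₀ * P 1)), -(u * P 0 + w * P 1)] (by
      rw [Matrix.det_fin_two_of]
      have : s * d₁ * w - -(s * d₀) * u = s := by linear_combination s * huw
      rw [this]
      exact IsUnit.of_mul_eq_one s hs)
  have hφ0 : ∀ x, φ.map x 0 = s * (d₁ * (x 0 - P 0) - d₀ * (x 1 - P 1)) := fun x => by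
    rw [LatPair.map, latMap_apply, hφM, hφc]
    simp
    ring
  have hφ1 : ∀ x, φ.map x 1 = u * (x 0 - P 0) + w * (x 1 - P 1) := fun x => by
    rw [LatPair.map, latMap_apply, hφM, hφc]
    simp
    ring
  refine ⟨φ, ?_, ?_, ?_, ?_⟩
  · rw [hφ0, hlin 1 (by decide), mul_zero]
  · rw [hφ0, hlin 2 (by decide), mul_zero]
  · rw [hφ0]; exact hs0
  · simp only [hφ1]; exact hη

lemma mem_convexHull_triple {p q r : Fin 2 → ℝ} {a b c : ℝ} (ha : 0 ≤ a) (hb : 0 ≤ b) (hc : 0 ≤ c)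
    (h : a + b + c = 1) : a • p + b • q + c • r ∈ convexHull ℝ {p, q, r} := by
  have := (convex_convexHull ℝ ({p, q, r} : Set (Fin 2 → ℝ))).sum_mem (t := Finset.univ)
    (w := ![a, b, c]) (z := ![p, q, r]) ?_ ?_ ?_
  · simpa [Fin.sum_univ_three] using this
  · intro i _
    fin_cases i <;> simpa
  · simpa [Fin.sum_univ_three] using h
  · intro i _
    fin_cases i <;> exact subset_convexHull ℝ _ (by simp)

lemma range_fin_three (v : Fin 3 → Fin 2 → ℝ) : range v = {v 0, v 1, v 2} := by
  ext x
  simp only [mem_range, Fin.exists_fin_succ, mem_insert_iff, mem_singleton_iff]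
  simp [eq_comm]

lemma convex_aff_nonneg (c₀ c₁ c₂ : ℝ) : Convex ℝ {x : Fin 2 → ℝ | 0 ≤ c₀ + c₁ * x 0 + c₂ * x 1} := by
  intro x hx y hy a b ha hb hab
  simp only [mem_ofPred_eq] at hx hy ⊢
  have e : c₀ + c₁ * (a • x + b • y) 0 + c₂ * (a • x + b • y) 1 =
      a * (c₀ + c₁ * x 0 + c₂ * x 1) + b * (c₀ + c₁ * y 0 + c₂ * y 1) :=
    isAff_coord c₀ c₁ c₂ x y a b hab
  rw [e]
  exact add_nonneg (mul_nonneg ha hx) (mul_nonneg hb hy)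

lemma aff_nonneg_of_mem_convexHull {S : Set (Fin 2 → ℝ)} (c₀ c₁ c₂ : ℝ)
    (h : ∀ x ∈ S, 0 ≤ c₀ + c₁ * x 0 + c₂ * x 1) {x : Fin 2 → ℝ} (hx : x ∈ convexHull ℝ S) :
    0 ≤ c₀ + c₁ * x 0 + c₂ * x 1 :=
  convexHull_min (t := {x : Fin 2 → ℝ | 0 ≤ c₀ + c₁ * x 0 + c₂ * x 1}) h
    (convex_aff_nonneg c₀ c₁ c₂) hx

/-- The long side lies on `x₀ = 0`, and the other two sides are graphs over `[0, h]`. `exists_shear`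
shows that they cross `x₀ = 1` at consecutive integers and supplies the shear that gives them slopes
of opposite signs. -/
lemma exists_coords_of_position {T : Set (Fin 2 → ℝ)} {v₀ v₁ v₂ : Fin 2 → ℝ}
    (hfree : LatticeFree T) (hT : T = convexHull ℝ {v₀, v₁, v₂}) (hv₁ : v₁ 0 = 0) (hv₂ : v₂ 0 = 0)
    (hv₀ : 0 < v₀ 0) (ht₁ : 1 ≤ v₁ 1) (ht₂ : v₂ 1 ≤ 0) (hlat : v₀ ∉ latticePoints)
    (h01 : OneInside v₀ v₁) (h02 : OneInside v₀ v₂) :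
    ∃ (ψ : LatPair) (a β : ℝ), 0 < a ∧ 0 < β ∧ ∀ x ∈ T, 0 ≤ ψ.map x 0 ∧
      0 ≤ 1 - ψ.map x 1 - β * (ψ.map x 0 - 1) ∧ 0 ≤ ψ.map x 1 - a * (ψ.map x 0 - 1) := by
  set h := v₀ 0 with hh
  set t₁ := v₁ 1 with ht₁'
  set t₂ := v₂ 1 with ht₂'
  obtain ⟨A, hA⟩ : ∃ A, A = (v₀ 1 - t₁) / h := ⟨_, rfl⟩
  obtain ⟨B, hB⟩ : ∃ B, B = (v₀ 1 - t₂) / h := ⟨_, rfl⟩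
  have hAh : t₁ + A * h = v₀ 1 := by rw [hA]; field_simp; ring
  have hBh : t₂ + B * h = v₀ 1 := by rw [hB]; field_simp; ring
  have ht : 0 < t₁ - t₂ := by linarith
  have hopen : {x : Fin 2 → ℝ | 0 < x 0 ∧ t₂ + B * x 0 < x 1 ∧ x 1 < t₁ + A * x 0} ⊆
      interior T := by
    refine interior_maximal ?_ ?_
    · rintro x ⟨hx₀, hx₁, hx₂⟩
      rw [hT]
      have hsum : x 0 / h + (x 1 - t₂ - B * x 0) / (t₁ - t₂) + (t₁ + A * x 0 - x 1) / (t₁ - t₂) =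
          1 := by
        have : (A - B) * h = t₂ - t₁ := by linarith
        field_simp
        linear_combination x 0 * this
      convert mem_convexHull_triple (p := v₀) (q := v₁) (r := v₂)
        (div_nonneg hx₀.le hv₀.le) (div_nonneg (by linarith : 0 ≤ x 1 - t₂ - B * x 0) ht.le)
        (div_nonneg (by linarith : 0 ≤ t₁ + A * x 0 - x 1) ht.le) hsum using 1
      funext i
      fin_cases i
      · simp only [Fin.zero_eta, Pi.add_apply, Pi.smul_apply, smul_eq_mul, hv₁, hv₂, ← hh]
        field_simp
        ring
      · simp only [Fin.mk_one, Pi.add_apply, Pi.smul_apply, smul_eq_mul, ← ht₁', ← ht₂']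
        have e₁ : x 0 / h * v₀ 1 = x 0 / h * t₁ + A * x 0 := by
          rw [← hAh]; field_simp
        have e₂ : (x 1 - t₂ - B * x 0) / (t₁ - t₂) * t₁ + (t₁ + A * x 0 - x 1) / (t₁ - t₂) * t₂ =
            x 1 - t₂ - B * x 0 + t₂ * (1 - x 0 / h) := by
          have : (t₁ + A * x 0 - x 1) / (t₁ - t₂) =
              1 - x 0 / h - (x 1 - t₂ - B * x 0) / (t₁ - t₂) := by linarith
          rw [this]
          field_simp
          ring
        have e₃ : x 0 / h * t₁ + A * x 0 = x 0 / h * t₂ + B * x 0 := by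
          field_simp
          linarith
        linarith
    · have c₀ : Continuous fun x : Fin 2 → ℝ => t₂ + B * x 0 := by fun_prop
      have c₁ : Continuous fun x : Fin 2 → ℝ => t₁ + A * x 0 := by fun_prop
      exact (isOpen_lt continuous_const (continuous_apply 0)).inter
        ((isOpen_lt c₀ (continuous_apply 1)).inter (isOpen_lt (continuous_apply 1) c₁))
  have side : ∀ (w : Fin 2 → ℝ) (t C : ℝ), w 0 = 0 → w 1 = t → t + C * h = v₀ 1 → OneInside v₀ w →
      ∃ m b : ℤ, 0 < m ∧ (m : ℝ) < h ∧ t + C * m = b ∧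
        ∀ m' b' : ℤ, 0 < m' → (m' : ℝ) < h → t + C * m' = b' → m' = m := by
    rintro w t C hw0 hw1 hC ⟨_, ⟨hp, ⟨z, rfl⟩⟩, hu⟩
    obtain ⟨s, hs₀, hs₁, hs⟩ := mem_openSegment_coord.1 hp
    have e₀ : (z 0 : ℝ) = h - s * h := by rw [hs 0, hw0]; ring
    have e₁ : (z 1 : ℝ) = v₀ 1 + s * (t - v₀ 1) := by rw [hs 1, hw1]
    have hz0 : (0 : ℝ) < z 0 := by rw [e₀]; nlinarith
    refine ⟨z 0, z 1, by exact_mod_cast hz0, by rw [e₀]; nlinarith, ?_, ?_⟩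
    · rw [e₀, e₁, ← hC]; ring
    · intro m' b' hm' hmh' hb'
      have hmr : (0 : ℝ) < m' := by exact_mod_cast hm'
      have := hu (fun i => ((![m', b'] i : ℤ) : ℝ)) ⟨mem_openSegment_coord.2
        ⟨1 - m' / h, ?_, ?_, fun i => ?_⟩, _, rfl⟩
      · have := congrFun this 0
        simp at this
        exact this
      · have : m' / h < 1 := (div_lt_one hv₀).2 hmh'
        linarith
      · have : 0 < m' / h := by positivity
        linarith
      · fin_cases i
        · simp only [Fin.zero_eta, Matrix.cons_val_zero, hw0, ← hh]
          field_simp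
          ring
        · simp only [Fin.mk_one, Matrix.cons_val_one, Matrix.cons_val_fin_one, hw1, ← hb', ← hC]
          field_simp
          ring
  obtain ⟨b, n, hb₁, hb₂, ha, hβ⟩ := exists_shear (A := A) (B := B) hv₀ ht₁ ht₂ (by rw [hAh, hBh])
    (fun i j hi hj => hlat ⟨![i, j], funext fun l => by
      fin_cases l
      · simp only [Fin.zero_eta, Matrix.cons_val_zero]; exact hi
      · simp only [Fin.mk_one, Matrix.cons_val_one, Matrix.cons_val_fin_one, ← hj, hAh]⟩)
    (fun i j hi hj => by
      by_contra hcon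
      have hd := Set.disjoint_left.1 hfree
      refine hd (a := fun l => ((![i, j] l : ℤ) : ℝ)) (hopen ?_) ⟨_, rfl⟩
      refine ⟨?_, ?_, ?_⟩
      · simpa using hi
      · simpa using hj
      · simpa using hcon)
    (side v₁ t₁ A hv₁ rfl hAh h01) (side v₂ t₂ B hv₂ rfl hBh h02)
  -- A shear fixing the line `x₀ = 1`, followed by the translation taking `(1, b)` and `(1, b + 1)`
  -- to `(1, 0)` and `(1, 1)`.
  obtain ⟨ψ, hψM, hψc⟩ := LatPair.exists_of_isUnit !![1, 0; n, 1] ![0, -b - n] (by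
    rw [Matrix.det_fin_two_of]; simp)
  have hψ0 : ∀ x, ψ.map x 0 = x 0 := fun x => by
    rw [LatPair.map, latMap_apply, hψM, hψc]; simp
  have hψ1 : ∀ x, ψ.map x 1 = x 1 - b + n * (x 0 - 1) := fun x => by
    rw [LatPair.map, latMap_apply, hψM, hψc]; simp; ring
  refine ⟨ψ, b - t₂ + n, t₁ - (b + 1) - n, ha, hβ, fun x hx => ?_⟩
  rw [hψ0, hψ1]
  rw [hT] at hx
  have hA' : A = b + 1 - t₁ := by linarith
  have hB' : B = b - t₂ := by linarith
  refine ⟨?_, ?_, ?_⟩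
  · have := aff_nonneg_of_mem_convexHull 0 1 0 (by
      rintro y (rfl | rfl | rfl)
      · linarith
      · linarith
      · linarith) hx
    linarith
  · have := aff_nonneg_of_mem_convexHull t₁ A (-1) (by
      rintro y (rfl | rfl | rfl)
      · linarith
      · rw [hv₁]; linarith
      · rw [hv₂]; linarith) hx
    rw [hA'] at this
    linarith
  · have := aff_nonneg_of_mem_convexHull (-t₂) (-B) 1 (by
      rintro y (rfl | rfl | rfl)
      · linarith
      · rw [hv₁]; linarith
      · rw [hv₂]; linarith) hx
    rw [hB'] at this
    linarith

/-- A triangle of type `T²ᴬ` is contained, in suitable lattice coordinates, in a triangle whose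
sides are `x₀ = 0`, a line of slope `-β < 0` through `(1, 1)` and a line of slope `a > 0` through
`(1, 0)`. -/
lemma IsT2A.exists_coords {T : Set (Fin 2 → ℝ)} (h : IsT2A T) :
    ∃ (ψ : LatPair) (a β : ℝ), 0 < a ∧ 0 < β ∧ ∀ x ∈ T, 0 ≤ ψ.map x 0 ∧
      0 ≤ 1 - ψ.map x 1 - β * (ψ.map x 0 - 1) ∧ 0 ≤ ψ.map x 1 - a * (ψ.map x 0 - 1) := by
  obtain ⟨hfree, v, hv, hv0, h12, h01, h02⟩ := h
  obtain ⟨φ, e₁, e₂, e₀, hpos⟩ := exists_coords_of_segment hv.1 h12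
  have hT : φ.map '' T = convexHull ℝ {φ.map (v 0), φ.map (v 1), φ.map (v 2)} := by
    rw [hv.2, AffineMap.image_convexHull, range_fin_three, image_insert_eq, image_insert_eq,
      image_singleton]
  have hlat : φ.map (v 0) ∉ latticePoints := fun h => hv0 (φ.map_mem_iff.1 h)
  obtain ⟨ψ, a, β, ha, hβ, hψ⟩ : ∃ (ψ : LatPair) (a β : ℝ), 0 < a ∧ 0 < β ∧ ∀ x ∈ φ.map '' T,
      0 ≤ ψ.map x 0 ∧ 0 ≤ 1 - ψ.map x 1 - β * (ψ.map x 0 - 1) ∧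
        0 ≤ ψ.map x 1 - a * (ψ.map x 0 - 1) := by
    rcases hpos with ⟨h₁, h₂⟩ | ⟨h₁, h₂⟩
    · exact exists_coords_of_position (φ.latticeFree hfree) hT e₁ e₂ e₀ h₁ h₂ hlat
        (φ.oneInside h01) (φ.oneInside h02)
    · exact exists_coords_of_position (φ.latticeFree hfree) (by rw [hT, pair_comm]) e₂ e₁ e₀ h₁ h₂
        hlat (φ.oneInside h02) (φ.oneInside h01)
  refine ⟨φ.trans ψ, a, β, ha, hβ, fun x hx => ?_⟩
  rw [φ.trans_map ψ x]
  exact hψ _ (mem_image_of_mem _ hx)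

/-- Cuts whose induced set is contained in a triangle of type `T²ᴬ` have finite split rank. -/
theorem cutRank_lt_top_of_isT2A {k : ℕ} {f : Fin 2 → ℝ} {R : Fin k → Fin 2 → ℝ} {α : Fin k → ℝ}
    (hR : PointedCone.hull ℝ (range R) = ⊤) (hα : ∀ i, 0 < α i) {T : Set (Fin 2 → ℝ)}
    (hT : IsT2A T) (h : ∀ i, f + (α i)⁻¹ • R i ∈ T) : cutRank f R α < ⊤ := by
  obtain ⟨ψ, a, β, ha, hβ, hψ⟩ := hT.exists_coords
  exact cutRank_lt_top_of_coords hR hα ψ ha hβ fun i => hψ _ (h i)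

/-! ### Intersection cuts from convex sets -/

/-- A small move from `p` against the gradient stays in `S` and strictly lowers the value. -/
lemma aff_pos_of_mem_interior {S : Set (Fin 2 → ℝ)} {c₀ c₁ c₂ : ℝ} (hc : c₁ ≠ 0 ∨ c₂ ≠ 0)
    (h : ∀ x ∈ S, 0 ≤ c₀ + c₁ * x 0 + c₂ * x 1) {p : Fin 2 → ℝ} (hp : p ∈ interior S) :
    0 < c₀ + c₁ * p 0 + c₂ * p 1 := by
  have hcont : Filter.Tendsto (fun ε : ℝ => p - ε • (![c₁, c₂] : Fin 2 → ℝ)) (nhds 0) (nhds p) := by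
    have : Continuous fun ε : ℝ => p - ε • (![c₁, c₂] : Fin 2 → ℝ) := by fun_prop
    have h2 := this.tendsto 0
    rwa [zero_smul, sub_zero] at h2
  have hev := hcont.eventually (mem_interior_iff_mem_nhds.1 hp)
  obtain ⟨ε, hε, hmem⟩ := (hev.filter_mono nhdsWithin_le_nhds |>.and
    (self_mem_nhdsWithin (a := (0 : ℝ)) (s := Ioi 0))).exists.imp fun ε h => And.intro h.2 h.1
  have := h _ hmem
  simp only [Pi.sub_apply, Pi.smul_apply, smul_eq_mul, Matrix.cons_val_zero,
    Matrix.cons_val_one, Matrix.cons_val_fin_one] at this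
  have hpos : 0 < c₁ * c₁ + c₂ * c₂ := by
    rcases hc with hc | hc
    · nlinarith [mul_self_pos.2 hc, mul_self_nonneg c₂]
    · nlinarith [mul_self_pos.2 hc, mul_self_nonneg c₁]
  have hε' : (0 : ℝ) < ε := hε
  nlinarith [mul_pos hε' hpos]

lemma mem_frontier_of_aff {S : Set (Fin 2 → ℝ)} {c₀ c₁ c₂ : ℝ} (hc : c₁ ≠ 0 ∨ c₂ ≠ 0)
    (h : ∀ x ∈ S, 0 ≤ c₀ + c₁ * x 0 + c₂ * x 1) {p : Fin 2 → ℝ} (hp : p ∈ S)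
    (h0 : c₀ + c₁ * p 0 + c₂ * p 1 = 0) : p ∈ frontier S :=
  ⟨subset_closure hp, fun hi => (aff_pos_of_mem_interior hc h hi).ne' h0⟩

/-- The coefficient of an intersection cut is read off from the point where the ray leaves the
set. -/
lemma phi_eq_of_mem_frontier {k : ℕ} {f : Fin 2 → ℝ} {R : Fin k → Fin 2 → ℝ}
    {B : Set (Fin 2 → ℝ)} (hB : Convex ℝ B) (hf : f ∈ interior B) {i : Fin k} {t : ℝ} (ht : 0 < t)
    (hi : f + t⁻¹ • R i ∈ frontier B) : phi f R B i = t := by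
  -- Points of the ray strictly before a point of the closure are interior, so the ray meets the
  -- frontier only once.
  have key : ∀ {a b : ℝ}, 0 < a → a < b → f + b • R i ∈ closure B → f + a • R i ∈ interior B := by
    intro a b ha hab hb
    refine hB.openSegment_interior_closure_subset_interior hf hb
      ⟨1 - a / b, a / b, ?_, div_pos ha (ha.trans hab), by ring, ?_⟩
    · have : a / b < 1 := (div_lt_one (ha.trans hab)).2 hab
      linarith
    · have : b ≠ 0 := (ha.trans hab).ne'
      rw [smul_add, smul_smul, div_mul_cancel₀ _ this, ← add_assoc, ← add_smul]
      simp
  have hrec : R i ∉ recCone B := by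
    intro hr
    have h2 := hr f (interior_subset hf) (2 * t⁻¹) (by positivity)
    have ht' : (0 : ℝ) < t⁻¹ := inv_pos.2 ht
    exact hi.2 (key ht' (by linarith) (subset_closure h2))
  have hset : {s : ℝ | 0 < s ∧ f + s⁻¹ • R i ∈ frontier B} = {t} := by
    ext s
    constructor
    · rintro ⟨hs, hs'⟩
      rcases lt_trichotomy s t with h | h | h
      · exact absurd (key (inv_pos.2 ht) (inv_strictAnti₀ hs h) hs'.1) hi.2
      · exact h
      · exact absurd (key (inv_pos.2 hs) (inv_strictAnti₀ ht h) hi.1) hs'.2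
    · rintro rfl
      exact ⟨ht, hi⟩
  rw [phi, if_neg hrec, hset, csInf_singleton]

lemma inducedSet_of_pos {k : ℕ} {f : Fin 2 → ℝ} {R : Fin k → Fin 2 → ℝ} {α : Fin k → ℝ}
    (hα : ∀ i, 0 < α i) :
    inducedSet f R α = convexHull ℝ (range (fun i => f + (α i)⁻¹ • R i) ∪ {f}) := by
  have h₁ : {y | ∃ i, 0 < α i ∧ y = f + (α i)⁻¹ • R i} = range fun i => f + (α i)⁻¹ • R i := by
    ext y
    exact ⟨fun ⟨i, _, h⟩ => ⟨i, h.symm⟩, fun ⟨i, h⟩ => ⟨i, hα i, h.symm⟩⟩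
  have h₂ : {r | ∃ i, α i = 0 ∧ r = R i} = ∅ := by
    ext r
    simp only [mem_ofPred_eq, mem_empty_iff_false, iff_false, not_exists, not_and]
    exact fun i h => absurd h (hα i).ne'
  ext x
  rw [inducedSet, h₁, h₂]
  constructor
  · rintro ⟨y, hy, d, hd, rfl⟩
    have : d = 0 := by
      have := Submodule.span_empty (R := {c : ℝ // 0 ≤ c}) (M := Fin 2 → ℝ)
      rw [PointedCone.hull, this] at hd
      exact hd
    rwa [this, add_zero]
  · intro hx
    exact ⟨x, hx, 0, Submodule.zero_mem _, (add_zero x).symm⟩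

/-- The induced set of an intersection cut is the convex set if all vertices lie on rays. -/
lemma inducedSet_eq_of_rays {k : ℕ} {f : Fin 2 → ℝ} {R : Fin k → Fin 2 → ℝ} {α : Fin k → ℝ}
    (hα : ∀ i, 0 < α i) {S : Set (Fin 2 → ℝ)} (hf : f ∈ convexHull ℝ S)
    (h : ∀ i, f + (α i)⁻¹ • R i ∈ convexHull ℝ S)
    (hS : S ⊆ range (fun i => f + (α i)⁻¹ • R i) ∪ {f}) : inducedSet f R α = convexHull ℝ S := by
  rw [inducedSet_of_pos hα]
  refine Subset.antisymm (convexHull_min ?_ (convex_convexHull ℝ S)) (convexHull_mono hS)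
  rintro x (⟨i, rfl⟩ | rfl)
  · exact h i
  · exact hf

/-! ### Triangles of type `T²ᴮ` with a horizontal long side -/

lemma affineIndependent_of_orient {v : Fin 3 → Fin 2 → ℝ} (h : orient (v 0) (v 1) (v 2) ≠ 0) :
    AffineIndependent ℝ v := by
  rw [affineIndependent_iff_not_collinear]
  intro hcol
  obtain ⟨w, hw⟩ := (collinear_iff_of_mem (mem_range_self 0)).1 hcol
  obtain ⟨r, hr⟩ := hw _ (mem_range_self 1)
  obtain ⟨s, hs⟩ := hw _ (mem_range_self 2)
  apply h
  rw [orient, hr, hs]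
  simp only [vadd_eq_add, Pi.add_apply, Pi.smul_apply, smul_eq_mul]
  ring

/-- The lattice points inside a segment from height `0` to a height between `1` and `2`. -/
lemma mem_openSegment_lattice {P₁ P₂ Z : ℝ} (h₁ : 1 < P₂) (h₂ : P₂ < 2) {p : Fin 2 → ℝ}
    (hp : p ∈ openSegment ℝ ![P₁, P₂] ![Z, 0] ∩ latticePoints) :
    p 1 = 1 ∧ p 0 = Z + (P₁ - Z) / P₂ := by
  obtain ⟨hp, z, rfl⟩ := hp
  obtain ⟨t, ht₀, ht₁, ht⟩ := mem_openSegment_coord.1 hp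
  have e₀ := ht 0
  have e₁ := ht 1
  simp only [Matrix.cons_val_zero, Matrix.cons_val_one, Matrix.cons_val_fin_one] at e₀ e₁
  have a₁ : (0 : ℝ) < z 1 := by rw [e₁]; nlinarith
  have a₂ : (z 1 : ℝ) < 2 := by rw [e₁]; nlinarith
  have a₁' : 0 < z 1 := by exact_mod_cast a₁
  have a₂' : z 1 < 2 := by exact_mod_cast a₂
  have hz : z 1 = 1 := by omega
  have hz' : (z 1 : ℝ) = 1 := by exact_mod_cast hz
  refine ⟨hz', ?_⟩
  simp only
  rw [e₀]
  have : (1 - t) = 1 / P₂ := by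
    rw [eq_div_iff (by linarith)]; linarith
  have ht' : t = 1 - 1 / P₂ := by linarith
  rw [ht']
  ring

lemma oneInside_of_height {P₁ P₂ Z : ℝ} (h₁ : 1 < P₂) (h₂ : P₂ < 2) {c : ℤ}
    (hc : Z + (P₁ - Z) / P₂ = c) : OneInside ![P₁, P₂] ![Z, 0] := by
  refine ⟨![(c : ℝ), 1], ⟨mem_openSegment_coord.2 ⟨1 - 1 / P₂, ?_, ?_, ?_⟩, ![c, 1], ?_⟩, ?_⟩
  · have : 1 / P₂ < 1 := (div_lt_one (by linarith)).2 h₁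
    linarith
  · have : 0 < 1 / P₂ := by positivity
    linarith
  · intro i
    fin_cases i
    · simp only [Fin.zero_eta, Matrix.cons_val_zero, ← hc]
      ring
    · simp only [Fin.mk_one, Matrix.cons_val_one, Matrix.cons_val_fin_one]
      field_simp
      ring
  · funext i
    fin_cases i <;> simp
  · intro p hp
    obtain ⟨e₁, e₀⟩ := mem_openSegment_lattice h₁ h₂ hp
    funext i
    fin_cases i
    · simpa [hc] using e₀
    · simpa using e₁

/-- A triangle with an integral vertex `(0, 0)`, a vertex `(X, 0)` with `X > 2` and the third vertex
`(P₁, P₂)` on the line through `(X, 0)` and `(1, 1)`. -/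
lemma isT2B_of_coords {X P₁ P₂ : ℝ} (hX : 2 < X) (hP : P₁ = X - (X - 1) * P₂) (h₀ : 0 < P₁)
    (h₁ : P₁ < 1) : IsT2B (convexHull ℝ {![P₁, P₂], ![X, 0], ![0, 0]}) := by
  have hP₁ : 1 < P₂ := by
    by_contra hcon
    nlinarith
  have hP₂ : P₂ < 2 := by
    by_contra hcon
    nlinarith
  have hP₀ : P₂ ≠ 0 := by linarith
  -- The line through `(P₁, P₂)` and `(0, 1)` meets `x₁ = 0` at `(-Y, 0)`. Replacing `(0, 0)` by
  -- this point gives the `T²ᴬ` triangle.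
  set Y := P₁ / (P₂ - 1) with hY
  have hP21 : 0 < P₂ - 1 := by linarith
  have hY₀ : 0 < Y := div_pos h₀ hP21
  have hYP : Y * (P₂ - 1) = P₁ := div_mul_cancel₀ _ hP21.ne'
  have hnl : (![P₁, P₂] : Fin 2 → ℝ) ∉ latticePoints := by
    rintro ⟨z, hz⟩
    have e := congrFun hz 0
    simp only [Matrix.cons_val_zero] at e
    rw [e] at h₀ h₁
    have : 0 < z 0 := by exact_mod_cast h₀
    have : z 0 < 1 := by exact_mod_cast h₁
    omega
  have hTfree : LatticeFree (convexHull ℝ {![P₁, P₂], ![X, 0], ![-Y, 0]}) := by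
    refine Set.disjoint_left.2 ?_
    rintro _ hx ⟨z, rfl⟩
    have f₁ := aff_pos_of_mem_interior (c₀ := 0) (c₁ := 0) (c₂ := 1) (Or.inr one_ne_zero)
      (fun x hx => aff_nonneg_of_mem_convexHull 0 0 1 (by
        rintro y (rfl | rfl | rfl) <;> simp <;> linarith) hx) hx
    have f₂ := aff_pos_of_mem_interior (c₀ := P₂) (c₁ := 0) (c₂ := -1)
      (Or.inr (by norm_num))
      (fun x hx => aff_nonneg_of_mem_convexHull P₂ 0 (-1) (by
        rintro y (rfl | rfl | rfl) <;> simp <;> linarith) hx) hx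
    have f₃ := aff_pos_of_mem_interior (c₀ := X) (c₁ := -1) (c₂ := -(X - 1))
      (Or.inl (by norm_num))
      (fun x hx => aff_nonneg_of_mem_convexHull X (-1) (-(X - 1)) (by
        rintro y (rfl | rfl | rfl)
        · simp; linarith
        · simp
        · simp; linarith) hx) hx
    have f₄ := aff_pos_of_mem_interior (c₀ := P₁) (c₁ := P₂ - 1) (c₂ := -P₁)
      (Or.inl hP21.ne')
      (fun x hx => aff_nonneg_of_mem_convexHull P₁ (P₂ - 1) (-P₁) (by
        rintro y (rfl | rfl | rfl)
        · simp; linarith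
        · simp; nlinarith
        · simp; linarith) hx) hx
    -- An interior lattice point has height `1`, where the triangle reaches exactly from `(0, 1)` to
    -- `(1, 1)`.
    have a₁ : (0 : ℝ) < z 1 := by linarith
    have a₂ : (z 1 : ℝ) < 2 := by linarith
    have a₁' : 0 < z 1 := by exact_mod_cast a₁
    have a₂' : z 1 < 2 := by exact_mod_cast a₂
    have hz : z 1 = 1 := by omega
    have hz' : (z 1 : ℝ) = 1 := by exact_mod_cast hz
    rw [hz'] at f₃ f₄
    have b₁ : (z 0 : ℝ) < 1 := by linarith
    have b₂ : (0 : ℝ) < z 0 := by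
      by_contra hcon
      nlinarith
    have b₁' : z 0 < 1 := by exact_mod_cast b₁
    have b₂' : 0 < z 0 := by exact_mod_cast b₂
    omega
  have hsub : convexHull ℝ {![P₁, P₂], ![X, 0], ![0, 0]} ⊆
      convexHull ℝ {![P₁, P₂], ![X, 0], ![-Y, 0]} := by
    refine convexHull_min ?_ (convex_convexHull ℝ _)
    rintro x (rfl | rfl | rfl)
    · exact subset_convexHull ℝ _ (by simp)
    · exact subset_convexHull ℝ _ (by simp)
    · have := mem_convexHull_triple (p := ![P₁, P₂]) (q := ![X, 0]) (r := ![-Y, 0]) le_rfl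
        (by positivity : 0 ≤ Y / (X + Y)) (by positivity : 0 ≤ X / (X + Y))
        (by field_simp; ring)
      convert this using 1
      funext i
      fin_cases i
      · simp
        field_simp
        ring
      · simp
  have hseg : ∀ Z ≤ (0 : ℝ), (segment ℝ ![X, 0] ![Z, 0] ∩ latticePoints).Nontrivial := by
    intro Z hZ
    have hXZ : 0 < X - Z := by linarith
    have hmem : ∀ c : ℤ, 0 ≤ c → c ≤ 2 → (![(c : ℝ), 0] : Fin 2 → ℝ) ∈
        segment ℝ ![X, 0] ![Z, 0] ∩ latticePoints := by
      intro c hc hc'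
      have hcr : (0 : ℝ) ≤ c := by exact_mod_cast hc
      have hcr' : (c : ℝ) ≤ 2 := by exact_mod_cast hc'
      refine ⟨⟨(c - Z) / (X - Z), (X - c) / (X - Z), div_nonneg (by linarith) hXZ.le,
        div_nonneg (by linarith) hXZ.le, by field_simp; ring, ?_⟩, ![c, 0], ?_⟩
      · funext i
        fin_cases i
        · simp
          field_simp
          ring
        · simp
      · funext i
        fin_cases i <;> simp
    refine ⟨_, hmem 0 le_rfl (by norm_num), _, hmem 1 (by norm_num) (by norm_num), fun h => ?_⟩
    have := congrFun h 0
    simp at this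
  have hone : OneInside ![P₁, P₂] ![X, 0] := oneInside_of_height hP₁ hP₂ (c := 1) (by
    rw [hP]; field_simp; push_cast; ring)
  refine ⟨hTfree.mono_left (interior_mono hsub), ⟨![![P₁, P₂], ![X, 0], ![0, 0]], ⟨?_, ?_⟩, hnl,
    hseg 0 le_rfl, hone, ?_⟩, convexHull ℝ {![P₁, P₂], ![X, 0], ![-Y, 0]}, ⟨hTfree,
    ![![P₁, P₂], ![X, 0], ![-Y, 0]], ⟨?_, ?_⟩, hnl, hseg (-Y) (by linarith), hone, ?_⟩, hsub⟩
  · refine affineIndependent_of_orient ?_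
    simp [orient]
    intro h
    nlinarith
  · rw [range_fin_three]; rfl
  · refine Set.eq_empty_of_forall_notMem fun p hp => ?_
    obtain ⟨-, e₀⟩ := mem_openSegment_lattice hP₁ hP₂ hp
    obtain ⟨-, z, rfl⟩ := hp
    rw [zero_add, sub_zero] at e₀
    have b₁ : (z 0 : ℝ) < 1 := by
      simp only at e₀
      rw [e₀, div_lt_one (by linarith)]
      linarith
    have b₂ : (0 : ℝ) < z 0 := by
      simp only at e₀
      rw [e₀]; positivity
    have b₁' : z 0 < 1 := by exact_mod_cast b₁
    have b₂' : 0 < z 0 := by exact_mod_cast b₂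
    omega
  · refine affineIndependent_of_orient ?_
    simp [orient]
    intro h
    nlinarith
  · rw [range_fin_three]; rfl
  · refine oneInside_of_height hP₁ hP₂ (c := 0) ?_
    rw [← hYP]; field_simp; push_cast; ring

/-! ### The auxiliary triangles of the standard position -/

lemma mem_convexHull_of_coords {X P₁ P₂ : ℝ} (hX : 0 < X) (hP₂ : 0 < P₂)
    (hP : P₁ = X - (X - 1) * P₂) {x : Fin 2 → ℝ} (h₁ : 0 ≤ x 1)
    (h₂ : 0 ≤ X - x 0 - (X - 1) * x 1) (h₃ : 0 ≤ P₂ * x 0 - P₁ * x 1) :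
    x ∈ convexHull ℝ {![P₁, P₂], ![X, 0], ![0, 0]} := by
  have := mem_convexHull_triple (p := ![P₁, P₂]) (q := ![X, 0]) (r := ![0, 0])
    (div_nonneg h₁ hP₂.le) (div_nonneg h₃ (mul_pos hP₂ hX).le) (div_nonneg h₂ hX.le)
    (by rw [hP]; field_simp; ring)
  convert this using 1
  funext i
  fin_cases i
  · simp
    field_simp
    ring
  · simp
    field_simp

/-- The triangle cut out by the line `x₁ = 0`, the line through `(1, 1)` and the point where the ray
through `(1 + δ, 1 - δ)` meets `x₁ = 0`, and the line through the origin and the point where that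
line meets the ray through `(0, 2)`. -/
lemma exists_auxiliary_triangle {f : Fin 2 → ℝ} {δ : ℝ} (hδ₀ : 0 < δ) (hδ₁ : δ < 1)
    (hf₀ : 0 < f 0) (hf₁ : 1 - δ < f 1) (hf₂ : f 0 + f 1 < 2) :
    ∃ (r s : ℝ) (p x : Fin 2 → ℝ) (U : Set (Fin 2 → ℝ)), 0 < r ∧ r < 1 ∧ 1 < s ∧
      p = f + r • (![0, 2] - f) ∧ x = f + s • (![1 + δ, 1 - δ] - f) ∧ x 1 = 0 ∧
      p ∈ affineSpan ℝ {x, ![1, 1]} ∧ U = convexHull ℝ {p, x, ![0, 0]} ∧ IsT2B U ∧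
      f ∈ interior U ∧ p ∈ frontier U ∧ x ∈ frontier U ∧
      (∀ c : ℝ, 0 ≤ c → c ≤ 2 → ![c, 0] ∈ frontier U) ∧
      1 - s⁻¹ = δ * (r⁻¹ - 1) ∧ f 0 * (1 - r) < 1 := by
  have hd : 0 < f 1 - (1 - δ) := by linarith
  obtain ⟨s, hs⟩ : ∃ s, s = f 1 / (f 1 - (1 - δ)) := ⟨_, rfl⟩
  have hs₁ : 1 < s := by rw [hs, one_lt_div hd]; linarith
  have hsx : f 1 + s * (1 - δ - f 1) = 0 := by
    rw [hs]; field_simp; ring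
  obtain ⟨X, hX⟩ : ∃ X, X = f 0 + s * (1 + δ - f 0) := ⟨_, rfl⟩
  have hX₂ : 2 < X := by nlinarith
  -- The function `X - x₀ - (X - 1) x₁` vanishes on the line through `(X, 0)` and `(1, 1)`. It
  -- equals `g` at `f`, `δ (X - 2)` at `(1 + δ, 1 - δ)` and `-(X - 2)` at `(0, 2)`; interpolation
  -- along the two rays gives `hgs` and the value of `r` below.
  obtain ⟨g, hg⟩ : ∃ g, g = X - f 0 - (X - 1) * f 1 := ⟨_, rfl⟩
  have hgs : (s - 1) * g = s * (δ * (X - 2)) := by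
    linear_combination (s - 1) * hg + (X - 1) * hsx - hX
  have hg₀ : 0 < g := by
    have : 0 < s * (δ * (X - 2)) := by
      have : 0 < X - 2 := by linarith
      positivity
    rw [← hgs] at this
    exact (pos_iff_pos_of_mul_pos this).1 (by linarith)
  obtain ⟨r, hr⟩ : ∃ r, r = g / (g + (X - 2)) := ⟨_, rfl⟩
  have hden : 0 < g + (X - 2) := by linarith
  have hr₀ : 0 < r := by rw [hr]; exact div_pos hg₀ hden
  have hr₁ : r < 1 := by rw [hr, div_lt_one hden]; linarith
  have hrg : r * (g + (X - 2)) = g := by rw [hr, div_mul_cancel₀ _ hden.ne']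
  obtain ⟨P₁, hP₁⟩ : ∃ P₁, P₁ = f 0 * (1 - r) := ⟨_, rfl⟩
  obtain ⟨P₂, hP₂⟩ : ∃ P₂, P₂ = f 1 + r * (2 - f 1) := ⟨_, rfl⟩
  have hP : P₁ = X - (X - 1) * P₂ := by
    linear_combination hP₁ + (X - 1) * hP₂ + (1 - r) * hg + hrg
  have hP₁0 : 0 < P₁ := by rw [hP₁]; exact mul_pos hf₀ (by linarith)
  have hsum : P₁ + P₂ < 2 := by rw [hP₁, hP₂]; nlinarith
  have hP₁1 : P₁ < 1 := by
    by_contra hcon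
    nlinarith
  have hP₂0 : 0 < P₂ := by nlinarith
  have hmem := @mem_convexHull_of_coords X P₁ P₂ (by linarith) hP₂0 hP
  have hpeq : (![P₁, P₂] : Fin 2 → ℝ) = f + r • (![0, 2] - f) := by
    funext i
    fin_cases i
    · simp [hP₁, Matrix.vecHead]; ring
    · simp [hP₂, Matrix.vecHead, Matrix.vecTail]
  have hxeq : (![X, 0] : Fin 2 → ℝ) = f + s • (![1 + δ, 1 - δ] - f) := by
    funext i
    fin_cases i
    · simp [hX, Matrix.vecHead]
    · simpa [Matrix.vecHead, Matrix.vecTail] using hsx.symm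
  have hlow : ∀ c : ℝ, 0 ≤ c → c ≤ X →
      ![c, 0] ∈ frontier (convexHull ℝ {![P₁, P₂], ![X, 0], ![0, 0]}) := by
    intro c hc hc'
    refine mem_frontier_of_aff (c₀ := 0) (c₁ := 0) (c₂ := 1) (Or.inr one_ne_zero)
      (fun x hx => aff_nonneg_of_mem_convexHull 0 0 1 (by
        rintro y (rfl | rfl | rfl) <;> simp; linarith) hx) (hmem ?_ ?_ ?_) ?_
    · simp
    · simp; linarith
    · simp; positivity
    · simp
  refine ⟨r, s, ![P₁, P₂], ![X, 0], _, hr₀, hr₁, hs₁, hpeq, hxeq, rfl, ?_, rfl,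
    isT2B_of_coords hX₂ hP hP₁0 hP₁1, ?_, ?_, hlow X (by linarith) le_rfl,
    fun c h h' => hlow c h (by linarith), ?_, by rw [← hP₁]; exact hP₁1⟩
  · have : (![P₁, P₂] : Fin 2 → ℝ) = AffineMap.lineMap ![X, 0] ![1, 1] P₂ := by
      funext i
      fin_cases i
      · simp [AffineMap.lineMap_apply, hP]; ring
      · simp [AffineMap.lineMap_apply]
    rw [this]
    exact AffineMap.lineMap_mem_affineSpan_pair _ _ _
  · have hopen : IsOpen {x : Fin 2 → ℝ | 0 < x 1 ∧ 0 < X - x 0 - (X - 1) * x 1 ∧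
        0 < P₂ * x 0 - P₁ * x 1} := by
      simp only [Set.ofPred_and]
      refine IsOpen.inter ?_ (IsOpen.inter ?_ ?_) <;> exact isOpen_lt (by fun_prop) (by fun_prop)
    refine interior_maximal (fun x hx => hmem hx.1.le hx.2.1.le hx.2.2.le) hopen ⟨?_, ?_, ?_⟩
    · linarith
    · rw [← hg]; exact hg₀
    · have : P₂ * f 0 - P₁ * f 1 = 2 * r * f 0 := by rw [hP₁, hP₂]; ring
      rw [this]; positivity
  · refine mem_frontier_of_aff (c₀ := X) (c₁ := -1) (c₂ := -(X - 1)) (Or.inl (by norm_num))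
      (fun x hx => aff_nonneg_of_mem_convexHull X (-1) (-(X - 1)) (by
        rintro y (rfl | rfl | rfl)
        · simp; linarith
        · simp
        · simp; linarith) hx) (subset_convexHull ℝ _ (by simp)) ?_
    simp; linarith
  · have e : r⁻¹ - 1 = (X - 2) / g := by
      rw [hr, inv_div]; field_simp; ring
    rw [e]
    have : s ≠ 0 := by linarith
    field_simp
    linarith

/-- The intersection cut of a triangle of type `T²ᴮ` whose vertices lie on rays. -/
lemma phi_of_isT2B {k : ℕ} {f : Fin 2 → ℝ} {R : Fin k → Fin 2 → ℝ} {β : Fin k → ℝ}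
    (hR : PointedCone.hull ℝ (range R) = ⊤) (hβ : ∀ i, 0 < β i) {S U : Set (Fin 2 → ℝ)}
    (hS : S.Finite) (hU : U = convexHull ℝ S) (hT : IsT2B U) (hf : f ∈ interior U)
    (hfr : ∀ i, f + (β i)⁻¹ • R i ∈ frontier U)
    (hSR : ∀ x ∈ S, ∃ i, f + (β i)⁻¹ • R i = x) :
    phi f R U = β ∧ inducedSet f R β = U ∧ cutRank f R β < ⊤ := by
  have hmem : ∀ i, f + (β i)⁻¹ • R i ∈ U := fun i => by
    have hcl : IsClosed U := by rw [hU]; exact hS.isClosed_convexHull ℝ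
    exact hcl.frontier_subset (hfr i)
  refine ⟨funext fun i => phi_eq_of_mem_frontier (hU ▸ convex_convexHull ℝ S) hf (hβ i) (hfr i),
    ?_, ?_⟩
  · rw [hU] at hmem hf ⊢
    exact inducedSet_eq_of_rays hβ (interior_subset hf) hmem fun x hx => Or.inl (hSR x hx)
  · obtain ⟨-, -, T, hT, hUT⟩ := hT
    exact cutRank_lt_top_of_isT2A hR hβ hT fun i => hUT (hmem i)

/-- The involution `(x₀, x₁) ↦ (x₀, 2 - x₀ - x₁)`, which exchanges the two auxiliary triangles. -/
def flipPair : LatPair where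
  M := !![1, 0; -1, -1]
  c := ![0, 2]
  N := !![1, 0; -1, -1]
  d := ![0, 2]
  left_inv x := by
    funext i
    simp only [latMap_apply]
    fin_cases i <;> (simp; try ring)
  right_inv x := by
    funext i
    simp only [latMap_apply]
    fin_cases i <;> (simp; try ring)

lemma flipPair_map (x : Fin 2 → ℝ) : flipPair.map x = ![x 0, 2 - x 0 - x 1] := by
  funext i
  rw [LatPair.map, latMap_apply]
  fin_cases i
  · simp [flipPair]
  · simp [flipPair]; ring

/-! ### The rank bound in standard position -/

/-- The split `x₀ ≤ 0 ∨ x₀ ≥ 1` derives the quadrilateral cut from two cuts whose coefficients differ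
from it on the first two and on the last two rays respectively. -/
lemma cutValidOn_splitSet_of_standard {f : Fin 2 → ℝ} {R : Fin 4 → Fin 2 → ℝ} {α : Fin 4 → ℝ}
    (hα : ∀ i, 0 < α i) {δ γ r s r' s' : ℝ}
    (h0 : f + (α 0)⁻¹ • R 0 = ![0, 2]) (h1 : f + (α 1)⁻¹ • R 1 = ![1 + δ, 1 - δ])
    (h2 : f + (α 2)⁻¹ • R 2 = ![γ, 0]) (h3 : f + (α 3)⁻¹ • R 3 = ![0, 0])
    (hδ : 0 < δ) (hγ : 0 < γ) (hf : 0 < f 0) (hr : 0 < r) (hr₁ : r < 1) (hr' : 0 < r')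
    (hr₁' : r' < 1) (hs : 1 - s⁻¹ = δ * (r⁻¹ - 1)) (hs' : 1 - s'⁻¹ = (γ - 1) * (r'⁻¹ - 1))
    (hfr : f 0 * (1 - r) < 1) :
    CutValidOn (splitSet {z | z ∈ relaxP f R ∧
      1 ≤ ∑ i, ![α 0 / r, α 1 / s, α 2, α 3] i * z.2 i ∧
      1 ≤ ∑ i, ![α 0, α 1, α 2 / s', α 3 / r'] i * z.2 i} ![1, 0] 0) α := by
  have hconv : Convex ℝ {z : (Fin 2 → ℝ) × (Fin 4 → ℝ) | 1 ≤ ∑ i, α i * z.2 i} := by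
    intro x hx y hy a b ha hb hab
    simp only [mem_ofPred_eq, Prod.snd_add, Prod.smul_snd, Pi.add_apply, Pi.smul_apply, smul_eq_mul,
      Fin.sum_univ_four] at hx hy ⊢
    nlinarith [mul_le_mul_of_nonneg_left hx ha, mul_le_mul_of_nonneg_left hy hb]
  have hq : ∀ i, 0 ≤ (0 : ℝ) + 1 * (f + (α i)⁻¹ • R i) 0 + 0 * (f + (α i)⁻¹ • R i) 1 := by
    intro i
    match i with
    | 0 => rw [h0]; simp
    | 1 => rw [h1]; simp; linarith
    | 2 => rw [h2]; simp; linarith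
    | 3 => rw [h3]; simp
  have hcol : ∀ i j, R i j = α i * ((f + (α i)⁻¹ • R i) j - f j) := by
    intro i j
    have := (hα i).ne'
    simp only [Pi.add_apply, Pi.smul_apply, smul_eq_mul]
    field_simp
    ring
  rw [cutValidOn_iff]
  refine fun z hz => convexHull_min (union_subset ?_ ?_) hconv hz
  -- Here `f 0 * (1 - ∑ αᵢ sᵢ) ≤ x₀ ≤ 0` with `f 0 > 0`.
  · rintro z ⟨⟨hz, -, -⟩, hx⟩
    have hx' : z.1 0 ≤ 0 := by simpa [Fin.sum_univ_two] using hx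
    have := sub_mul_sum_le hα hq hz
    simp only [mem_ofPred_eq]
    by_contra hcon
    push Not at hcon
    nlinarith
  · rintro z ⟨⟨hz, hU, hV⟩, hx⟩
    have hx' : 1 ≤ z.1 0 := by simpa [Fin.sum_univ_two] using hx
    rw [relaxP_coord hz, Fin.sum_univ_four, hcol 0, hcol 1, hcol 2, hcol 3, h0, h1, h2, h3] at hx'
    simp only [Matrix.cons_val_zero] at hx'
    simp only [Fin.sum_univ_four, Matrix.cons_val_zero, Matrix.cons_val_one, Matrix.cons_val,
      div_eq_mul_inv] at hU hV
    simp only [mem_ofPred_eq, Fin.sum_univ_four]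
    by_contra hcon
    push Not at hcon
    obtain ⟨k, hk⟩ : ∃ k, k = r⁻¹ - 1 := ⟨_, rfl⟩
    obtain ⟨k', hk'⟩ : ∃ k', k' = r'⁻¹ - 1 := ⟨_, rfl⟩
    have hk₀ : 0 < k := by
      have := one_lt_inv_iff₀.2 ⟨hr, hr₁⟩
      linarith
    have hk₀' : 0 < k' := by
      have := one_lt_inv_iff₀.2 ⟨hr', hr₁'⟩
      linarith
    have er : r⁻¹ = k + 1 := by linarith
    have er' : r'⁻¹ = k' + 1 := by linarith
    have es : s⁻¹ = 1 - δ * k := by rw [hk]; linarith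
    have es' : s'⁻¹ = 1 - (γ - 1) * k' := by rw [hk']; linarith
    -- A rewriting of `hfr`, which says that `p¹` has first coordinate below `1`.
    have hkf : k * (f 0 - 1) < 1 := by
      have h1 : r * (k + 1) = 1 := by rw [← er, mul_inv_cancel₀ hr.ne']
      by_contra hcon'
      push Not at hcon'
      nlinarith [mul_le_mul_of_nonneg_left hcon' hr.le]
    rw [er, es] at hU
    rw [er', es'] at hV
    generalize z.2 0 = z₀ at *
    generalize z.2 1 = z₁ at *
    generalize z.2 2 = z₂ at *
    generalize z.2 3 = z₃ at *
    obtain ⟨a, ha⟩ : ∃ a, a = α 0 * z₀ := ⟨_, rfl⟩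
    obtain ⟨b, hb⟩ : ∃ b, b = α 1 * z₁ := ⟨_, rfl⟩
    obtain ⟨c, hc⟩ : ∃ c, c = α 2 * z₂ := ⟨_, rfl⟩
    obtain ⟨d, hd⟩ : ∃ d, d = α 3 * z₃ := ⟨_, rfl⟩
    rw [← ha, ← hb, ← hc, ← hd] at hcon
    -- Let `D = 1 - (a + b + c + d) > 0`. The cuts give `D ≤ k (a - δ b)` and `0 < d - (γ - 1) c`,
    -- and `x₀ ≥ 1` reads `(a - δ b) + (d - (γ - 1) c) ≤ D (f 0 - 1)`. Multiplying the last by `k`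
    -- gives `D < D k (f 0 - 1)`, contrary to `hkf`.
    have eU : 1 - (a + b + c + d) ≤ k * (a - δ * b) := by
      rw [ha, hb, hc, hd]; linarith
    have eV : 0 < k' * (d - (γ - 1) * c) := by
      have : 1 - (a + b + c + d) ≤ k' * (d - (γ - 1) * c) := by
        rw [ha, hb, hc, hd]; linarith
      linarith
    have eV' : 0 < d - (γ - 1) * c := (pos_iff_pos_of_mul_pos eV).1 hk₀'
    have eX : 0 ≤ (1 - (a + b + c + d)) * (f 0 - 1) - (a - δ * b) - (d - (γ - 1) * c) := by
      rw [ha, hb, hc, hd]; linarith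
    have e₁ := mul_nonneg hk₀.le eX
    have e₂ : 0 < (1 - (a + b + c + d)) * (1 - k * (f 0 - 1)) :=
      mul_pos (by linarith) (by linarith)
    nlinarith [mul_pos hk₀ eV']

/-- The involution `flipPair` exchanges the first ray with the fourth and the second with the third,
with `γ - 1` in the role of `δ`. So `V` is the image of a triangle built like `U`. -/
theorem rank_bound_of_isStandardQ1 {f : Fin 2 → ℝ} {R : Fin 4 → Fin 2 → ℝ} {α : Fin 4 → ℝ}
    (h : IsStandardQ1 f R α) :
    ∃ U V : Set (Fin 2 → ℝ),
      IsTriangleU f R U ∧ IsTriangleV f R V ∧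
      IsT2B U ∧ IsT2B V ∧ f ∈ interior U ∧ f ∈ interior V ∧
      inducedSet f R (phi f R U) = U ∧ inducedSet f R (phi f R V) = V ∧
      cutRank f R (phi f R U) < ⊤ ∧ cutRank f R (phi f R V) < ⊤ ∧
      CutValidOn
        (splitSet
          {z | z ∈ relaxP f R ∧ 1 ≤ ∑ i, phi f R U i * z.2 i ∧ 1 ≤ ∑ i, phi f R V i * z.2 i}
          ![1, 0] 0) α ∧
      cutRank f R α ≤ max (cutRank f R (phi f R U)) (cutRank f R (phi f R V)) + 1 := by
  obtain ⟨hdata, hα, ⟨δ, γ, hδ₀, hδ₁, hγ₁, hγ₂, h0, h1, h2, h3⟩, hsec, hthird⟩ := h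
  have hR := hdata.cone_eq_top
  have hpos : ∀ {c₀ c₁ c₂ : ℝ}, (c₁ ≠ 0 ∨ c₂ ≠ 0) → 0 ≤ c₀ + c₂ * 2 →
      0 ≤ c₀ + c₁ * (1 + δ) + c₂ * (1 - δ) → 0 ≤ c₀ + c₁ * γ → 0 ≤ c₀ →
      0 < c₀ + c₁ * f 0 + c₂ * f 1 := by
    intro c₀ c₁ c₂ hc e0 e1 e2 e3
    refine pos_of_hull_eq_top hR hα hc fun i => ?_
    match i with
    | 0 => rw [h0]; simpa using e0
    | 1 => rw [h1]; simpa using e1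
    | 2 => rw [h2]; simpa using e2
    | 3 => rw [h3]; simpa using e3
  have hf₀ : 0 < f 0 := by
    have := @hpos 0 1 0 (Or.inl one_ne_zero) (by simp) (by linarith) (by linarith) le_rfl
    linarith
  have hf₁ : 0 < f 1 := by
    have := @hpos 0 0 1 (Or.inr one_ne_zero) (by norm_num) (by linarith) (by simp) le_rfl
    linarith
  have hf₂ : f 0 + f 1 < 2 := by
    have := @hpos 2 (-1) (-1) (Or.inl (by norm_num)) (by norm_num) (by linarith) (by linarith)
      (by norm_num)
    linarith
  have hsec' : 1 - δ < f 1 := by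
    have e := congrFun h1 1
    have : (α 1)⁻¹ * R 1 1 < 0 := mul_neg_of_pos_of_neg (inv_pos.2 (hα 1)) hsec
    simp at e
    linarith
  have hthird' : f 0 + f 1 < γ := by
    have e₀ := congrFun h2 0
    have e₁ := congrFun h2 1
    have : 0 < (α 2)⁻¹ * (R 2 0 + R 2 1) := mul_pos (inv_pos.2 (hα 2)) hthird
    simp at e₀ e₁
    linarith
  obtain ⟨r, s, p, x, U, hr₀, hr₁, hs₁, hp, hx, hx1, hpx, hU, hT, hfU, hpU, hxU, hlow, hrs, hfr⟩ :=
    exists_auxiliary_triangle hδ₀ hδ₁ hf₀ hsec' hf₂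
  obtain ⟨r', s', p', x', V, hr₀', hr₁', hs₁', hp', hx', hx1', hpx', hV, hT', hfV, hpV, hxV, hlow',
      hrs', hfr'⟩ := exists_auxiliary_triangle (f := flipPair.map f) (δ := γ - 1) (by linarith)
    (by linarith) (by simpa [flipPair_map] using hf₀) (by simp [flipPair_map]; linarith)
    (by simp [flipPair_map]; linarith)
  have hray : ∀ (i : Fin 4) (t : ℝ) (q : Fin 2 → ℝ), f + (α i)⁻¹ • R i = q →
      f + (α i / t)⁻¹ • R i = f + t • (q - f) := by
    rintro i t q rfl
    rw [inv_div, add_sub_cancel_left, smul_smul, div_eq_mul_inv]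
  have hpt : ∀ (i : Fin 4) (t : ℝ) (q : Fin 2 → ℝ), 0 < t → f + (α i)⁻¹ • R i = q →
      ∃ t' : ℝ, 0 < t' ∧ f + t • (q - f) = f + t' • R i := fun i t q ht hq =>
    ⟨(α i / t)⁻¹, inv_pos.2 (div_pos (hα i) ht), (hray i t q hq).symm⟩
  have hflip : ∀ (t : ℝ) (q : Fin 2 → ℝ),
      flipPair.map (flipPair.map f + t • (q - flipPair.map f)) = f + t • (flipPair.map q - f) := by
    intro t q
    funext i
    simp only [flipPair_map]
    fin_cases i
    · simp [Matrix.vecHead]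
    · simp [Matrix.vecHead, Matrix.vecTail]; ring
  have hff : flipPair.map (flipPair.map f) = f := flipPair.map_inv f
  have hinf : f ∈ interior (flipPair.map '' V) := by
    rw [← flipPair.image_interior]
    exact ⟨_, hfV, hff⟩
  have hfront : ∀ y ∈ frontier V, flipPair.map y ∈ frontier (flipPair.map '' V) := by
    intro y hy
    rw [← flipPair.image_frontier]
    exact mem_image_of_mem _ hy
  have q0 : flipPair.map ![0, 2] = ![0, 0] := by rw [flipPair_map]; simp
  have q1 : flipPair.map ![1 + δ, 0] = ![1 + δ, 1 - δ] := by rw [flipPair_map]; simp; ring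
  have q2 : flipPair.map ![1 + (γ - 1), 1 - (γ - 1)] = ![γ, 0] := by
    rw [flipPair_map]; simp; ring
  have q3 : flipPair.map ![0, 0] = ![0, 2] := by rw [flipPair_map]; simp
  have q4 : flipPair.map ![1, 1] = ![1, 0] := by rw [flipPair_map]; simp; norm_num
  have hp4 : flipPair.map p' = f + r' • (![0, 0] - f) := by rw [hp', hflip, q0]
  have hx3 : flipPair.map x' = f + s' • (![γ, 0] - f) := by rw [hx', hflip, q2]
  have hVeq : flipPair.map '' V = convexHull ℝ {![0, 2], flipPair.map x', flipPair.map p'} := by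
    rw [hV, AffineMap.image_convexHull, image_insert_eq, image_insert_eq, image_singleton, q3]
    congr 1
    ext y
    simp only [mem_insert_iff, mem_singleton_iff]
    tauto
  -- These are the coefficients of `φ(U)` and `φ(V)`. Two of them agree with `α` in each case: `(γ,
  -- 0)` and `(0, 0)` lie on the side `x₁ = 0` of `U`, while `(0, 2)` and `(1 + δ, 1 - δ)` lie on
  -- the side `x₀ + x₁ = 2` of `V`.
  obtain ⟨β, hβ⟩ : ∃ β, β = ![α 0 / r, α 1 / s, α 2, α 3] := ⟨_, rfl⟩
  obtain ⟨β', hβ'⟩ : ∃ β', β' = ![α 0, α 1, α 2 / s', α 3 / r'] := ⟨_, rfl⟩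
  have hβpos : ∀ i, 0 < β i := by
    intro i
    rw [hβ]
    fin_cases i
    · exact div_pos (hα 0) hr₀
    · exact div_pos (hα 1) (by linarith)
    · exact hα 2
    · exact hα 3
  have hβpos' : ∀ i, 0 < β' i := by
    intro i
    rw [hβ']
    fin_cases i
    · exact hα 0
    · exact hα 1
    · exact div_pos (hα 2) (by linarith)
    · exact div_pos (hα 3) hr₀'
  have u0 : f + (β 0)⁻¹ • R 0 = p := by rw [hβ, hp, ← hray 0 r _ h0]; rfl
  have u1 : f + (β 1)⁻¹ • R 1 = x := by rw [hβ, hx, ← hray 1 s _ h1]; rfl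
  have u2 : f + (β 2)⁻¹ • R 2 = ![γ, 0] := by rw [hβ, ← h2]; rfl
  have u3 : f + (β 3)⁻¹ • R 3 = ![0, 0] := by rw [hβ, ← h3]; rfl
  have v0 : f + (β' 0)⁻¹ • R 0 = ![0, 2] := by rw [hβ', ← h0]; rfl
  have v1 : f + (β' 1)⁻¹ • R 1 = ![1 + δ, 1 - δ] := by rw [hβ', ← h1]; rfl
  have v2 : f + (β' 2)⁻¹ • R 2 = flipPair.map x' := by rw [hβ', hx3, ← hray 2 s' _ h2]; rfl
  have v3 : f + (β' 3)⁻¹ • R 3 = flipPair.map p' := by rw [hβ', hp4, ← hray 3 r' _ h3]; rfl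
  obtain ⟨eU, iU, kU⟩ := phi_of_isT2B hR hβpos (by simp) hU hT hfU (by
      intro i
      match i with
      | 0 => rw [u0]; exact hpU
      | 1 => rw [u1]; exact hxU
      | 2 => rw [u2]; exact hlow γ (by linarith) hγ₂.le
      | 3 => rw [u3]; exact hlow 0 le_rfl (by norm_num)) (by
      rintro y (rfl | rfl | rfl)
      exacts [⟨0, u0⟩, ⟨1, u1⟩, ⟨3, u3⟩])
  obtain ⟨eV, iV, kV⟩ := phi_of_isT2B hR hβpos' (by simp) hVeq (flipPair.isT2B hT') hinf (by
      intro i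
      match i with
      | 0 => rw [v0, ← q3]; exact hfront _ (hlow' 0 le_rfl (by norm_num))
      | 1 => rw [v1, ← q1]; exact hfront _ (hlow' (1 + δ) (by linarith) (by linarith))
      | 2 => rw [v2]; exact hfront _ hxV
      | 3 => rw [v3]; exact hfront _ hpV) (by
      rintro y (rfl | rfl | rfl)
      exacts [⟨0, v0⟩, ⟨2, v2⟩, ⟨3, v3⟩])
  have hvalid := cutValidOn_splitSet_of_standard hα h0 h1 h2 h3 hδ₀ (by linarith) hf₀ hr₀ hr₁ hr₀'
    hr₁' hrs hrs' hfr
  rw [← hβ, ← hβ'] at hvalid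
  refine ⟨U, flipPair.map '' V, ⟨x, p, ?_, hx1, ?_, hpx, hU⟩,
    ⟨flipPair.map x', flipPair.map p', ?_, ?_, ?_, ?_, hVeq⟩, hT, flipPair.isT2B hT', hfU, hinf, ?_⟩
  · rw [hx]; exact hpt 1 s _ (by linarith) h1
  · rw [hp]; exact hpt 0 r _ hr₀ h0
  · rw [hx3]; exact hpt 2 s' _ (by linarith) h2
  · rw [flipPair_map]; simp [hx1']
  · rw [hp4]; exact hpt 3 r' _ hr₀' h3
  · have : flipPair.map p' ∈ (affineSpan ℝ {x', ![1, 1]}).map flipPair.map :=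
      AffineSubspace.mem_map_of_mem _ hpx'
    rwa [AffineSubspace.map_span, image_insert_eq, image_singleton, q4] at this
  · rw [eU, eV]
    exact ⟨iU, iV, kU, kV, hvalid, cutRank_le_max_add_one _ _ hvalid⟩

/-! ### Quadrilaterals and triangles of type `T¹` -/

/-- Every vertex of a convex quadrilateral is the unique minimum of an affine function. -/
lemma IsQuadrilateral.exists_support {S : Set (Fin 2 → ℝ)} {v : Fin 4 → Fin 2 → ℝ}
    (h : IsQuadrilateral S v) (m : Fin 4) : ∃ c₀ c₁ c₂ : ℝ, c₀ + c₁ * v m 0 + c₂ * v m 1 = 0 ∧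
      ∀ n ≠ m, 0 < c₀ + c₁ * v n 0 + c₂ * v n 1 := by
  have h0 := h.1 0
  have h1 := h.1 1
  have h2 := h.1 2
  have h3 := h.1 3
  simp only [orient, Fin.isValue, zero_add, Fin.reduceAdd] at h0 h1 h2 h3
  -- The zero line passes through `v m` parallel to the diagonal from `v (m + 1)` to `v (m + 3)`.
  -- Its values at the other vertices are sums of the positive orientations.
  refine ⟨v (m + 1) 1 * v m 0 - v (m + 1) 0 * v m 1 + v m 1 * v (m + 3) 0 - v m 0 * v (m + 3) 1,
    v (m + 3) 1 - v (m + 1) 1, v (m + 1) 0 - v (m + 3) 0, by ring, ?_⟩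
  intro n hn
  fin_cases m <;> fin_cases n <;> first | exact absurd rfl hn | (simp; linarith)

/-- By `exists_support` the four vertices are distinct extreme points, and extreme points of a hull
belong to the generating set, which here has at most three points. -/
lemma IsQuadrilateral.ne_convexHull_range {S : Set (Fin 2 → ℝ)} {v : Fin 4 → Fin 2 → ℝ}
    (h : IsQuadrilateral S v) (t : Fin 3 → Fin 2 → ℝ) : S ≠ convexHull ℝ (range t) := by
  intro hS
  have hv : ∀ m, v m ∈ range t := by
    intro m
    obtain ⟨c₀, c₁, c₂, hm, hn⟩ := h.exists_support m
    refine extremePoints_convexHull_subset (𝕜 := ℝ) ?_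
    have hmem : v m ∈ convexHull ℝ (range t) := by
      rw [← hS, h.2]
      exact subset_convexHull ℝ _ (mem_range_self m)
    have hconv : Convex ℝ {x : Fin 2 → ℝ | x = v m ∨ 0 < c₀ + c₁ * x 0 + c₂ * x 1} := by
      refine convex_iff_forall_pos.2 fun x hx y hy a b ha hb hab => ?_
      have e := isAff_coord c₀ c₁ c₂ x y a b hab
      simp only [mem_ofPred_eq] at hx hy e ⊢
      rcases hx with rfl | hx
      · rcases hy with rfl | hy
        · left; rw [← add_smul, hab, one_smul]
        · right; rw [e, hm]; nlinarith [mul_pos hb hy]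
      · right
        rw [e]
        rcases hy with rfl | hy
        · rw [hm]; nlinarith [mul_pos ha hx]
        · nlinarith [mul_pos ha hx, mul_pos hb hy]
    have hsub : convexHull ℝ (range t) ⊆
        {x : Fin 2 → ℝ | x = v m ∨ 0 < c₀ + c₁ * x 0 + c₂ * x 1} := by
      rw [← hS, h.2]
      refine convexHull_min ?_ hconv
      rintro _ ⟨n, rfl⟩
      rcases eq_or_ne n m with rfl | hnm
      · exact Or.inl rfl
      · exact Or.inr (hn n hnm)
    refine ⟨hmem, fun x hx y hy => ?_⟩
    rintro ⟨a, b, ha, hb, hab, hxy⟩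
    have e := isAff_coord c₀ c₁ c₂ x y a b hab
    rw [hxy] at e
    simp only [hm] at e
    rcases hsub hx with hx | hx
    · exact hx
    · exfalso
      have h₁ := mul_pos ha hx
      rcases hsub hy with hy | hy
      · rw [hy, hm] at e; linarith
      · have h₂ := mul_pos hb hy
        linarith
  choose g hg using hv
  have hinj : Function.Injective g := by
    intro m n hmn
    by_contra hne
    obtain ⟨c₀, c₁, c₂, hm, hn⟩ := h.exists_support m
    have := hn n (Ne.symm hne)
    rw [← hg n, ← hmn, hg m, hm] at this
    exact lt_irrefl _ this
  have := Fintype.card_le_of_injective g hinj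
  simp at this

/-- A bounded induced set has only positive coefficients. -/
lemma pos_of_isBounded_inducedSet {k : ℕ} {f : Fin 2 → ℝ} {R : Fin k → Fin 2 → ℝ} {α : Fin k → ℝ}
    (hR : ∀ i, R i ≠ 0) (hα : ∀ i, 0 ≤ α i) (h : Bornology.IsBounded (inducedSet f R α))
    (i : Fin k) : 0 < α i := by
  refine lt_of_le_of_ne (hα i) fun h0 => ?_
  obtain ⟨C, hC⟩ := h.exists_norm_le
  have hRi : 0 < ‖R i‖ := norm_pos_iff.2 (hR i)
  have hmem : ∀ t : ℝ, 0 ≤ t → f + t • R i ∈ inducedSet f R α := fun t ht =>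
    ⟨f, subset_convexHull ℝ _ (Or.inr rfl), t • R i,
      Submodule.smul_mem _ (⟨t, ht⟩ : {c : ℝ // 0 ≤ c}) (Submodule.subset_span ⟨i, h0.symm, rfl⟩),
      rfl⟩
  have hC₀ : 0 ≤ C := (norm_nonneg _).trans (hC _ (hmem 0 le_rfl))
  have ht : 0 ≤ (C + ‖f‖ + 1) / ‖R i‖ := by positivity
  have h1 := hC _ (hmem _ ht)
  have h2 : ‖((C + ‖f‖ + 1) / ‖R i‖) • R i‖ = C + ‖f‖ + 1 := by
    rw [norm_smul, Real.norm_of_nonneg ht, div_mul_cancel₀ _ hRi.ne']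
  have h3 := norm_sub_le (f + ((C + ‖f‖ + 1) / ‖R i‖) • R i) f
  rw [add_sub_cancel_left, h2] at h3
  linarith

/-- The lattice point inside a segment between lattice points is the midpoint. -/
lemma OneInside.exists_midpoint {a b : Fin 2 → ℤ}
    (h : OneInside (fun i => (a i : ℝ)) (fun i => (b i : ℝ))) :
    ∃ d : Fin 2 → ℤ, (∀ i, b i = a i + 2 * d i) ∧ ∀ t : ℝ, 0 < t → t < 2 →
      (fun i => a i + t * d i : Fin 2 → ℝ) ∈ latticePoints → t = 1 ∨ d = 0 := by
  obtain ⟨p, ⟨hp, z, rfl⟩, hu⟩ := h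
  obtain ⟨s, hs₀, hs₁, hs⟩ := mem_openSegment_coord.1 hp
  -- The reflection of the lattice point in the midpoint is again a lattice point inside the
  -- segment, so uniqueness makes them equal.
  have hq := hu (fun i => ((a i + b i - z i : ℤ) : ℝ)) ⟨mem_openSegment_coord.2
    ⟨1 - s, by linarith, by linarith, fun i => by push_cast; rw [hs i]; ring⟩, _, rfl⟩
  have hd : ∀ i, b i = a i + 2 * (z i - a i) := by
    intro i
    have := congrFun hq i
    have : a i + b i - z i = z i := by exact_mod_cast this
    omega
  refine ⟨fun i => z i - a i, hd, fun t ht₀ ht₂ ht => ?_⟩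
  have := hu _ ⟨mem_openSegment_coord.2 ⟨t / 2, by linarith, by linarith, fun i => ?_⟩, ht⟩
  · by_contra hcon
    push Not at hcon
    refine hcon.2 (funext fun i => ?_)
    have e := congrFun this i
    push_cast at e
    have : (t - 1) * ((z i : ℝ) - a i) = 0 := by linear_combination e
    have h0 := (mul_eq_zero.1 this).resolve_left (sub_ne_zero.2 hcon.1)
    change z i - a i = 0
    exact_mod_cast h0
  · have := hd i
    have hb : (b i : ℝ) = a i + 2 * (z i - a i) := by exact_mod_cast this
    rw [hb]
    push_cast
    ring

/-- A lattice-free triangle with integral vertices and one lattice point inside each of two sides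
is unimodularly equivalent to `(0, 0), (0, 2), (2, 0)`. -/
lemma exists_unimodular_coords {T : Set (Fin 2 → ℝ)} {a b c : Fin 2 → ℤ} (hfree : LatticeFree T)
    (hT : T = convexHull ℝ {fun i => (a i : ℝ), fun i => (b i : ℝ), fun i => (c i : ℝ)})
    (haff : AffineIndependent ℝ ![fun i => (a i : ℝ), fun i => (b i : ℝ), fun i => (c i : ℝ)])
    (hab : OneInside (fun i => (a i : ℝ)) (fun i => (b i : ℝ)))
    (hac : OneInside (fun i => (a i : ℝ)) (fun i => (c i : ℝ))) :
    ∃ (M : Matrix (Fin 2) (Fin 2) ℤ) (w : Fin 2 → ℤ), IsUnit M.det ∧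
      intAffine M w (fun i => (a i : ℝ)) = ![0, 0] ∧
      intAffine M w (fun i => (b i : ℝ)) = ![0, 2] ∧
      intAffine M w (fun i => (c i : ℝ)) = ![2, 0] := by
  obtain ⟨d, hd, hd'⟩ := hab.exists_midpoint
  obtain ⟨e, he, he'⟩ := hac.exists_midpoint
  have hb : ∀ i, (b i : ℝ) = a i + 2 * d i := fun i => by exact_mod_cast hd i
  have hc : ∀ i, (c i : ℝ) = a i + 2 * e i := fun i => by exact_mod_cast he i
  have hd0 : d ≠ 0 := by
    rintro rfl
    have := haff.injective (a₁ := 0) (a₂ := 1) (funext fun i => by simp [hb])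
    simp at this
  have he0 : e ≠ 0 := by
    rintro rfl
    have := haff.injective (a₁ := 0) (a₂ := 2) (funext fun i => by simp [hc])
    simp at this
  obtain ⟨D, hD⟩ : ∃ D : ℝ, D = e 0 * d 1 - e 1 * d 0 := ⟨_, rfl⟩
  have hD0 : D ≠ 0 := by
    intro h0
    have hne : (d 1 : ℝ) ≠ 0 ∨ -(d 0 : ℝ) ≠ 0 := by
      by_contra hcon
      push Not at hcon
      refine hd0 (funext fun i => ?_)
      match i with
      | 0 => exact_mod_cast neg_eq_zero.1 hcon.2
      | 1 => exact_mod_cast hcon.1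
    refine haff.not_line (c₀ := -(d 1 * a 0) + d 0 * a 1) hne fun i => ?_
    match i with
    | 0 => simp
    | 1 => simp [hb]; linarith
    | 2 => simp [hc]; linarith
  have hint : ∀ s t : ℝ, 0 < s → 0 < t → s + t < 2 →
      (fun i => a i + s * e i + t * d i : Fin 2 → ℝ) ∈ interior T := by
    intro s t hs ht hst
    obtain ⟨S, hS⟩ : ∃ S : (Fin 2 → ℝ) → ℝ,
      S = fun x => ((x 0 - a 0) * d 1 - (x 1 - a 1) * d 0) / D := ⟨_, rfl⟩
    obtain ⟨S', hS'⟩ : ∃ S' : (Fin 2 → ℝ) → ℝ,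
      S' = fun x => (e 0 * (x 1 - a 1) - e 1 * (x 0 - a 0)) / D := ⟨_, rfl⟩
    have hSc : Continuous S := by rw [hS]; fun_prop
    have hSc' : Continuous S' := by rw [hS']; fun_prop
    have hopen : IsOpen {x | 0 < S x ∧ 0 < S' x ∧ S x + S' x < 2} := by
      simp only [Set.ofPred_and]
      refine IsOpen.inter ?_ (IsOpen.inter ?_ ?_) <;> exact isOpen_lt (by fun_prop) (by fun_prop)
    refine interior_maximal (fun x hx => ?_) hopen ⟨?_, ?_, ?_⟩
    · have := mem_convexHull_triple (p := fun i => (a i : ℝ)) (q := fun i => (b i : ℝ))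
        (r := fun i => (c i : ℝ)) (a := 1 - (S x + S' x) / 2) (b := S' x / 2) (c := S x / 2)
        (by linarith [hx.2.2]) (by linarith [hx.2.1]) (by linarith [hx.1]) (by ring)
      rw [hT]
      convert this using 1
      have e₀ : x 0 = a 0 + S x * e 0 + S' x * d 0 := by
        rw [hS, hS']; field_simp; rw [hD]; ring
      have e₁ : x 1 = a 1 + S x * e 1 + S' x * d 1 := by
        rw [hS, hS']; field_simp; rw [hD]; ring
      funext i
      match i with
      | 0 => simp only [Pi.add_apply, Pi.smul_apply, smul_eq_mul, hb, hc]; rw [e₀]; ring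
      | 1 => simp only [Pi.add_apply, Pi.smul_apply, smul_eq_mul, hb, hc]; rw [e₁]; ring
    all_goals
      have e₁ : S (fun i => a i + s * e i + t * d i) = s := by
        simp only [hS]; field_simp; rw [hD]; ring
      have e₂ : S' (fun i => a i + s * e i + t * d i) = t := by
        simp only [hS']; field_simp; rw [hD]; ring
      simp only [e₁, e₂]
      assumption
  -- The half-edges `e, d` generate the lattice. Otherwise reducing coefficients modulo `1` leaves a
  -- lattice point in the half-open parallelogram other than `a`, which is either interior to the
  -- triangle or a second one inside a side.
  have hgen : ∀ z : Fin 2 → ℤ, ∃ s t : ℤ, ∀ i, z i = s * e i + t * d i := by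
    intro z
    obtain ⟨s, hs⟩ : ∃ s : ℝ, s = (z 0 * d 1 - z 1 * d 0) / D := ⟨_, rfl⟩
    obtain ⟨t, ht⟩ : ∃ t : ℝ, t = (e 0 * z 1 - e 1 * z 0) / D := ⟨_, rfl⟩
    have hz : ∀ i, (z i : ℝ) = s * e i + t * d i := by
      intro i
      match i with
      | 0 => rw [hs, ht]; field_simp; rw [hD]; ring
      | 1 => rw [hs, ht]; field_simp; rw [hD]; ring
    have hlat : (fun i => a i + Int.fract s * e i + Int.fract t * d i : Fin 2 → ℝ) ∈
        latticePoints := by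
      refine ⟨fun i => a i + z i - ⌊s⌋ * e i - ⌊t⌋ * d i, funext fun i => ?_⟩
      push_cast
      rw [hz i, Int.fract, Int.fract]
      ring
    have key : Int.fract s = 0 ∧ Int.fract t = 0 := by
      have s₁ := Int.fract_lt_one s
      have t₁ := Int.fract_lt_one t
      rcases (Int.fract_nonneg s).eq_or_lt with s₀ | s₀
      · rcases (Int.fract_nonneg t).eq_or_lt with t₀ | t₀
        · exact ⟨s₀.symm, t₀.symm⟩
        · rw [← s₀] at hlat
          simp only [zero_mul, add_zero] at hlat
          rcases hd' _ t₀ (by linarith) hlat with h | h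
          · exact absurd h t₁.ne
          · exact absurd h hd0
      · rcases (Int.fract_nonneg t).eq_or_lt with t₀ | t₀
        · rw [← t₀] at hlat
          simp only [zero_mul, add_zero] at hlat
          rcases he' _ s₀ (by linarith) hlat with h | h
          · exact absurd h s₁.ne
          · exact absurd h he0
        · exact (Set.disjoint_left.1 hfree (hint _ _ s₀ t₀ (by linarith)) hlat).elim
    refine ⟨⌊s⌋, ⌊t⌋, fun i => ?_⟩
    have h1 : s = ⌊s⌋ := by linarith [Int.floor_add_fract s, key.1]
    have h2 : t = ⌊t⌋ := by linarith [Int.floor_add_fract t, key.2]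
    have := hz i
    rw [h1, h2] at this
    exact_mod_cast this
  obtain ⟨s₀, t₀, h0⟩ := hgen ![1, 0]
  obtain ⟨s₁, t₁, h1⟩ := hgen ![0, 1]
  have hBM : !![e 0, d 0; e 1, d 1] * !![s₀, s₁; t₀, t₁] = (1 : Matrix (Fin 2) (Fin 2) ℤ) := by
    have a₁ := h0 0
    have a₂ := h0 1
    have a₃ := h1 0
    have a₄ := h1 1
    simp only [Matrix.cons_val_zero, Matrix.cons_val_one, Matrix.cons_val_fin_one] at a₁ a₂ a₃ a₄
    rw [Matrix.mul_fin_two, Matrix.one_fin_two, mul_comm (e 0), mul_comm (e 0), mul_comm (e 1),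
      mul_comm (e 1), mul_comm (d 0), mul_comm (d 0), mul_comm (d 1), mul_comm (d 1), ← a₁, ← a₂,
      ← a₃, ← a₄]
  have hMB := mul_eq_one_comm.1 hBM
  rw [Matrix.mul_fin_two, Matrix.one_fin_two] at hMB
  have b₁ : (s₀ * e 0 + s₁ * e 1 : ℝ) = 1 := by exact_mod_cast congrFun₂ hMB 0 0
  have b₂ : (s₀ * d 0 + s₁ * d 1 : ℝ) = 0 := by exact_mod_cast congrFun₂ hMB 0 1
  have b₃ : (t₀ * e 0 + t₁ * e 1 : ℝ) = 0 := by exact_mod_cast congrFun₂ hMB 1 0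
  have b₄ : (t₀ * d 0 + t₁ * d 1 : ℝ) = 1 := by exact_mod_cast congrFun₂ hMB 1 1
  have happ : ∀ x : Fin 2 → ℝ, intAffine !![s₀, s₁; t₀, t₁] (-a) x =
      ![s₀ * (x 0 - a 0) + s₁ * (x 1 - a 1), t₀ * (x 0 - a 0) + t₁ * (x 1 - a 1)] := by
    intro x
    funext i
    fin_cases i <;> simp [intAffine, Matrix.mulVec, dotProduct, Fin.sum_univ_two, sub_eq_add_neg]
  refine ⟨!![s₀, s₁; t₀, t₁], -a, Matrix.isUnit_det_of_left_inverse hBM, ?_, ?_, ?_⟩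
  · rw [happ]; simp
  · rw [happ, hb, hb]
    funext i
    fin_cases i
    · simp; linear_combination 2 * b₂
    · simp; linear_combination 2 * b₄
  · rw [happ, hc, hc]
    funext i
    fin_cases i
    · simp; linear_combination 2 * b₁
    · simp; linear_combination 2 * b₃

/-! ### Reduction to standard position -/

/-- A cut whose points `f + rⁱ / αᵢ` are mapped by a lattice map into the induced set of another cut
has at most the split rank of that cut. -/
lemma cutRank_le_of_mapsTo {k k' : ℕ} {f : Fin 2 → ℝ} {R : Fin k → Fin 2 → ℝ} {α : Fin k → ℝ}
    {R' : Fin k' → Fin 2 → ℝ} {α' : Fin k' → ℝ} (hα : ∀ i, 0 < α i)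
    (M : Matrix (Fin 2) (Fin 2) ℤ) (c : Fin 2 → ℤ)
    (h : ∀ i, ∃ w : Fin k' → ℝ, (∀ j, 0 ≤ w j) ∧
      latMap M c (f + (α i)⁻¹ • R i) = latMap M c f + ∑ j, w j • R' j ∧ ∑ j, α' j * w j ≤ 1) :
    cutRank f R α ≤ cutRank (latMap M c f) R' α' := by
  choose w hw hwR hwα using h
  -- The amount `αᵢ sᵢ` on ray `i` is distributed over the new rays with weights `w i`. As `∑ α'ⱼ wⱼ
  -- ≤ 1`, the new cut expression never exceeds the old one.
  let A : (Fin k → ℝ) →ₗ[ℝ] (Fin k' → ℝ) :=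
    LinearMap.pi fun j => ∑ i, (α i * w i j) • LinearMap.proj i
  have hA : ∀ (s : Fin k → ℝ) (j : Fin k'), A s j = ∑ i, α i * w i j * s i := fun s j => by
    simp [A, LinearMap.sum_apply]
  have hcol : ∀ i l, ∑ j : Fin 2, (M l j : ℝ) * R i j = α i * ∑ j, w i j * R' j l := by
    intro i l
    have e := congrFun (hwR i) l
    simp only [latMap_apply, Finset.sum_apply, Pi.add_apply, Pi.smul_apply, smul_eq_mul] at e
    have e' : (α i)⁻¹ * ∑ j : Fin 2, (M l j : ℝ) * R i j = ∑ j, w i j * R' j l := by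
      rw [Fin.sum_univ_two]
      linarith
    rw [← e', mul_inv_cancel_left₀ (hα i).ne']
  have hmaps : MapsTo (fun z : (Fin 2 → ℝ) × (Fin k → ℝ) =>
      ((fun i => (M i 0 : ℝ) * z.1 0 + M i 1 * z.1 1 + c i : Fin 2 → ℝ), A z.2))
      (relaxP f R) (relaxP (latMap M c f) R') := by
    intro z hz
    refine ⟨funext fun l => ?_, fun j => ?_⟩
    · simp only [Pi.add_apply, Finset.sum_apply, Pi.smul_apply, smul_eq_mul, latMap_apply, hA]
      rw [relaxP_coord hz 0, relaxP_coord hz 1]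
      have e₁ : ∑ j, (∑ i, α i * w i j * z.2 i) * R' j l =
          ∑ i, z.2 i * (α i * ∑ j, w i j * R' j l) := by
        simp only [Finset.sum_mul, Finset.mul_sum]
        rw [Finset.sum_comm]
        exact Finset.sum_congr rfl fun i _ => Finset.sum_congr rfl fun j _ => by ring
      have e₂ : ∑ i, z.2 i * (α i * ∑ j, w i j * R' j l) =
          M l 0 * ∑ i, z.2 i * R i 0 + M l 1 * ∑ i, z.2 i * R i 1 := by
        simp only [← hcol, Fin.sum_univ_two, Finset.mul_sum]
        rw [← Finset.sum_add_distrib]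
        exact Finset.sum_congr rfl fun i _ => by ring
      rw [e₁, e₂]
      ring
    · change 0 ≤ A z.2 j
      rw [hA]
      exact Finset.sum_nonneg fun i _ => mul_nonneg (mul_nonneg (hα i).le (hw i j)) (hz.2 i)
  refine cutRank_le_of_forall fun n hn => ?_
  rw [cutValidOn_iff] at hn ⊢
  intro z hz
  have h1 := hn _ ((isSplitMap_intMap M c A).mapsTo_iterSplitClosure hmaps n hz)
  have hz0 : z ∈ relaxP f R := iterSplitClosure_antitone (convex_relaxP f R) (Nat.zero_le n) hz
  refine h1.trans ?_
  simp only [hA, Finset.mul_sum]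
  rw [Finset.sum_comm]
  refine Finset.sum_le_sum fun i _ => ?_
  have e : ∑ j, α' j * (α i * w i j * z.2 i) = α i * z.2 i * ∑ j, α' j * w i j := by
    rw [Finset.mul_sum]
    exact Finset.sum_congr rfl fun j _ => by ring
  rw [e]
  exact mul_le_of_le_one_right (mul_nonneg (hα i).le (hz0.2 i)) (hwα i)

/-- The vertices of the standard quadrilateral with `δ = γ - 1`. -/
def standardVertex (γ : ℝ) : Fin 4 → Fin 2 → ℝ := ![![0, 2], ![γ, 2 - γ], ![γ, 0], ![0, 0]]

lemma exists_weights_standardVertex {γ : ℝ} (h₀ : 0 < γ) (h₂ : γ < 2) {x : Fin 2 → ℝ}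
    (hx₀ : 0 ≤ x 0) (hxγ : x 0 ≤ γ) (hx₁ : 0 ≤ x 1) (hx : x 0 + x 1 ≤ 2) :
    ∃ w : Fin 4 → ℝ, (∀ j, 0 ≤ w j) ∧ ∑ j, w j = 1 ∧ x = ∑ j, w j • standardVertex γ j := by
  -- Product weights on the trapezoid: `p` is the horizontal position and `t` the relative height in
  -- the vertical section `0 ≤ x₁ ≤ 2 - x₀`.
  obtain ⟨p, hp⟩ : ∃ p, p = x 0 / γ := ⟨_, rfl⟩
  obtain ⟨t, ht⟩ : ∃ t, t = x 1 / (2 - x 0) := ⟨_, rfl⟩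
  have hden : 0 < 2 - x 0 := by linarith
  have hp₀ : 0 ≤ p := by rw [hp]; positivity
  have hp₁ : 0 ≤ 1 - p := by rw [hp, sub_nonneg, div_le_one h₀]; exact hxγ
  have ht₀ : 0 ≤ t := by rw [ht]; exact div_nonneg hx₁ hden.le
  have ht₁ : 0 ≤ 1 - t := by rw [ht, sub_nonneg, div_le_one hden]; linarith
  have hpx : p * γ = x 0 := by rw [hp, div_mul_cancel₀ _ h₀.ne']
  have htx : t * (2 - x 0) = x 1 := by rw [ht, div_mul_cancel₀ _ hden.ne']
  refine ⟨![(1 - p) * t, p * t, p * (1 - t), (1 - p) * (1 - t)], ?_, ?_, ?_⟩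
  · intro j
    fin_cases j
    · exact mul_nonneg hp₁ ht₀
    · exact mul_nonneg hp₀ ht₀
    · exact mul_nonneg hp₀ ht₁
    · exact mul_nonneg hp₁ ht₁
  · simp [Fin.sum_univ_four]; ring
  · funext i
    match i with
    | 0 =>
      simp [Fin.sum_univ_four, standardVertex]
      linear_combination -hpx
    | 1 =>
      simp [Fin.sum_univ_four, standardVertex]
      linear_combination -htx + t * hpx

/-- Rays from a point to the vertices of the standard quadrilateral. -/
lemma exists_weights_rays {γ : ℝ} (h₀ : 0 < γ) (h₂ : γ < 2) (f : Fin 2 → ℝ) {x : Fin 2 → ℝ}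
    (hx₀ : 0 ≤ x 0) (hxγ : x 0 ≤ γ) (hx₁ : 0 ≤ x 1) (hx : x 0 + x 1 ≤ 2) :
    ∃ w : Fin 4 → ℝ, (∀ j, 0 ≤ w j) ∧ ∑ j, w j = 1 ∧
      x = f + ∑ j, w j • (standardVertex γ j - f) := by
  obtain ⟨w, hw, hw1, hwx⟩ := exists_weights_standardVertex h₀ h₂ hx₀ hxγ hx₁ hx
  refine ⟨w, hw, hw1, ?_⟩
  simp only [smul_sub, Finset.sum_sub_distrib]
  rw [← Finset.sum_smul, hw1, one_smul, ← hwx]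
  abel

/-- A rational point inside the standard quadrilateral, with the rays to the vertices, is in standard
position. -/
lemma isStandardQ1_of_coords {γ : ℚ} {f : Fin 2 → ℝ} (h₁ : (1 : ℝ) < γ) (h₂ : (γ : ℝ) < 2)
    (hf : IsRationalVec f) (hf' : f ∉ latticePoints) (hf₀ : 0 < f 0) (hf₁ : 0 < f 1)
    (hfγ : f 0 + f 1 < γ) (hfγ' : 2 - f 1 < γ) :
    IsStandardQ1 f (fun j => standardVertex γ j - f) (fun _ => 1) := by
  have hv : ∀ j, f + (1 : ℝ)⁻¹ • (standardVertex γ j - f) = standardVertex γ j := by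
    intro j
    rw [inv_one, one_smul, add_sub_cancel]
  refine ⟨⟨hf, hf', ?_, ?_, ?_⟩, fun _ => one_pos, ⟨γ - 1, γ, by linarith, by linarith, h₁, h₂,
    hv 0, (hv 1).trans ?_, hv 2, hv 3⟩, ?_, ?_⟩
  · obtain ⟨z, rfl⟩ := hf
    intro j
    have : ∃ y : Fin 4 → Fin 2 → ℚ, ∀ j, standardVertex γ j = fun i => (y j i : ℝ) := by
      refine ⟨![![0, 2], ![γ, 2 - γ], ![γ, 0], ![0, 0]], fun j => funext fun i => ?_⟩
      fin_cases j <;> fin_cases i <;> simp [standardVertex]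
    obtain ⟨y, hy⟩ := this
    exact ⟨fun i => y j i - z i, by rw [hy]; funext i; simp⟩
  · intro j hj
    have hj' := sub_eq_zero.1 hj
    have e₀ := congrFun hj' 0
    have e₁ := congrFun hj' 1
    match j with
    | 0 => simp [standardVertex] at e₀; linarith
    | 1 => simp [standardVertex] at e₁; linarith
    | 2 => simp [standardVertex] at e₁; linarith
    | 3 => simp [standardVertex] at e₀; linarith
  · rw [Submodule.eq_top_iff']
    intro d
    -- Since `f` is interior to the quadrilateral, `f + ε d` stays in it for small `ε > 0`. Its
    -- weights, divided by `ε`, express `d` through the rays.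
    have hev : ∀ᶠ ε : ℝ in nhdsWithin 0 (Ioi 0), 0 < (f + ε • d) 0 ∧ (f + ε • d) 0 < γ ∧
        0 < (f + ε • d) 1 ∧ (f + ε • d) 0 + (f + ε • d) 1 < 2 := by
      refine Filter.Eventually.filter_mono nhdsWithin_le_nhds ?_
      have hopen : IsOpen {ε : ℝ | 0 < (f + ε • d) 0 ∧ (f + ε • d) 0 < γ ∧
          0 < (f + ε • d) 1 ∧ (f + ε • d) 0 + (f + ε • d) 1 < 2} := by
        simp only [Set.ofPred_and, Pi.add_apply, Pi.smul_apply, smul_eq_mul]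
        refine IsOpen.inter ?_ (IsOpen.inter ?_ (IsOpen.inter ?_ ?_)) <;>
          exact isOpen_lt (by fun_prop) (by fun_prop)
      refine hopen.mem_nhds ⟨?_, ?_, ?_, ?_⟩ <;> simp <;> linarith
    obtain ⟨ε, ⟨a₁, a₂, a₃, a₄⟩, hε⟩ := (hev.and self_mem_nhdsWithin).exists
    have hε' : (0 : ℝ) < ε := hε
    obtain ⟨w, hw, -, hwx⟩ := exists_weights_rays (by linarith) h₂ f a₁.le a₂.le a₃.le a₄.le
    have hd : d = ∑ j, (ε⁻¹ * w j) • (standardVertex γ j - f) := by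
      have := add_left_cancel hwx
      simp only [mul_smul]
      rw [← Finset.smul_sum, ← this, smul_smul, inv_mul_cancel₀ hε'.ne', one_smul]
    rw [hd]
    exact Submodule.sum_mem _ fun j _ => Submodule.smul_mem _
      (⟨ε⁻¹ * w j, mul_nonneg (inv_pos.2 hε').le (hw j)⟩ : {c : ℝ // 0 ≤ c})
      (Submodule.subset_span (mem_range_self j))
  · funext i
    fin_cases i
    · simp [standardVertex]
    · simp [standardVertex]; ring
  · simp [standardVertex]; linarith
  · simp [standardVertex]; linarith

/-- The reduction for a triangle with distinguished vertex `c` outside the induced set. -/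
lemma exists_standard_of_vertex {k : ℕ} {f : Fin 2 → ℝ} {R : Fin k → Fin 2 → ℝ} {α : Fin k → ℝ}
    (hdata : IsPlaneData f R) (hα : ∀ i, 0 < α i) (hL : IsCompact (inducedSet f R α))
    {T : Set (Fin 2 → ℝ)} (hLT : inducedSet f R α ⊆ T) {a b c : Fin 2 → ℤ} (hfree : LatticeFree T)
    (hT : T = convexHull ℝ {fun i => (a i : ℝ), fun i => (b i : ℝ), fun i => (c i : ℝ)})
    (haff : AffineIndependent ℝ ![fun i => (a i : ℝ), fun i => (b i : ℝ), fun i => (c i : ℝ)])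
    (hab : OneInside (fun i => (a i : ℝ)) (fun i => (b i : ℝ)))
    (hac : OneInside (fun i => (a i : ℝ)) (fun i => (c i : ℝ)))
    (hc : (fun i => (c i : ℝ)) ∉ inducedSet f R α) :
    ∃ (M : Matrix (Fin 2) (Fin 2) ℤ) (w : Fin 2 → ℤ)
      (R' : Fin 4 → Fin 2 → ℝ) (α' : Fin 4 → ℝ),
      IsUnit M.det ∧
      IsStandardQ1 (intAffine M w f) R' α' ∧
      intAffine M w '' inducedSet f R α ⊆ inducedSet (intAffine M w f) R' α' ∧
      cutRank f R α ≤ cutRank (intAffine M w f) R' α' := by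
  obtain ⟨M, w, hM, ha', hb', hc'⟩ := exists_unimodular_coords hfree hT haff hab hac
  obtain ⟨φ, hφM, hφc⟩ := LatPair.exists_of_isUnit M (M.mulVec w) hM
  have hφ : (intAffine M w : (Fin 2 → ℝ) → Fin 2 → ℝ) = φ.map := by
    rw [intAffine_eq_latMap, LatPair.map, hφM, hφc]
  have hmem : ∀ i, f + (α i)⁻¹ • R i ∈ inducedSet f R α := fun i => by
    rw [inducedSet_of_pos hα]
    exact subset_convexHull ℝ _ (Or.inl ⟨i, rfl⟩)
  have hfL : f ∈ inducedSet f R α := by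
    rw [inducedSet_of_pos hα]
    exact subset_convexHull ℝ _ (Or.inr rfl)
  rw [hφ] at ha' hb' hc'
  have hTimg : φ.map '' T = convexHull ℝ {![0, 0], ![0, 2], ![2, 0]} := by
    rw [hT, AffineMap.image_convexHull, image_insert_eq, image_insert_eq, image_singleton, ha', hb',
      hc']
  have hTc : ∀ x ∈ T, 0 ≤ φ.map x 0 ∧ 0 ≤ φ.map x 1 ∧ φ.map x 0 + φ.map x 1 ≤ 2 := by
    intro x hx
    have hx' : φ.map x ∈ convexHull ℝ {![0, 0], ![0, 2], ![2, 0]} := hTimg ▸ mem_image_of_mem _ hx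
    have e₁ := aff_nonneg_of_mem_convexHull 0 1 0 (by rintro y (rfl | rfl | rfl) <;> simp) hx'
    have e₂ := aff_nonneg_of_mem_convexHull 0 0 1 (by rintro y (rfl | rfl | rfl) <;> simp) hx'
    have e₃ := aff_nonneg_of_mem_convexHull 2 (-1) (-1)
      (by rintro y (rfl | rfl | rfl) <;> simp) hx'
    exact ⟨by linarith, by linarith, by linarith⟩
  have happ : ∀ x i, φ.map x i = M i 0 * x 0 + M i 1 * x 1 + φ.c i := by
    intro x i
    rw [LatPair.map, latMap_apply, hφM]
  have hdet : ((M 0 0 * M 1 1 - M 0 1 * M 1 0 : ℤ) : ℝ) ≠ 0 := by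
    rw [← Matrix.det_fin_two]
    exact_mod_cast hM.ne_zero
  push_cast at hdet
  have hpos : ∀ c₀ c₁ c₂ : ℝ, (c₁ ≠ 0 ∨ c₂ ≠ 0) →
      (∀ x ∈ T, 0 ≤ c₀ + c₁ * φ.map x 0 + c₂ * φ.map x 1) →
      0 < c₀ + c₁ * φ.map f 0 + c₂ * φ.map f 1 := by
    intro c₀ c₁ c₂ hne hnn
    have e : ∀ x, c₀ + c₁ * φ.map x 0 + c₂ * φ.map x 1 = (c₀ + c₁ * φ.c 0 + c₂ * φ.c 1) +
        (c₁ * M 0 0 + c₂ * M 1 0) * x 0 + (c₁ * M 0 1 + c₂ * M 1 1) * x 1 := by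
      intro x
      rw [happ, happ]
      ring
    rw [e]
    refine pos_of_hull_eq_top hdata.cone_eq_top hα ?_ fun i => ?_
    · by_contra hcon
      push Not at hcon
      obtain ⟨k₁, k₂⟩ := hcon
      have d₁ : c₁ * (M 0 0 * M 1 1 - M 0 1 * M 1 0 : ℝ) = 0 := by
        linear_combination M 1 1 * k₁ - M 1 0 * k₂
      have d₂ : c₂ * (M 0 0 * M 1 1 - M 0 1 * M 1 0 : ℝ) = 0 := by
        linear_combination M 0 0 * k₂ - M 0 1 * k₁
      rcases hne with hne | hne
      · exact hne ((mul_eq_zero.1 d₁).resolve_right hdet)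
      · exact hne ((mul_eq_zero.1 d₂).resolve_right hdet)
    · rw [← e]
      exact hnn _ (hLT (hmem i))
  have hf₀ := hpos 0 1 0 (Or.inl one_ne_zero) fun x hx => by linarith [(hTc x hx).1]
  have hf₁ := hpos 0 0 1 (Or.inr one_ne_zero) fun x hx => by linarith [(hTc x hx).2.1]
  have hf₂ := hpos 2 (-1) (-1) (Or.inl (by norm_num)) fun x hx => by linarith [(hTc x hx).2.2]
  have hcont : Continuous fun x => φ.map x 0 := by
    simp only [happ]
    fun_prop
  obtain ⟨y, hyL, hy⟩ := hL.exists_isMaxOn ⟨f, hfL⟩ hcont.continuousOn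
  have hy2 : φ.map y 0 < 2 := by
    obtain ⟨t₀, t₁, t₂⟩ := hTc y (hLT hyL)
    by_contra hcon
    have : φ.map y = φ.map (fun i => (c i : ℝ)) := by
      rw [hc']
      funext i
      fin_cases i
      · simp; linarith
      · simp; linarith
    exact hc (φ.injective this ▸ hyL)
  -- A rational `γ < 2` above all four numbers makes the quadrilateral contain the image, and the
  -- last two bounds give the sign conditions on the second and third rays.
  have hlt : max (max 1 (φ.map y 0)) (max (φ.map f 0 + φ.map f 1) (2 - φ.map f 1)) < 2 := by
    simp only [max_lt_iff]
    exact ⟨⟨by norm_num, hy2⟩, by linarith, by linarith⟩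
  obtain ⟨γ, hγ, hγ₂⟩ := exists_rat_btwn hlt
  simp only [max_lt_iff] at hγ
  obtain ⟨⟨hγ₁, hγy⟩, hγf, hγf'⟩ := hγ
  have hQ : ∀ x ∈ inducedSet f R α, 0 ≤ φ.map x 0 ∧ φ.map x 0 ≤ γ ∧ 0 ≤ φ.map x 1 ∧
      φ.map x 0 + φ.map x 1 ≤ 2 := fun x hx =>
    ⟨(hTc x (hLT hx)).1, (hy hx).trans hγy.le, (hTc x (hLT hx)).2.1, (hTc x (hLT hx)).2.2⟩
  have hrat : IsRationalVec (φ.map f) := by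
    obtain ⟨z, rfl⟩ := hdata.f_rational
    refine ⟨fun i => M i 0 * z 0 + M i 1 * z 1 + φ.c i, funext fun i => ?_⟩
    rw [happ]
    push_cast
    rfl
  have hstd := isStandardQ1_of_coords hγ₁ hγ₂ hrat
    (fun h => hdata.f_notMem (φ.map_mem_iff.1 h)) (by linarith) (by linarith) hγf hγf'
  refine ⟨M, w, fun j => standardVertex γ j - φ.map f, fun _ => 1, hM, ?_, ?_, ?_⟩
  · rw [hφ]; exact hstd
  · rw [hφ, inducedSet_of_pos hstd.pos]
    rintro _ ⟨x, hx, rfl⟩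
    obtain ⟨x₀, x₁, x₂, x₃⟩ := hQ x hx
    obtain ⟨u, hu, hu1, hux⟩ := exists_weights_standardVertex (by linarith) hγ₂ x₀ x₁ x₂ x₃
    rw [hux]
    refine (convex_convexHull ℝ _).sum_mem (fun j _ => hu j) hu1 fun j _ =>
      subset_convexHull ℝ _ (Or.inl ⟨j, ?_⟩)
    simp
  · rw [hφ]
    refine cutRank_le_of_mapsTo hα φ.M φ.c fun i => ?_
    obtain ⟨x₀, x₁, x₂, x₃⟩ := hQ _ (hmem i)
    obtain ⟨u, hu, hu1, hux⟩ := exists_weights_rays (by linarith) hγ₂ (φ.map f) x₀ x₁ x₂ x₃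
    exact ⟨u, hu, hux, by simp [hu1]⟩

/-- A quadrilateral cut inside a triangle of type `T¹` is dominated by one in standard position. -/
theorem exists_standard_of_isT1 {k : ℕ} {f : Fin 2 → ℝ} {R : Fin k → Fin 2 → ℝ} {α : Fin k → ℝ}
    (hdata : IsPlaneData f R) (hα : ∀ i, 0 < α i) {v : Fin 4 → Fin 2 → ℝ}
    (hv : IsQuadrilateral (inducedSet f R α) v) {T : Set (Fin 2 → ℝ)} (hT : IsT1 T)
    (hLT : inducedSet f R α ⊆ T) :
    ∃ (M : Matrix (Fin 2) (Fin 2) ℤ) (w : Fin 2 → ℤ)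
      (R' : Fin 4 → Fin 2 → ℝ) (α' : Fin 4 → ℝ),
      IsUnit M.det ∧
      IsStandardQ1 (intAffine M w f) R' α' ∧
      intAffine M w '' inducedSet f R α ⊆ inducedSet (intAffine M w f) R' α' ∧
      cutRank f R α ≤ cutRank (intAffine M w f) R' α' := by
  have hL : IsCompact (inducedSet f R α) := by
    rw [hv.2]
    exact (finite_range v).isCompact_convexHull ℝ
  have hLc : Convex ℝ (inducedSet f R α) := by
    rw [hv.2]
    exact convex_convexHull ℝ _
  obtain ⟨hfree, t, ⟨haff, hTt⟩, hlat, h01, h12, h20⟩ := hT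
  have hsymm : ∀ {x y : Fin 2 → ℝ}, OneInside x y → OneInside y x := by
    intro x y h
    rwa [OneInside, openSegment_symm]
  -- If all three vertices of `T` were in the induced set, it would be `T` itself, a triangle.
  obtain ⟨j, hj⟩ : ∃ j, t j ∉ inducedSet f R α := by
    by_contra hcon
    push Not at hcon
    refine hv.ne_convexHull_range t (Subset.antisymm (hTt ▸ hLT) (convexHull_min ?_ hLc))
    rintro _ ⟨j, rfl⟩
    exact hcon j
  have hside : ∀ i : Fin 3, OneInside (t (i + 1)) (t (i + 2)) ∧ OneInside (t (i + 1)) (t i) := by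
    intro i
    match i with
    | 0 => exact ⟨h12, hsymm h01⟩
    | 1 => exact ⟨h20, hsymm h12⟩
    | 2 => exact ⟨h01, hsymm h20⟩
  choose z hz using hlat
  have haff' : AffineIndependent ℝ ![t (j + 1), t (j + 2), t j] := by
    have hinj : ∀ j : Fin 3, Function.Injective ![j + 1, j + 2, j] := by decide
    have := haff.comp_embedding ⟨![j + 1, j + 2, j], hinj j⟩
    convert this using 1
    funext i
    fin_cases i <;> rfl
  have hTt' : T = convexHull ℝ {t (j + 1), t (j + 2), t j} := by
    rw [hTt, range_fin_three]
    congr 1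
    ext x
    match j with
    | 0 => simp; tauto
    | 1 => simp; tauto
    | 2 => simp
  obtain ⟨s₁, s₂⟩ := hside j
  rw [hz (j + 1), hz (j + 2), hz j] at haff' hTt'
  rw [hz (j + 1), hz (j + 2)] at s₁
  rw [hz (j + 1), hz j] at s₂
  rw [hz j] at hj
  exact exists_standard_of_vertex hdata hα hL hLT hfree hTt' haff' s₁ s₂ hj

end

/-! ### Assembly of the two statements -/

theorem mainTheorem5 :
    -- every inequality of type `Q¹` has finite split rank; inside a `T¹` triangle it is dominated,
    -- after a unimodular change of coordinates, by one in standard position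
    (∀ (k : ℕ) (f : Fin 2 → ℝ) (R : Fin k → Fin 2 → ℝ) (α : Fin k → ℝ),
      IsPlaneData f R → (∀ i, 0 ≤ α i) → CutValidOn (convexHull ℝ (mixedP f R)) α →
      IsQ1 (inducedSet f R α) →
        cutRank f R α < ⊤ ∧
        ((∃ T, IsT1 T ∧ inducedSet f R α ⊆ T) →
          ∃ (M : Matrix (Fin 2) (Fin 2) ℤ) (w : Fin 2 → ℤ)
            (R' : Fin 4 → Fin 2 → ℝ) (α' : Fin 4 → ℝ) (U V : Set (Fin 2 → ℝ)),
            IsUnit M.det ∧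
            IsStandardQ1 (intAffine M w f) R' α' ∧
            intAffine M w '' inducedSet f R α ⊆ inducedSet (intAffine M w f) R' α' ∧
            cutRank f R α ≤ cutRank (intAffine M w f) R' α' ∧
            IsTriangleU (intAffine M w f) R' U ∧ IsTriangleV (intAffine M w f) R' V ∧
            cutRank f R α ≤
              max (cutRank (intAffine M w f) R' (phi (intAffine M w f) R' U))
                (cutRank (intAffine M w f) R' (phi (intAffine M w f) R' V)) + 1)) ∧
    -- the rank bound in standard position, through the disjunction `x₁ ≤ 0 ∨ x₁ ≥ 1`
    (∀ (f : Fin 2 → ℝ) (R : Fin 4 → Fin 2 → ℝ) (α : Fin 4 → ℝ), IsStandardQ1 f R α →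
      ∃ U V : Set (Fin 2 → ℝ),
        IsTriangleU f R U ∧ IsTriangleV f R V ∧
        IsT2B U ∧ IsT2B V ∧ f ∈ interior U ∧ f ∈ interior V ∧
        inducedSet f R (phi f R U) = U ∧ inducedSet f R (phi f R V) = V ∧
        cutRank f R (phi f R U) < ⊤ ∧ cutRank f R (phi f R V) < ⊤ ∧
        CutValidOn
          (splitSet
            {z | z ∈ relaxP f R ∧ 1 ≤ ∑ i, phi f R U i * z.2 i ∧ 1 ≤ ∑ i, phi f R V i * z.2 i}
            ![1, 0] 0) α ∧
        cutRank f R α ≤ max (cutRank f R (phi f R U)) (cutRank f R (phi f R V)) + 1) := by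
  refine ⟨fun k f R α hdata hα _ hQ => ?_, fun f R α h => rank_bound_of_isStandardQ1 h⟩
  obtain ⟨⟨T, hT, hLT⟩, v, hv, -⟩ := hQ
  -- A quadrilateral is bounded, so no coefficient can vanish.
  have hpos : ∀ i, 0 < α i := by
    refine pos_of_isBounded_inducedSet (f := f) hdata.R_ne_zero hα ?_
    rw [hv.2]
    exact ((finite_range v).isCompact_convexHull ℝ).isBounded
  have key : ∀ T, IsT1 T → inducedSet f R α ⊆ T → ∃ (M : Matrix (Fin 2) (Fin 2) ℤ) (w : Fin 2 → ℤ)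
      (R' : Fin 4 → Fin 2 → ℝ) (α' : Fin 4 → ℝ) (U V : Set (Fin 2 → ℝ)),
      IsUnit M.det ∧
      IsStandardQ1 (intAffine M w f) R' α' ∧
      intAffine M w '' inducedSet f R α ⊆ inducedSet (intAffine M w f) R' α' ∧
      cutRank f R α ≤ cutRank (intAffine M w f) R' α' ∧
      IsTriangleU (intAffine M w f) R' U ∧ IsTriangleV (intAffine M w f) R' V ∧
      cutRank f R α ≤
        max (cutRank (intAffine M w f) R' (phi (intAffine M w f) R' U))
          (cutRank (intAffine M w f) R' (phi (intAffine M w f) R' V)) + 1 ∧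
      cutRank f R α < ⊤ := by
    intro T hT hLT
    obtain ⟨M, w, R', α', hM, hstd, hsub, hle⟩ := exists_standard_of_isT1 hdata hpos hv hT hLT
    obtain ⟨U, V, hU, hV, -, -, -, -, -, -, hkU, hkV, -, hmax⟩ := rank_bound_of_isStandardQ1 hstd
    refine ⟨M, w, R', α', U, V, hM, hstd, hsub, hle, hU, hV, hle.trans hmax,
      (hle.trans hmax).trans_lt ?_⟩
    exact ENat.add_lt_top.2 ⟨max_lt hkU hkV, ENat.natCast_lt_top 1⟩
  refine ⟨?_, fun ⟨T, hT, hLT⟩ => ?_⟩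
  · rcases hT with hT | hT
    · obtain ⟨_, _, _, _, _, _, -, -, -, -, -, -, -, h⟩ := key T hT hLT
      exact h
    · refine cutRank_lt_top_of_isT2A hdata.cone_eq_top hpos hT fun i => hLT ?_
      rw [inducedSet_of_pos hpos]
      exact subset_convexHull ℝ _ (Or.inl ⟨i, rfl⟩)
  · obtain ⟨M, w, R', α', U, V, h₁, h₂, h₃, h₄, h₅, h₆, h₇, -⟩ := key T hT hLT
    exact ⟨M, w, R', α', U, V, h₁, h₂, h₃, h₄, h₅, h₆, h₇⟩
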